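/- **Model.** For individuals $i=1,2,\dots$ and periods $t=1,2,\dots$ let $W_i\in\mathbb R^d$, $Y_{it}\in\mathbb R$, $X_{it}\in\mathbb R^p$ be observed and $\alpha_i\in\mathbb R$ latent, with the vectors $(W_i,\alpha_i,(Y_{it},X_{it})_{t})$ i.i.d. across $i$, and put $u_{it}=Y_{it}-X_{it}'\beta_0-\alpha_i$. Let $m:\mathbb R^d\times\mathbb R\times\mathbb R^k\to\mathbb R^q$ be a moment function, measurable in $(w,\alpha)$. The sample of size $N$ has the individuals $i\le N$ and the periods $t\le T=T_N$, $T_N\ge 2$. Write $X_i=(X_{i1},\dots,X_{iT})$, $\bar Y_i=\frac1{T-1}\sum_{t<T}Y_{it}$ and likewise $\bar X_i,\bar u_i$, $$a_i=E\Big[\tfrac{\partial m(W_i,\alpha_i,\mu_0)}{\partial\alpha}\,\Big|\,X_i,\alpha_i\Big],\quad e_i=\tfrac{\partial m(W_i,\alpha_i,\mu_0)}{\partial\alpha}-a_i,\quad m^*_i=m(W_i,\alpha_i,\mu_0)+a_i\,u_{iT}.$$ **Estimator.** The individuals $1,\dots,N$ are split into a fixed number $L$ of disjoint folds $I_1,\dots,I_L$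 with $|I_l|\ge\lfloor N/L\rfloor$; $\mathcal W_l^c$ denotes the observed data of the individuals outside $I_l$. Let $\tilde\beta_l$, $\tilde\mu_l$ and $\tilde\pi_l$ be measurable functions of $\mathcal W_l^c$, and for $i\in I_l$ let $\tilde\alpha_{il}=\bar Y_i-\bar X_i'\tilde\beta_l$ and $\tilde a_{il}=\tilde\pi_l'\,b(X_i,\tilde\alpha_{il})$ with a (measurable, possibly growing) dictionary $b$ of functions. Let $\hat u_{it}=Y_{it}-X_{it}'\tilde\beta_l-\tilde\alpha_{il}$, and let $\hat u_i^2=\frac1{(T-1)^2}\big[\sum_{t<T}\hat u_{it}^2+2\sum_{j=1}^{h}(1-\frac{j}{h+1})\sum_{j<t<T}\hat u_{it}\hat u_{i,t-j}\big]$ with any $h=h_N\ge0$. The estimate $\hat\alpha_{il}$ of $\alpha_i$ is either $\tilde\alpha_{il}$ (no shrinkage) or $$(1-s_i)\tilde\alpha_{il}+s_i\bar\alpha_l,\qquad s_i=\frac{\hat u_i^2}{\hat u_i^2+\hat\sigma_l^2},\qquad \bar\alpha_l=\frac1{|I_l|}\sum_{i\in I_l}\tilde\alpha_{il},$$ with $\hat\sigma^2_l=\frac1{|I_l|-1}\sum_{i\in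 I_l}[(\tilde\alpha_{il}-\bar\alpha_l)^2-\hat u_i^2]$ (Empirical Bayes, EB), or with $\hat\sigma_l^2$ a minimizer over $s\ge0$ of $\frac1{|I_l|}\sum_{i\in I_l}\big[\hat u_i^2+\frac{\hat u_i^4(\tilde\alpha_{il}-\bar\alpha_l)^2}{(s+\hat u_i^2)^2}-\frac{2\hat u_i^4}{s+\hat u_i^2}\big]$ (SURE). Put $\hat\psi_{il}=\tilde a_{il}(Y_{iT}-X_{iT}'\tilde\beta_l-\hat\alpha_{il})$ and $\hat m^*(\mu)=\frac1N\sum_l\sum_{i\in I_l}[m(W_i,\hat\alpha_{il},\mu)+\hat\psi_{il}]$. Let $\hat\mu$ be a random vector that minimizes $\hat m^*(\mu)'\Upsilon_N\hat m^*(\mu)$ over a set $\Theta$ that contains $\mu_0$ in its interior, and let $$\hat G=\frac1N\sum_{l}\sum_{i\in I_l}\frac{\partial m(W_i,\hat\alpha_{il},\hat\mu)}{\partial\mu'},\quad \hat\Omega(\nu_1,\dots,\nu_L)=\frac1N\sum_l\sum_{i\in I_l}(m(W_i,\hat\alpha_{il},\nu_l)+\hat\psi_{il})(m(W_i,\hat\alpha_{il},\nu_l)+\hat\psi_{il})',\quad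 \hat\Omega=\hat\Omega(\hat\mu,\dots,\hat\mu).$$ **Assumptions** ($\mathcal N$ is a ball around $\mu_0$; statements about all $\alpha\in\mathbb R$ or all $\mu\in\mathcal N$ with argument $W_i$ hold almost surely; conditions on $i$ are for every $i$, and those with a fold $l$ are for every $l$ and, where an $i$ occurs, $i\in I_l$). 1. $m(W_i,\alpha_i,\mu_0)$ is integrable with mean $0$; $E[u_{it}\mid X_{it},\alpha_i,(Y_{is},X_{is})_{s<t}]=0$ and $E[u_{it}^2]=\sigma^2<\infty$ for all $t\ge 1$. 2. $T_N$ is of exact order $N^g$ for some $1/2<g<1$, and for some $1-g\le\zeta<1/2$: $\tilde\beta_l-\beta_0=O_p((NT)^{-1/2})$; $E[\|\tilde a_{il}-a_i\|^2\mid\mathcal W_l^c]=o_p(N^{-\zeta})$; $\frac1{|I_l|}\sum_{i\in I_l}\|\tilde a_{il}-a_i\|^2=o_p(N^{-\zeta})$; $\partial m(W_i,\alpha_i,\mu_0)/\partial\alpha$ is integrable, and $\tilde a_{il}$ and $a_i$ are square integrable. 3. $\frac1{|I_l|}\sum_{i\in I_l}(\hat\alpha_{il}-\alpha_i)^2=O_p(T^{-1})$,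 and the same for $\tilde\alpha_{il}$; $E[\|e_i\|^2\bar u_i^2]=o(1)$ and $E[e_i\bar u_i]=o(N^{-1/2})$. Only if EB or SURE is used: $0<\mathrm{Var}(\alpha_i)<\infty$, and $E[(T\hat u_i^2)^{2+\delta}\mid\mathcal W_l^c]=O_p(1)$ (with $(T\hat u_i^2)^{2+\delta}$ integrable) for some $\delta>0$ with $g>\frac12+\frac1{2+\delta}$. Only if SURE is used: for some $c>0$, $\hat\sigma_l^2\ge c$ with probability approaching one. 4. $m(W_i,\cdot,\mu_0)$ is $C^2$ with $\|\partial^2m(W_i,\alpha,\mu_0)/\partial\alpha^2\|\le C$ for all $\alpha$; for some $C$, with probability approaching one $E[u_{iT}^2\mid X_i,\bar Y_i,\alpha_i]\le C$ for all $i\le N$; $\sup_tE\|X_{it}\|^2<\infty$; $E[\|a_i\|^2\|X_{iT}\|^2]$, $E[\|\tilde a_{il}\|^2\|X_{iT}\|^2]$, $E\|e_i\|^4$ and $E[\|e_i\|\|\bar X_i\|]$ are finite for every $N$. 5. Only if EB or SURE is used: $E\|e_i(\alpha_i+\bar u_i-E\alpha_i)\|<\infty$ for every $N$. 6. $\big(\frac1N\sum_{i\in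 I_l}\|\tilde a_{il}-a_i\|^4\big)\big(\frac1N\sum_{i\in I_l}(\alpha_i-\hat\alpha_{il})^4\big)=o_p(1)$; $\tilde\mu_l\to\mu_0$ in probability; the variables $\|m_i^*\|^2$, which depend on $N$ through $T_N$, are uniformly integrable in $N$, and $E[m_i^*m_i^{*\prime}]\to\Omega$ as $N\to\infty$; for $\mu\in\mathcal N$ and all $\alpha$ the derivatives $\frac{\partial m}{\partial\mu'},\frac{\partial^2m}{\partial\alpha\partial\mu'},\frac{\partial^3m}{\partial\alpha^2\partial\mu'}$ of $m(W_i,\alpha,\mu)$ exist and are continuous in $(\alpha,\mu)$, the last one is bounded by a constant, and $E\sup_{\mu\in\mathcal N}\|\frac{\partial^2m(W_i,\alpha_i,\mu)}{\partial\alpha\partial\mu'}\|^4<\infty$. 7. $G=E[\partial m(W_i,\alpha_i,\mu_0)/\partial\mu']$ exists and has rank $k$; $\sup_{\alpha}\|\frac{\partial^2m(W_i,\alpha,\mu)}{\partial\alpha\partial\mu'}\|^2\le F(W_i)$ for all $\mu\in\mathcal N$ with $E|F(W_i)|<\infty$; and for some $C>0$, $\|\frac{\partial m(W_i,\alpha_i,\mu)}{\partial\mu'}-\frac{\partial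 m(W_i,\alpha_i,\mu_0)}{\partial\mu'}\|\le F_\alpha(W_i,\alpha_i)\|\mu-\mu_0\|^{1/C}$ for all $\mu\in\mathcal N$ with $E|F_\alpha(W_i,\alpha_i)|<\infty$. 8. $\Upsilon$ is symmetric positive definite, and either $\Upsilon_N\to\Upsilon$ in probability, or $\Upsilon_N=\hat\Omega(\tilde\mu_1,\dots,\tilde\mu_L)^{-1}$ is the feasible optimal weighting matrix, $\Upsilon=\Omega^{-1}$ and $E\sup_{\mu\in\mathcal N}\|\partial m(W_i,\alpha_i,\mu)/\partial\mu'\|^2<\infty$. **Theorem.** If these assumptions hold and $\hat\mu\to\mu_0$ in probability, then, as $N\to\infty$, $$\sqrt N(\hat\mu-\mu_0)\xrightarrow{d}\mathcal N(0,V),\qquad V=(G'\Upsilon G)^{-1}G'\Upsilon\Omega\Upsilon G(G'\Upsilon G)^{-1},$$ and $\hat V=(\hat G'\Upsilon_N\hat G)^{-1}\hat G'\Upsilon_N\hat\Omega\Upsilon_N\hat G(\hat G'\Upsilon_N\hat G)^{-1}\to V$ in probability. -/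

import Mathlib

open MeasureTheory ProbabilityTheory Filter Topology
open scoped ENNReal NNReal

namespace OrthMoment

noncomputable section

/-- `ℝⁿ` with its Euclidean norm. -/
abbrev Vec (n : ℕ) : Type := EuclideanSpace ℝ (Fin n)

/-! ### Stochastic order symbols -/

section StochasticOrder

variable {Ω E : Type*} [MeasurableSpace Ω] [NormedAddCommGroup E]

/-- `ξ N = O_p(r N)` as `N → ∞`. -/
def IsBigOp (P : Measure Ω) (ξ : ℕ → Ω → E) (r : ℕ → ℝ) : Prop :=
  ∀ ε : ℝ≥0∞, 0 < ε → ∃ M : ℝ, ∀ᶠ N in atTop, P {ω | M * r N < ‖ξ N ω‖} ≤ ε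

/-- `ξ N = o_p(r N)` as `N → ∞`. -/
def IsLittleOp (P : Measure Ω) (ξ : ℕ → Ω → E) (r : ℕ → ℝ) : Prop :=
  ∀ ε : ℝ, 0 < ε → Tendsto (fun N => P {ω | ε * r N < ‖ξ N ω‖}) atTop (𝓝 0)

/-- The events `A N` hold with probability approaching one. -/
def WithProbApproachingOne (P : Measure Ω) (A : ℕ → Ω → Prop) : Prop :=
  Tendsto (fun N => P {ω | ¬ A N ω}) atTop (𝓝 0)

end StochasticOrder

/-! ### The moment function and its derivatives -/

section Moment

variable {d k q : ℕ}

/-- `∂m/∂α`. -/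
def dα (m : Vec d → ℝ → Vec k → Vec q) (w : Vec d) (a : ℝ) (μ : Vec k) : Vec q :=
  deriv (fun s => m w s μ) a

/-- `∂²m/∂α²`. -/
def dαα (m : Vec d → ℝ → Vec k → Vec q) (w : Vec d) (a : ℝ) (μ : Vec k) : Vec q :=
  iteratedDeriv 2 (fun s => m w s μ) a

/-- `∂m/∂μ'`. -/
def dμ (m : Vec d → ℝ → Vec k → Vec q) (w : Vec d) (a : ℝ) (μ : Vec k) : Vec k →L[ℝ] Vec q :=
  fderiv ℝ (fun ν => m w a ν) μ

/-- `∂²m/∂α∂μ'`. -/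
def dαμ (m : Vec d → ℝ → Vec k → Vec q) (w : Vec d) (a : ℝ) (μ : Vec k) : Vec k →L[ℝ] Vec q :=
  deriv (fun s => dμ m w s μ) a

/-- `∂³m/∂α²∂μ'`. -/
def dααμ (m : Vec d → ℝ → Vec k → Vec q) (w : Vec d) (a : ℝ) (μ : Vec k) : Vec k →L[ℝ] Vec q :=
  iteratedDeriv 2 (fun s => dμ m w s μ) a

/-- The Jacobian matrix `∂m/∂μ'`, of size `q × k`. -/
def jac (m : Vec d → ℝ → Vec k → Vec q) (w : Vec d) (a : ℝ) (μ : Vec k) :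
    Matrix (Fin q) (Fin k) ℝ :=
  Matrix.of fun r c => dμ m w a μ (EuclideanSpace.single c 1) r

/-- The outer product `v v'`. -/
def outer (v : Vec q) : Matrix (Fin q) (Fin q) ℝ :=
  Matrix.of fun r s => v r * v s

/-- The quadratic form `v' Υ v`. -/
def quadForm (Υ : Matrix (Fin q) (Fin q) ℝ) (v : Vec q) : ℝ :=
  ∑ r, ∑ s, v r * Υ r s * v s

/-- `(G'ΥG)⁻¹ G'ΥΩΥG (G'ΥG)⁻¹`. -/
def sandwich (G : Matrix (Fin q) (Fin k) ℝ) (Υ Om : Matrix (Fin q) (Fin q) ℝ) :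
    Matrix (Fin k) (Fin k) ℝ :=
  (G.transpose * Υ * G)⁻¹ * (G.transpose * Υ * Om * Υ * G) * (G.transpose * Υ * G)⁻¹

end Moment

/-! ### The population -/

/-- The random variables attached to the individuals `i = 0, 1, 2, …` and the time periods
`t = 1, 2, …` (the values at `t = 0` are never used). Observed are `W`, `Y`, `X`; the fixed effect
`α` is latent. -/
structure Panel (Ω : Type*) (d p : ℕ) where
  W : ℕ → Ω → Vec d
  α : ℕ → Ω → ℝ
  Y : ℕ → ℕ → Ω → ℝ
  X : ℕ → ℕ → Ω → Vec p

namespace Panel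

variable {Ω : Type*} {d p k q : ℕ} (D : Panel Ω d p)

/-- The residual `u_it = Y_it - X_it'β₀ - α_i` of the panel regression. -/
def u (β₀ : Vec p) (i t : ℕ) (ω : Ω) : ℝ :=
  D.Y i t ω - inner ℝ (D.X i t ω) β₀ - D.α i ω

/-- All random variables attached to individual `i`. -/
def unit (i : ℕ) (ω : Ω) : Vec d × ℝ × (ℕ → ℝ) × (ℕ → Vec p) :=
  (D.W i ω, D.α i ω, fun t => D.Y i t ω, fun t => D.X i t ω)

/-- `(T - 1)⁻¹ ∑_{t < T} Y_it`. -/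
def Ybar (T i : ℕ) (ω : Ω) : ℝ := ((T : ℝ) - 1)⁻¹ * ∑ t ∈ Finset.Icc 1 (T - 1), D.Y i t ω

/-- `(T - 1)⁻¹ ∑_{t < T} X_it`. -/
def Xbar (T i : ℕ) (ω : Ω) : Vec p := ((T : ℝ) - 1)⁻¹ • ∑ t ∈ Finset.Icc 1 (T - 1), D.X i t ω

/-- `(T - 1)⁻¹ ∑_{t < T} u_it`. -/
def ubar (β₀ : Vec p) (T i : ℕ) (ω : Ω) : ℝ :=
  ((T : ℝ) - 1)⁻¹ * ∑ t ∈ Finset.Icc 1 (T - 1), D.u β₀ i t ω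

/-- The covariate path `(X_i1, …, X_iT)`. -/
def Xpath (T i : ℕ) (ω : Ω) : Fin T → Vec p := fun s => D.X i (s + 1) ω

/-- The σ-algebra generated by `α_i` and `X_i = (X_i1, …, X_iT)`. -/
abbrev sigXα (T i : ℕ) : MeasurableSpace Ω :=
  MeasurableSpace.comap (D.α i) inferInstance ⊔
    ⨆ t ∈ Finset.Icc 1 T, MeasurableSpace.comap (D.X i t) inferInstance

/-- The σ-algebra generated by `X_i`, `Ybar_i` and `α_i`. -/
abbrev sigXYα (T i : ℕ) : MeasurableSpace Ω :=
  D.sigXα T i ⊔ MeasurableSpace.comap (D.Ybar T i) inferInstance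

/-- The σ-algebra generated by `X_it`, `α_i` and `(Y_is, X_is)`, `1 ≤ s < t`. -/
abbrev sigPast (i t : ℕ) : MeasurableSpace Ω :=
  MeasurableSpace.comap (D.X i t) inferInstance ⊔ MeasurableSpace.comap (D.α i) inferInstance ⊔
    ⨆ s ∈ Finset.Ico 1 t, (MeasurableSpace.comap (D.Y i s) inferInstance ⊔
      MeasurableSpace.comap (D.X i s) inferInstance)

/-- The σ-algebra generated by the observations up to period `T` of the individuals in `S`. -/
abbrev sigObs (T : ℕ) (S : Finset ℕ) : MeasurableSpace Ω :=
  ⨆ j ∈ S, (MeasurableSpace.comap (D.W j) inferInstance ⊔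
    ⨆ t ∈ Finset.Icc 1 T, (MeasurableSpace.comap (D.Y j t) inferInstance ⊔
      MeasurableSpace.comap (D.X j t) inferInstance))

variable [MeasurableSpace Ω]

/-- `a(X_i, α_i, μ₀) = E[∂m(W_i, α_i, μ₀)/∂α | X_i, α_i]`, with `X_i = (X_i1, …, X_iT)`. -/
def a (P : Measure Ω) (m : Vec d → ℝ → Vec k → Vec q) (μ₀ : Vec k) (T i : ℕ) : Ω → Vec q :=
  P[fun ω => dα m (D.W i ω) (D.α i ω) μ₀ | D.sigXα T i]

/-- `e_i = ∂m(W_i, α_i, μ₀)/∂α - a(X_i, α_i, μ₀)`. -/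
def e (P : Measure Ω) (m : Vec d → ℝ → Vec k → Vec q) (μ₀ : Vec k) (T i : ℕ) (ω : Ω) : Vec q :=
  dα m (D.W i ω) (D.α i ω) μ₀ - D.a P m μ₀ T i ω

/-- The orthogonal moment
`m* = m(W_i, α_i, μ₀) + a(X_i, α_i, μ₀) (Y_iT - X_iT'β₀ - α_i)`. -/
def mstar (P : Measure Ω) (m : Vec d → ℝ → Vec k → Vec q) (β₀ : Vec p) (μ₀ : Vec k)
    (T i : ℕ) (ω : Ω) : Vec q :=
  m (D.W i ω) (D.α i ω) μ₀ + D.u β₀ i T ω • D.a P m μ₀ T i ω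

end Panel

/-! ### The cross-fitted estimator -/

/-- Which shrinkage is applied to the estimated fixed effects: none, Empirical Bayes, or Stein's
Unbiased Risk Estimation. -/
inductive Shrinkage
  | none
  | EB
  | SURE

/-- The ingredients of the cross-fitting procedure for sample sizes `N = 0, 1, 2, …`; the sample of
size `N` consists of the individuals `i < N` and the periods `t = 1, …, T N`. -/
structure Procedure (Ω : Type*) (p k q L : ℕ) where
  /-- number of time periods -/
  T : ℕ → ℕ
  /-- the folds `I_l` -/
  fold : ℕ → Fin L → Finset ℕ
  /-- first-stage estimate of `β₀` without fold `l` -/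
  βt : ℕ → Fin L → Ω → Vec p
  /-- preliminary estimate of `μ₀` without fold `l` -/
  μt : ℕ → Fin L → Ω → Vec k
  /-- size of the dictionary -/
  K : ℕ → ℕ
  /-- the dictionary `b(X_i, α)` -/
  dict : (N : ℕ) → (Fin (T N) → Vec p) → ℝ → Fin (K N) → ℝ
  /-- estimated dictionary coefficients without fold `l`, one column per moment -/
  πt : (N : ℕ) → Fin L → Ω → Matrix (Fin (K N)) (Fin q) ℝ
  /-- shrinkage method for the fixed effects -/
  shrink : Shrinkage
  /-- lag truncation of the Newey–West variance estimate (`0` means no autocorrelation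
  correction) -/
  lag : ℕ → ℕ
  /-- prior variance selected by SURE (used only under SURE shrinkage) -/
  sureVar : ℕ → Fin L → Ω → ℝ
  /-- weighting matrix -/
  Υ : ℕ → Ω → Matrix (Fin q) (Fin q) ℝ
  /-- the final estimate of `μ₀` -/
  μhat : ℕ → Ω → Vec k

namespace Procedure

variable {Ω : Type*} {d p k q L : ℕ} (A : Procedure Ω p k q L) (D : Panel Ω d p)
  (m : Vec d → ℝ → Vec k → Vec q)

/-- `∑_{i ∈ I_l} f i / |I_l|`. -/
def foldMean (N : ℕ) (l : Fin L) (f : ℕ → ℝ) : ℝ :=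
  ((A.fold N l).card : ℝ)⁻¹ * ∑ i ∈ A.fold N l, f i

/-- The unshrunk estimate `Ybar_i - Xbar_i'β̃_l` of `α_i`. -/
def αt (N : ℕ) (l : Fin L) (i : ℕ) (ω : Ω) : ℝ :=
  D.Ybar (A.T N) i ω - inner ℝ (D.Xbar (A.T N) i ω) (A.βt N l ω)

/-- Mean of the unshrunk estimates over the fold. -/
def αbar (N : ℕ) (l : Fin L) (ω : Ω) : ℝ := A.foldMean N l fun i => A.αt D N l i ω

/-- The residual `Y_it - X_it'β̃_l - α̃_il`. -/
def uhat (N : ℕ) (l : Fin L) (i t : ℕ) (ω : Ω) : ℝ :=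
  D.Y i t ω - inner ℝ (D.X i t ω) (A.βt N l ω) - A.αt D N l i ω

/-- The estimate `û_i²` of the variance of `(T - 1)⁻¹ ∑_{t < T} u_it`: Newey–West with Bartlett
weights; for lag truncation `0` it is `(T - 1)⁻² ∑_{t < T} û_it²`. -/
def uhatSq (N : ℕ) (l : Fin L) (i : ℕ) (ω : Ω) : ℝ :=
  (((A.T N : ℝ) - 1) ^ 2)⁻¹ *
    (∑ t ∈ Finset.Icc 1 (A.T N - 1), A.uhat D N l i t ω ^ 2 +
      2 * ∑ j ∈ Finset.Icc 1 (A.lag N), (1 - (j : ℝ) / ((A.lag N : ℝ) + 1)) *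
        ∑ t ∈ Finset.Icc (j + 1) (A.T N - 1), A.uhat D N l i t ω * A.uhat D N l i (t - j) ω)

/-- The Empirical Bayes estimate of the variance of `α_i`. -/
def ebVar (N : ℕ) (l : Fin L) (ω : Ω) : ℝ :=
  (((A.fold N l).card : ℝ) - 1)⁻¹ *
      ∑ i ∈ A.fold N l, (A.αt D N l i ω - A.αbar D N l ω) ^ 2 -
    (((A.fold N l).card : ℝ) - 1)⁻¹ * ∑ i ∈ A.fold N l, A.uhatSq D N l i ω

/-- The unbiased risk estimate at prior variance `s`. -/
def ure (N : ℕ) (l : Fin L) (ω : Ω) (s : ℝ) : ℝ :=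
  A.foldMean N l fun i =>
    A.uhatSq D N l i ω +
      A.uhatSq D N l i ω ^ 2 * (A.αt D N l i ω - A.αbar D N l ω) ^ 2 /
        (s + A.uhatSq D N l i ω) ^ 2 -
      2 * (A.uhatSq D N l i ω ^ 2 / (s + A.uhatSq D N l i ω))

/-- Shrinkage of `α̃_il` towards the fold mean for prior variance `s`. -/
def shrunk (N : ℕ) (l : Fin L) (i : ℕ) (ω : Ω) (s : ℝ) : ℝ :=
  (1 - A.uhatSq D N l i ω / (A.uhatSq D N l i ω + s)) * A.αt D N l i ω +
    A.uhatSq D N l i ω / (A.uhatSq D N l i ω + s) * A.αbar D N l ω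

/-- The estimate of `α_i`, `i ∈ I_l`, that enters the sample moments. -/
def αhat (N : ℕ) (l : Fin L) (i : ℕ) (ω : Ω) : ℝ :=
  match A.shrink with
  | .none => A.αt D N l i ω
  | .EB => A.shrunk D N l i ω (A.ebVar D N l ω)
  | .SURE => A.shrunk D N l i ω (A.sureVar N l ω)

/-- The estimate `ã_il = b(X_i, α̃_il)'π̃_l` of `a(X_i, α_i, μ₀)`. -/
def at_ (N : ℕ) (l : Fin L) (i : ℕ) (ω : Ω) : Vec q :=
  WithLp.toLp 2 fun r =>
    ∑ j, A.dict N (D.Xpath (A.T N) i ω) (A.αt D N l i ω) j * A.πt N l ω j r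

/-- The correction term `ψ̂_il = ã_il (Y_iT - X_iT'β̃_l - α̂_il)`. -/
def ψ (N : ℕ) (l : Fin L) (i : ℕ) (ω : Ω) : Vec q :=
  (D.Y i (A.T N) ω - inner ℝ (D.X i (A.T N) ω) (A.βt N l ω) - A.αhat D N l i ω) •
    A.at_ D N l i ω

/-- The debiased sample moments at `μ`. -/
def mhat (N : ℕ) (ω : Ω) (μ : Vec k) : Vec q :=
  (N : ℝ)⁻¹ • ∑ l, ∑ i ∈ A.fold N l,
    (m (D.W i ω) (A.αhat D N l i ω) μ + A.ψ D N l i ω)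

/-- The GMM objective function. -/
def objective (N : ℕ) (ω : Ω) (μ : Vec k) : ℝ := quadForm (A.Υ N ω) (A.mhat D m N ω μ)

/-- `N⁻¹ ∑_l ∑_{i ∈ I_l} (m(W_i, α̂_il, ν_l) + ψ̂_il)(m(W_i, α̂_il, ν_l) + ψ̂_il)'`. -/
def secondMoment (N : ℕ) (ω : Ω) (ν : Fin L → Vec k) : Matrix (Fin q) (Fin q) ℝ :=
  (N : ℝ)⁻¹ • ∑ l, ∑ i ∈ A.fold N l,
    outer (m (D.W i ω) (A.αhat D N l i ω) (ν l) + A.ψ D N l i ω)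

/-- The feasible optimal weighting matrix, based on the preliminary estimates `μ̃_l`. -/
def optimalΥ (N : ℕ) (ω : Ω) : Matrix (Fin q) (Fin q) ℝ :=
  (A.secondMoment D m N ω fun l => A.μt N l ω)⁻¹

/-- `Ω̂`. -/
def Omhat (N : ℕ) (ω : Ω) : Matrix (Fin q) (Fin q) ℝ :=
  A.secondMoment D m N ω fun _ => A.μhat N ω

/-- `Ĝ`. -/
def Ghat (N : ℕ) (ω : Ω) : Matrix (Fin q) (Fin k) ℝ :=
  (N : ℝ)⁻¹ • ∑ l, ∑ i ∈ A.fold N l, jac m (D.W i ω) (A.αhat D N l i ω) (A.μhat N ω)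

/-- The plug-in sandwich estimator `V̂`. -/
def Vhat (N : ℕ) (ω : Ω) : Matrix (Fin k) (Fin k) ℝ :=
  sandwich (A.Ghat D m N ω) (A.Υ N ω) (A.Omhat D m N ω)

/-- The σ-algebra of the data that are not in fold `l`. -/
abbrev sigOut (N : ℕ) (l : Fin L) : MeasurableSpace Ω :=
  D.sigObs (A.T N) (Finset.range N \ A.fold N l)

variable [MeasurableSpace Ω]

/-- The objects of the procedure are what they are said to be: the folds partition the sample into
`L` groups of comparable size, first-stage and preliminary estimates use out-of-fold data only, the
SURE variance minimizes the unbiased risk estimate, and `μ̂` minimizes the GMM objective over the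
parameter space `Θ`. -/
structure IsValid (P : Measure Ω) (Θ : Set (Vec k)) : Prop where
  two_le_T : ∀ N, 2 ≤ A.T N
  fold_disjoint : ∀ N, Pairwise fun l l' => Disjoint (A.fold N l) (A.fold N l')
  fold_cover : ∀ N, Finset.univ.biUnion (A.fold N) = Finset.range N
  fold_card : ∀ N l, N / L ≤ (A.fold N l).card
  βt_out : ∀ N l, Measurable[A.sigOut D N l] (A.βt N l)
  μt_out : ∀ N l, Measurable[A.sigOut D N l] (A.μt N l)
  πt_out : ∀ N l j r, Measurable[A.sigOut D N l] fun ω => A.πt N l ω j r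
  dict_meas : ∀ N, Measurable fun z : (Fin (A.T N) → Vec p) × ℝ => A.dict N z.1 z.2
  sure_meas : ∀ N l, Measurable (A.sureVar N l)
  sure_min : A.shrink = .SURE → ∀ N l, ∀ᵐ ω ∂P,
    0 ≤ A.sureVar N l ω ∧ IsMinOn (A.ure D N l ω) (Set.Ici 0) (A.sureVar N l ω)
  Υ_meas : ∀ N r s, Measurable fun ω => A.Υ N ω r s
  μhat_meas : ∀ N, Measurable (A.μhat N)
  μhat_min : ∀ᶠ N in atTop, ∀ᵐ ω ∂P,
    A.μhat N ω ∈ Θ ∧ IsMinOn (A.objective D m N ω) Θ (A.μhat N ω)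

end Procedure

/-! ### Assumptions -/

section Assumptions

variable {Ω : Type*} [MeasurableSpace Ω] {d p k q L : ℕ}

/-- The individuals are independent and identically distributed. -/
structure Sampling (P : Measure Ω) (D : Panel Ω d p) : Prop where
  meas_W : ∀ i, Measurable (D.W i)
  meas_α : ∀ i, Measurable (D.α i)
  meas_Y : ∀ i t, Measurable (D.Y i t)
  meas_X : ∀ i t, Measurable (D.X i t)
  indep : iIndepFun D.unit P
  ident : ∀ i, IdentDistrib (D.unit i) (D.unit 0) P P

/-- Moment condition and sequential exogeneity. -/
structure ModelAssumption (P : Measure Ω) (D : Panel Ω d p) (m : Vec d → ℝ → Vec k → Vec q)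
    (β₀ : Vec p) (μ₀ : Vec k) : Prop where
  meas : ∀ μ, Measurable fun z : Vec d × ℝ => m z.1 z.2 μ
  integrable : ∀ i, Integrable (fun ω => m (D.W i ω) (D.α i ω) μ₀) P
  moment : ∀ i, ∫ ω, m (D.W i ω) (D.α i ω) μ₀ ∂P = 0
  exogenous : ∀ i t, 1 ≤ t → P[D.u β₀ i t | D.sigPast i t] =ᵐ[P] 0
  sq_integrable : ∀ i t, 1 ≤ t → MemLp (D.u β₀ i t) 2 P
  variance : ∃ σsq : ℝ, ∀ i t, 1 ≤ t → ∫ ω, D.u β₀ i t ω ^ 2 ∂P = σsq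

/-- Rates for the first-stage estimator and for the estimate of `a(X_i, α_i, μ₀)`. Given the
out-of-fold data, the individuals of a fold are exchangeable, so that a conditional mean given these
data is the same for all `i ∈ I_l`; it is written as its average over the fold. -/
structure RateAssumption (P : Measure Ω) (D : Panel Ω d p) (A : Procedure Ω p k q L)
    (m : Vec d → ℝ → Vec k → Vec q) (β₀ : Vec p) (μ₀ : Vec k) (g : ℝ) : Prop where
  g_lower : 1 / 2 < g
  g_upper : g < 1
  T_growth : (fun N => (A.T N : ℝ)) =Θ[atTop] fun N => (N : ℝ) ^ g
  βt_rate : ∀ l, IsBigOp P (fun N ω => A.βt N l ω - β₀)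
    fun N => (Real.sqrt ((N : ℝ) * (A.T N : ℝ)))⁻¹
  dα_integrable : ∀ i, Integrable (fun ω => dα m (D.W i ω) (D.α i ω) μ₀) P
  a_sq : ∀ N i, MemLp (D.a P m μ₀ (A.T N) i) 2 P
  at_sq : ∀ N l, ∀ i ∈ A.fold N l, MemLp (A.at_ D N l i) 2 P
  a_rate : ∃ ζ : ℝ, 1 - g ≤ ζ ∧ ζ < 1 / 2 ∧
    (∀ l, IsLittleOp P
      (fun N ω => A.foldMean N l fun i =>
        (P[fun ω' => ‖A.at_ D N l i ω' - D.a P m μ₀ (A.T N) i ω'‖ ^ 2 | A.sigOut D N l]) ω)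
      fun N => (N : ℝ) ^ (-ζ)) ∧
    (∀ l, IsLittleOp P
      (fun N ω => A.foldMean N l fun i =>
        ‖A.at_ D N l i ω - D.a P m μ₀ (A.T N) i ω‖ ^ 2)
      fun N => (N : ℝ) ^ (-ζ))

/-- Rates for the estimated fixed effects; the last four conditions concern shrinkage only. Those on
the variances make sure that the shrinkage factors do not involve division by numbers close to
zero. -/
structure FixedEffectAssumption (P : Measure Ω) (D : Panel Ω d p) (A : Procedure Ω p k q L)
    (m : Vec d → ℝ → Vec k → Vec q) (β₀ : Vec p) (μ₀ : Vec k) (g : ℝ) : Prop where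
  αhat_rate : ∀ l, IsBigOp P
    (fun N ω => A.foldMean N l fun i => (A.αhat D N l i ω - D.α i ω) ^ 2)
    fun N => (A.T N : ℝ)⁻¹
  αt_rate : ∀ l, IsBigOp P
    (fun N ω => A.foldMean N l fun i => (A.αt D N l i ω - D.α i ω) ^ 2)
    fun N => (A.T N : ℝ)⁻¹
  eu_sq : ∀ i, Tendsto (fun N => ∫⁻ ω,
      ‖D.ubar β₀ (A.T N) i ω • D.e P m μ₀ (A.T N) i ω‖ₑ ^ 2 ∂P) atTop (𝓝 0)
  eu_mean : ∀ i, (fun N => ∫ ω, D.ubar β₀ (A.T N) i ω • D.e P m μ₀ (A.T N) i ω ∂P)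
    =o[atTop] fun N => ((N : ℝ) ^ (-(1 / 2) : ℝ))
  α_var : A.shrink ≠ .none → ∀ i, MemLp (D.α i) 2 P ∧ 0 < variance (D.α i) P
  uhat_moment : A.shrink ≠ .none → ∃ δ : ℝ, 0 < δ ∧ 1 / 2 + 1 / (2 + δ) < g ∧
    (∀ N l, ∀ i ∈ A.fold N l,
      Integrable (fun ω => |(A.T N : ℝ) * A.uhatSq D N l i ω| ^ (2 + δ)) P) ∧
    ∀ l, IsBigOp P
      (fun N ω => A.foldMean N l fun i =>
        (P[fun ω' => |(A.T N : ℝ) * A.uhatSq D N l i ω'| ^ (2 + δ) | A.sigOut D N l]) ω)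
      fun _ => 1
  sure_pos : A.shrink = .SURE → ∃ c : ℝ, 0 < c ∧
    ∀ l, WithProbApproachingOne P fun N ω => c ≤ A.sureVar N l ω
  eb_moment : A.shrink ≠ .none → ∀ N i, ∫⁻ ω,
    ‖(D.α i ω + D.ubar β₀ (A.T N) i ω - ∫ ω', D.α i ω' ∂P) • D.e P m μ₀ (A.T N) i ω‖ₑ ∂P < ∞

/-- Smoothness in `α` and existence of moments. -/
structure MomentAssumption (P : Measure Ω) (D : Panel Ω d p) (A : Procedure Ω p k q L)
    (m : Vec d → ℝ → Vec k → Vec q) (β₀ : Vec p) (μ₀ : Vec k) : Prop where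
  smooth : ∀ i, ∀ᵐ ω ∂P, ContDiff ℝ 2 fun s => m (D.W i ω) s μ₀
  dαα_bound : ∃ C : ℝ, ∀ i, ∀ᵐ ω ∂P, ∀ s, ‖dαα m (D.W i ω) s μ₀‖ ≤ C
  cond_var : ∃ C : ℝ, WithProbApproachingOne P fun N ω => ∀ i < N,
    (P[fun ω' => D.u β₀ i (A.T N) ω' ^ 2 | D.sigXYα (A.T N) i]) ω ≤ C
  X_sq : ∃ C : ℝ≥0, ∀ i t, 1 ≤ t → ∫⁻ ω, ‖D.X i t ω‖ₑ ^ 2 ∂P ≤ C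
  aX_sq : ∀ N i, ∫⁻ ω, ‖D.a P m μ₀ (A.T N) i ω‖ₑ ^ 2 * ‖D.X i (A.T N) ω‖ₑ ^ 2 ∂P < ∞
  atX_sq : ∀ N l, ∀ i ∈ A.fold N l,
    ∫⁻ ω, ‖A.at_ D N l i ω‖ₑ ^ 2 * ‖D.X i (A.T N) ω‖ₑ ^ 2 ∂P < ∞
  e_fourth : ∀ N i, ∫⁻ ω, ‖D.e P m μ₀ (A.T N) i ω‖ₑ ^ 4 ∂P < ∞
  eX : ∀ N i, ∫⁻ ω, ‖D.e P m μ₀ (A.T N) i ω‖ₑ * ‖D.Xbar (A.T N) i ω‖ₑ ∂P < ∞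

/-- Conditions for the second-moment matrix of the orthogonal moments. The neighbourhood of `μ₀`
is the ball of radius `ρ`. -/
structure OmegaAssumption (P : Measure Ω) (D : Panel Ω d p) (A : Procedure Ω p k q L)
    (m : Vec d → ℝ → Vec k → Vec q) (β₀ : Vec p) (μ₀ : Vec k) (ρ : ℝ)
    (Om : Matrix (Fin q) (Fin q) ℝ) : Prop where
  fourth : ∀ l, IsLittleOp P
    (fun N ω => ((N : ℝ)⁻¹ * ∑ i ∈ A.fold N l,
        ‖A.at_ D N l i ω - D.a P m μ₀ (A.T N) i ω‖ ^ 4) *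
      ((N : ℝ)⁻¹ * ∑ i ∈ A.fold N l, (D.α i ω - A.αhat D N l i ω) ^ 4))
    fun _ => 1
  mstar_sq : ∀ i, UniformIntegrable (fun N => D.mstar P m β₀ μ₀ (A.T N) i) 2 P
  Om_lim : ∀ i r s, Tendsto (fun N => ∫ ω,
    outer (D.mstar P m β₀ μ₀ (A.T N) i ω) r s ∂P) atTop (𝓝 (Om r s))
  μt_consistent : ∀ l, TendstoInMeasure P (fun N => A.μt N l) atTop fun _ => μ₀
  dμ_exists : ∀ i, ∀ᵐ ω ∂P, ∀ s, ∀ μ ∈ Metric.ball μ₀ ρ,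
    DifferentiableAt ℝ (fun ν => m (D.W i ω) s ν) μ
  dαμ_exists : ∀ i, ∀ᵐ ω ∂P, ∀ μ ∈ Metric.ball μ₀ ρ, ContDiff ℝ 2 fun s => dμ m (D.W i ω) s μ
  dμ_cont : ∀ i, ∀ᵐ ω ∂P, ContinuousOn (fun z : ℝ × Vec k => dμ m (D.W i ω) z.1 z.2)
    (Set.univ ×ˢ Metric.ball μ₀ ρ)
  dαμ_cont : ∀ i, ∀ᵐ ω ∂P, ContinuousOn (fun z : ℝ × Vec k => dαμ m (D.W i ω) z.1 z.2)
    (Set.univ ×ˢ Metric.ball μ₀ ρ)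
  dααμ_cont : ∀ i, ∀ᵐ ω ∂P, ContinuousOn (fun z : ℝ × Vec k => dααμ m (D.W i ω) z.1 z.2)
    (Set.univ ×ˢ Metric.ball μ₀ ρ)
  dααμ_bound : ∃ C : ℝ, ∀ i, ∀ᵐ ω ∂P, ∀ s, ∀ μ ∈ Metric.ball μ₀ ρ,
    ‖dααμ m (D.W i ω) s μ‖ ≤ C
  dαμ_fourth : ∀ i, ∫⁻ ω, ⨆ μ ∈ Metric.ball μ₀ ρ, ‖dαμ m (D.W i ω) (D.α i ω) μ‖ₑ ^ 4 ∂P < ∞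

/-- Conditions for the Jacobian `G = E[∂m(W_i, α_i, μ₀)/∂μ']`. -/
structure JacobianAssumption (P : Measure Ω) (D : Panel Ω d p)
    (m : Vec d → ℝ → Vec k → Vec q) (μ₀ : Vec k) (ρ : ℝ)
    (G : Matrix (Fin q) (Fin k) ℝ) : Prop where
  G_exists : ∀ i r c, Integrable (fun ω => jac m (D.W i ω) (D.α i ω) μ₀ r c) P
  G_eq : ∀ i r c, G r c = ∫ ω, jac m (D.W i ω) (D.α i ω) μ₀ r c ∂P
  full_rank : G.rank = k
  envelope : ∃ F : Vec d → ℝ, Measurable F ∧ (∀ i, Integrable (fun ω => F (D.W i ω)) P) ∧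
    ∀ i, ∀ᵐ ω ∂P, ∀ s, ∀ μ ∈ Metric.ball μ₀ ρ, ‖dαμ m (D.W i ω) s μ‖ ^ 2 ≤ F (D.W i ω)
  holder : ∃ (C : ℝ) (F : Vec d → ℝ → ℝ), 0 < C ∧ (Measurable fun z : Vec d × ℝ => F z.1 z.2) ∧
    (∀ i, Integrable (fun ω => F (D.W i ω) (D.α i ω)) P) ∧
    ∀ i, ∀ᵐ ω ∂P, ∀ μ ∈ Metric.ball μ₀ ρ,
      ‖dμ m (D.W i ω) (D.α i ω) μ - dμ m (D.W i ω) (D.α i ω) μ₀‖ ≤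
        F (D.W i ω) (D.α i ω) * ‖μ - μ₀‖ ^ (1 / C)

/-- The weighting matrices have the positive definite limit `Υ`: either they are any
random matrices that converge in probability to `Υ`, or they are the feasible optimal ones, in which
case `Υ = Ω⁻¹` (and `sup_μ ‖∂m/∂μ'‖` is square integrable near `μ₀`). -/
def WeightingAssumption (P : Measure Ω) (D : Panel Ω d p) (A : Procedure Ω p k q L)
    (m : Vec d → ℝ → Vec k → Vec q) (μ₀ : Vec k) (ρ : ℝ)
    (Om Υ : Matrix (Fin q) (Fin q) ℝ) : Prop :=
  Υ.PosDef ∧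
    ((∀ r s, TendstoInMeasure P (fun N ω => A.Υ N ω r s) atTop fun _ => Υ r s) ∨
      ((∀ N ω, A.Υ N ω = A.optimalΥ D m N ω) ∧ Υ = Om⁻¹ ∧
        ∀ i, ∫⁻ ω, ⨆ μ ∈ Metric.ball μ₀ ρ, ‖dμ m (D.W i ω) (D.α i ω) μ‖ₑ ^ 2 ∂P < ∞))

end Assumptions

end

end OrthMoment

open OrthMoment

/-! The estimator satisfies the first-order condition of GMM, so the theorem rests on three facts.
At `μ₀` the sample moments agree up to `o_p(N^{-1/2})` with the average of the infeasible moments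
`m*_i` (`tendsto_sqrt_smul_mhat_sub`). These are independent across individuals and obey a central
limit theorem (`tendstoInDistribution_mstarSum`). Near `μ₀` the sample Jacobian is uniformly close
to `G` (`exists_sampleJac_bound`). Linearizing the first-order condition (`tendsto_of_linearized`)
then gives `√N(μ̂ - μ₀)` as a fixed linear image of the normalized sum of the `m*_i`, up to a null
term.

The heart is the first fact. By `momentGap_eq` the estimated moment minus `m*_i` is a sum of five
terms; the first-order effect `a_i(α̂_i - α_i)` of estimating the fixed effect cancels against the
correction term, which is what orthogonality means here. The terms are treated as follows. (1) The
second-order remainder is bounded by a multiple of `(α̂_i - α_i)²`, on average `O_p(N^{-g})` with `g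
> 1/2`. (2) The products `u_iT(ã_i - a_i)` are orthogonal within a fold: `ã_i` uses other folds and
periods before `T` of `Y_i`, so `u_iT` has conditional mean zero given the weight. Their normalized
sum is therefore governed by the mean square of `ã_i - a_i` (`tendsto_sum_weighted_errors`). (3) The
effect of `β̃ - β₀` is negligible as `√N‖β̃ - β₀‖ = O_p(T^{-1/2})`. (4) For `(α̂_i - α_i)e_i`, the
unshrunk error is `ū_i - X̄_i'(β̃ - β₀)`; the products `ū_i e_i` have mean `o(N^{-1/2})` and
vanishing second moment (`tendsto_sum_αt_smul_e`). Shrinkage changes the estimate by a factor that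
is `o_p(N^{-1/2})` uniformly over the fold, since the variance estimates are that small and the
prior variance stays away from zero (`tendsto_sum_shrinkage_smul_e`). (5) For `(α_i - α̂_i)(ã_i -
a_i)`, Cauchy–Schwarz combines the rates `N^{-g}` and `N^{-ζ}` with `ζ ≥ 1 - g`.

The `m*_i` depend on `N` through `T_N`, so the limit theorems are needed for triangular arrays.
Uniform integrability of `‖m*_i‖²` supplies the Lindeberg condition of `clt_array` and the tails of
`weak_law_array`.

For the variance estimator, the same five terms vanish in mean square
(`tendsto_foldAvg_momentGap_sq`), so the estimated second moments converge to `Ω` once an estimate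
of `μ₀` may be plugged in. For `μ̂` this uses its rate `N^{-1/2}`; for the preliminary estimates,
which are merely consistent, it uses a square integrable envelope.

Stochastic order calculus is turned into calculus with one filter: convergence in probability is
convergence along `wpa`, boundedness in probability is used only through `Tight`. Almost sure
assumptions and events of probability tending to one then combine by `filter_upwards`. -/

set_option linter.unusedSectionVars false

namespace OrthMoment

/-! ### Convergence in probability as convergence along a filter -/

section WithProbability

variable {Ω E : Type*} [MeasurableSpace Ω] {P : Measure Ω}

/-- The filter of the events that hold with probability approaching one. -/
def wpa (P : Measure Ω) : Filter (ℕ × Ω) where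
  sets := {S | Tendsto (fun N => P {ω | (N, ω) ∉ S}) atTop (𝓝 0)}
  univ_sets := by simp
  sets_of_superset := fun {S T} hS hST =>
    tendsto_of_tendsto_of_tendsto_of_le_of_le tendsto_const_nhds hS (fun _ => zero_le)
      fun N => measure_mono fun ω hω h => hω (hST h)
  inter_sets := fun {S T} hS hT => by
    have := Tendsto.add hS hT
    rw [add_zero] at this
    refine tendsto_of_tendsto_of_tendsto_of_le_of_le tendsto_const_nhds this (fun _ => zero_le)
      fun N => (measure_mono fun ω hω => ?_).trans (measure_union_le _ _)
    by_cases h : (N, ω) ∈ S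
    · exact Or.inr fun h' => hω ⟨h, h'⟩
    · exact Or.inl h

theorem eventually_wpa {p : ℕ × Ω → Prop} :
    (∀ᶠ z in wpa P, p z) ↔ Tendsto (fun N => P {ω | ¬ p (N, ω)}) atTop (𝓝 0) := Iff.rfl

theorem tendsto_fst_wpa : Tendsto Prod.fst (wpa P) atTop := by
  intro S hS
  change Tendsto (fun N => P {ω | ¬ (N ∈ S)}) atTop (𝓝 0)
  refine tendsto_const_nhds.congr' ?_
  filter_upwards [hS] with N hN
  simp [hN]

theorem eventually_wpa_of_ae {p : ℕ × Ω → Prop}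
    (h : ∀ᶠ N in atTop, ∀ᵐ ω ∂P, p (N, ω)) : ∀ᶠ z in wpa P, p z := by
  rw [eventually_wpa]
  refine tendsto_const_nhds.congr' ?_
  filter_upwards [h] with N hN
  exact (ae_iff.1 hN).symm

theorem eventually_wpa_of_forall_ae {p : ℕ → Ω → Prop}
    (h : ∀ N, ∀ᵐ ω ∂P, p N ω) : ∀ᶠ z in wpa P, p z.1 z.2 :=
  eventually_wpa_of_ae (p := fun z => p z.1 z.2) (Eventually.of_forall h)

theorem eventually_wpa_of_atTop {p : ℕ → Prop}
    (h : ∀ᶠ N in atTop, p N) : ∀ᶠ z in wpa P, p z.1 := tendsto_fst_wpa.eventually h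

theorem tendsto_wpa_of_atTop {f : ℕ → E} {l : Filter E} (h : Tendsto f atTop l) :
    Tendsto (fun z => f z.1) (wpa P) l := h.comp tendsto_fst_wpa

/-- Both sides bound the outer measure of the same sets, so `f` need not be measurable. -/
theorem tendsto_wpa_iff [PseudoMetricSpace E] {f : ℕ → Ω → E} {c : E} :
    Tendsto (fun z => f z.1 z.2) (wpa P) (𝓝 c) ↔
      TendstoInMeasure P f atTop fun _ => c := by
  rw [tendstoInMeasure_iff_dist, Metric.tendsto_nhds]
  simp only [eventually_wpa, not_lt]

theorem IsLittleOp.tendsto_wpa [NormedAddCommGroup E] {ξ : ℕ → Ω → E} {r : ℕ → ℝ}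
    (h : IsLittleOp P ξ r) (hr : ∀ᶠ N in atTop, 0 < r N) :
    Tendsto (fun z => (r z.1)⁻¹ * ‖ξ z.1 z.2‖) (wpa P) (𝓝 0) := by
  rw [Metric.tendsto_nhds]
  intro ε hε
  rw [eventually_wpa]
  -- The hypothesis controls a strict inequality and the goal a weak one; halving `ε` bridges the
  -- two.
  refine tendsto_of_tendsto_of_tendsto_of_le_of_le' tendsto_const_nhds (h (ε / 2) (half_pos hε))
    (Eventually.of_forall fun _ => zero_le) ?_
  filter_upwards [hr] with N hN
  refine measure_mono fun ω hω => ?_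
  simp only [Real.dist_eq, sub_zero, not_lt, abs_mul, abs_inv, abs_norm,
    abs_of_pos hN, Set.mem_ofPred_eq] at hω ⊢
  rw [← div_eq_inv_mul, le_div_iff₀ hN] at hω
  nlinarith

/-- `f` is stochastically bounded along the filter `F`: its product with every null function is
a null function. -/
def Tight {ι : Type*} (F : Filter ι) (f : ι → ℝ) : Prop :=
  ∀ η : ι → ℝ, Tendsto η F (𝓝 0) → Tendsto (fun z => η z * f z) F (𝓝 0)

namespace Tight

variable {ι : Type*} {F : Filter ι} {f f' : ι → ℝ}

theorem mono (h : Tight F f) (hle : ∀ᶠ z in F, |f' z| ≤ |f z|) : Tight F f' := by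
  intro η hη
  refine squeeze_zero_norm' (a := fun z => ‖η z * f z‖) ?_ (by simpa using (h η hη).norm)
  filter_upwards [hle] with z hz
  rw [norm_mul, norm_mul]
  exact mul_le_mul_of_nonneg_left hz (norm_nonneg _)

theorem add (h : Tight F f) (h' : Tight F f') : Tight F fun z => f z + f' z := by
  intro η hη
  simpa [mul_add] using (h η hη).add (h' η hη)

theorem mul (h : Tight F f) (h' : Tight F f') : Tight F fun z => f z * f' z := by
  intro η hη
  simpa [mul_assoc] using h' _ (h η hη)

theorem of_tendsto {c : ℝ} (h : Tendsto f F (𝓝 c)) : Tight F f := by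
  intro η hη
  simpa using hη.mul h

theorem const (c : ℝ) : Tight F fun _ => c := of_tendsto tendsto_const_nhds

theorem const_mul (c : ℝ) (h : Tight F f) : Tight F fun z => c * f z := (const c).mul h

theorem abs (h : Tight F f) : Tight F fun z => |f z| := h.mono (by simp)

theorem congr (h : Tight F f) (hf : ∀ᶠ z in F, f z = f' z) : Tight F f' :=
  h.mono (hf.mono fun z hz => by rw [hz])

/-- With `η` also `η²` is null, hence so is `η²|f|`, and its square root dominates `|η √f|`. -/
theorem sqrt (h : Tight F f) : Tight F fun z => √(f z) := by
  intro η hη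
  have h2 : Tendsto (fun z => √(η z ^ 2 * |f z|)) F (𝓝 0) := by
    have := (h.abs (fun z => η z ^ 2) (by simpa using hη.pow 2)).sqrt
    simpa using this
  refine squeeze_zero_norm (fun z => ?_) h2
  rw [Real.sqrt_mul (sq_nonneg _), Real.sqrt_sq_eq_abs, norm_mul, Real.norm_eq_abs,
    Real.norm_of_nonneg (Real.sqrt_nonneg _)]
  exact mul_le_mul_of_nonneg_left (Real.sqrt_le_sqrt (le_abs_self _)) (abs_nonneg _)

end Tight

/-- Off an event of probability `κ/2` the function is bounded by `M`, and there `|η f| < ε` as soon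
as `|η| < ε/(|M| + 1)`, which fails with vanishing probability. -/
theorem tight_of_measure_le {f : ℕ × Ω → ℝ}
    (h : ∀ ε : ℝ≥0∞, 0 < ε → ∃ M : ℝ, ∀ᶠ N in atTop, P {ω | M < |f (N, ω)|} ≤ ε) :
    Tight (wpa P) f := by
  intro η hη
  rw [Metric.tendsto_nhds]
  intro ε hε
  rw [eventually_wpa, ENNReal.tendsto_atTop_zero]
  intro κ hκ
  obtain ⟨M, hM⟩ := h (κ / 2) (ENNReal.half_pos hκ.ne')
  have h1 := (Metric.tendsto_nhds.1 hη) (ε / (|M| + 1)) (by positivity)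
  rw [eventually_wpa] at h1
  have h2 := h1.eventually_le_const (ENNReal.half_pos hκ.ne')
  rw [← eventually_atTop]
  filter_upwards [hM, h2] with N hN1 hN2
  rw [← ENNReal.add_halves κ]
  refine (measure_mono ?_).trans ((measure_union_le _ _).trans (add_le_add hN1 hN2))
  intro ω hω
  by_contra hcon
  simp only [Real.dist_eq, sub_zero, Set.mem_union, Set.mem_ofPred_eq, not_or, not_lt,
    not_le, abs_mul] at hω hcon
  obtain ⟨h3, h4⟩ := hcon
  rw [lt_div_iff₀ (by positivity)] at h4
  have : |η (N, ω)| * |f (N, ω)| ≤ |η (N, ω)| * (|M| + 1) :=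
    mul_le_mul_of_nonneg_left (by linarith [le_abs_self M]) (abs_nonneg _)
  linarith

theorem IsBigOp.tight [NormedAddCommGroup E] {ξ : ℕ → Ω → E} {r : ℕ → ℝ}
    (h : IsBigOp P ξ r) (hr : ∀ᶠ N in atTop, 0 < r N) :
    Tight (wpa P) fun z => (r z.1)⁻¹ * ‖ξ z.1 z.2‖ := by
  refine tight_of_measure_le fun ε hε => ?_
  obtain ⟨M, hM⟩ := h ε hε
  refine ⟨M, ?_⟩
  filter_upwards [hM, hr] with N hN hr
  refine le_trans (measure_mono fun ω hω => ?_) hN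
  simp only [abs_mul, abs_inv, abs_norm, abs_of_pos hr, Set.mem_ofPred_eq] at hω ⊢
  rwa [← div_eq_inv_mul, lt_div_iff₀ hr] at hω

theorem tight_of_lintegral_le {f : ℕ → Ω → ℝ} {C : ℝ≥0∞} (hC : C ≠ ∞)
    (hf : ∀ N, AEMeasurable (f N) P) (h : ∀ᶠ N in atTop, ∫⁻ ω, ‖f N ω‖ₑ ∂P ≤ C) :
    Tight (wpa P) fun z => f z.1 z.2 := by
  refine tight_of_measure_le fun ε hε => ?_
  by_cases hε' : ε = ∞
  · exact ⟨0, by simp [hε']⟩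
  -- Markov's inequality at level `M` leaves probability `C/M`. The witness is `C/ε + 1`, where the
  -- `1` keeps it positive if `C = 0`.
  have hM : ∃ M : ℝ≥0, 0 < M ∧ C / M ≤ ε := by
    refine ⟨(C / ε).toNNReal + 1, by positivity, ?_⟩
    have hfin : C / ε ≠ ∞ := ENNReal.div_ne_top hC hε.ne'
    rw [ENNReal.coe_add, ENNReal.coe_toNNReal hfin, ENNReal.div_le_iff (by simp) (by simp [hfin]),
      mul_add, ENNReal.mul_div_cancel hε.ne' hε']
    exact le_self_add
  obtain ⟨M, hM0, hM⟩ := hM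
  refine ⟨M, ?_⟩
  filter_upwards [h] with N hN
  refine le_trans ?_ hM
  refine (measure_mono (t := {ω | (M : ℝ≥0∞) ≤ ‖f N ω‖ₑ}) fun ω hω => ?_).trans
    ((meas_ge_le_lintegral_div (hf N).enorm (by simpa using hM0.ne') (by simp)).trans
      (ENNReal.div_le_div_right hN _))
  simp only [Set.mem_ofPred_eq] at hω ⊢
  rw [← ofReal_norm, Real.norm_eq_abs, ← ENNReal.ofReal_coe_nnreal]
  exact ENNReal.ofReal_le_ofReal hω.le

theorem tendsto_wpa_of_lintegral {f : ℕ → Ω → ℝ}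
    (hf : ∀ N, AEMeasurable (f N) P) (h : Tendsto (fun N => ∫⁻ ω, ‖f N ω‖ₑ ∂P) atTop (𝓝 0)) :
    Tendsto (fun z => f z.1 z.2) (wpa P) (𝓝 0) := by
  rw [Metric.tendsto_nhds]
  intro ε hε
  rw [eventually_wpa]
  have h2 : Tendsto (fun N => (∫⁻ ω, ‖f N ω‖ₑ ∂P) / ENNReal.ofReal ε) atTop (𝓝 0) := by
    simpa using ENNReal.Tendsto.div_const h (b := ENNReal.ofReal ε) (Or.inr (by simpa using hε))
  refine tendsto_of_tendsto_of_tendsto_of_le_of_le tendsto_const_nhds h2 (fun _ => zero_le)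
    fun N => ?_
  refine (measure_mono (t := {ω | ENNReal.ofReal ε ≤ ‖f N ω‖ₑ}) fun ω hω => ?_).trans
    (meas_ge_le_lintegral_div (hf N).enorm (by simpa using hε) (by simp))
  simp only [Real.dist_eq, sub_zero, not_lt, Set.mem_ofPred_eq] at hω ⊢
  rw [← ofReal_norm, Real.norm_eq_abs]
  exact ENNReal.ofReal_le_ofReal hω

theorem tight_average {f : ℕ → ℕ → Ω → ℝ} {S : ℕ → Finset ℕ} {C : ℝ≥0∞} (hC : C ≠ ∞)
    (hS : ∀ N, S N ⊆ Finset.range N) (hf : ∀ N i, AEMeasurable (f N i) P)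
    (h : ∀ N i, ∫⁻ ω, ‖f N i ω‖ₑ ∂P ≤ C) :
    Tight (wpa P) fun z => (z.1 : ℝ)⁻¹ * ∑ i ∈ S z.1, |f z.1 i z.2| := by
  refine tight_of_lintegral_le (f := fun N ω => (N : ℝ)⁻¹ * ∑ i ∈ S N, |f N i ω|) hC
    (fun N => ?_) ?_
  · refine AEMeasurable.const_mul (Finset.aemeasurable_fun_sum _ fun i _ => (hf N i).norm) _
  filter_upwards [eventually_gt_atTop 0] with N hN
  have hN' : (0 : ℝ) < N := by exact_mod_cast hN
  calc ∫⁻ ω, ‖(N : ℝ)⁻¹ * ∑ i ∈ S N, |f N i ω|‖ₑ ∂P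
      ≤ ∫⁻ ω, ‖(N : ℝ)⁻¹‖ₑ * ∑ i ∈ S N, ‖f N i ω‖ₑ ∂P := by
        refine lintegral_mono fun ω => ?_
        rw [enorm_mul]
        gcongr
        refine (enorm_sum_le _ _).trans (le_of_eq ?_)
        simp
    _ = ‖(N : ℝ)⁻¹‖ₑ * ∑ i ∈ S N, ∫⁻ ω, ‖f N i ω‖ₑ ∂P := by
        rw [lintegral_const_mul'' _ (Finset.aemeasurable_fun_sum _ fun i _ => (hf N i).enorm),
          lintegral_finsetSum' _ fun i _ => (hf N i).enorm]
    _ ≤ ‖(N : ℝ)⁻¹‖ₑ * ∑ i ∈ Finset.range N, C := by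
        gcongr
        exact (Finset.sum_le_sum fun i _ => h N i).trans
          (Finset.sum_le_sum_of_subset (hS N))
    _ = C := by
        rw [Finset.sum_const, Finset.card_range, nsmul_eq_mul, ← mul_assoc,
          ← ofReal_norm, Real.norm_of_nonneg (by positivity),
          ENNReal.ofReal_inv_of_pos hN', ENNReal.ofReal_natCast,
          ENNReal.inv_mul_cancel (by simpa using hN.ne') (by simp), one_mul]

end WithProbability

end OrthMoment

namespace OrthMoment

/-! ### Conditional expectations -/

section CondExp

variable {Ω E F : Type*} {m0 : MeasurableSpace Ω}
  [NormedAddCommGroup F] [NormedSpace ℝ F] [CompleteSpace F] {P : Measure Ω} [IsProbabilityMeasure P]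

/-- Change of variables on each set `U ⁻¹' t`. As all individuals have the same law, it makes `a_i`
one and the same function of the data of individual `i`. -/
theorem condExp_comp_map {m' mE : MeasurableSpace E} (hm : m' ≤ mE) {U : Ω → E} (hU : Measurable U)
    {f : E → F} (hf : Integrable f (P.map U)) :
    P[f ∘ U | m'.comap U] =ᵐ[P] (P.map U)[f | m'] ∘ U := by
  have : IsProbabilityMeasure (P.map U) := Measure.isProbabilityMeasure_map hU.aemeasurable
  have hle : m'.comap U ≤ m0 := (MeasurableSpace.comap_mono hm).trans hU.comap_le
  have hfU : Integrable (f ∘ U) P := hf.comp_measurable hU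
  symm
  refine ae_eq_condExp_of_forall_setIntegral_eq hle hfU (fun s _ _ => ?_) (fun s hs _ => ?_) ?_
  · exact (integrable_condExp.comp_measurable hU).integrableOn
  · obtain ⟨t, ht, rfl⟩ := hs
    have h1 : ∫ x in U ⁻¹' t, ((P.map U)[f | m'] ∘ U) x ∂P = ∫ y in t, (P.map U)[f | m'] y ∂P.map U :=
      (setIntegral_map (hm t ht) integrable_condExp.aestronglyMeasurable hU.aemeasurable).symm
    have h2 : ∫ x in U ⁻¹' t, (f ∘ U) x ∂P = ∫ y in t, f y ∂P.map U :=
      (setIntegral_map (hm t ht) hf.aestronglyMeasurable hU.aemeasurable).symm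
    rw [h1, h2, setIntegral_condExp hm hf ht]
  · exact (stronglyMeasurable_condExp.comp_measurable
      (comap_measurable U : Measurable[m'.comap U, m'] U)).aestronglyMeasurable

/-- Information independent of both `V` and `m₁` jointly is irrelevant. The defining integrals agree
on the intersections `s ∩ t`, which form a π-system generating the join, and extend by Dynkin's
argument. -/
theorem condExp_sup_of_indep {m₁ m₂ k : MeasurableSpace Ω} (hm : m₁ ≤ k) (hk : k ≤ m0)
    (hm₂ : m₂ ≤ m0) (hind : Indep k m₂ P) {V : Ω → ℝ} (hV : StronglyMeasurable[k] V)
    (hVi : Integrable V P) : P[V | m₁ ⊔ m₂] =ᵐ[P] P[V | m₁] := by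
  have hm₁ : m₁ ≤ m0 := hm.trans hk
  have hle : m₁ ⊔ m₂ ≤ m0 := sup_le hm₁ hm₂
  -- Independence splits off the factor `P t`. The identity is applied both to `V` and to its
  -- conditional expectation.
  have key : ∀ s t, MeasurableSet[m₁] s → MeasurableSet[m₂] t → ∀ W : Ω → ℝ,
      StronglyMeasurable[k] W → Integrable W P →
      ∫ ω in s ∩ t, W ω ∂P = P.real t * ∫ ω in s, W ω ∂P := by
    intro s t hs ht W hW hWi
    have h1 : StronglyMeasurable[k] (s.indicator W) := hW.indicator (hm s hs)
    have h2 := condExp_indep_eq hk hm₂ h1 hind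
    calc ∫ ω in s ∩ t, W ω ∂P = ∫ ω in t, s.indicator W ω ∂P := by
          rw [setIntegral_indicator (hm₁ s hs), Set.inter_comm]
      _ = ∫ ω in t, (P[s.indicator W | m₂]) ω ∂P :=
          (setIntegral_condExp hm₂ (hWi.indicator (hm₁ s hs)) ht).symm
      _ = ∫ _ in t, P[s.indicator W] ∂P :=
          setIntegral_congr_ae (hm₂ t ht) (h2.mono fun ω h _ => h)
      _ = P.real t * ∫ ω in s, W ω ∂P := by
          rw [setIntegral_const, integral_indicator (hm₁ s hs), smul_eq_mul]
  symm
  refine ae_eq_condExp_of_forall_setIntegral_eq hle hVi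
    (fun s _ _ => integrable_condExp.integrableOn) (fun s hs _ => ?_)
    (StronglyMeasurable.aestronglyMeasurable
      (stronglyMeasurable_condExp.mono (le_sup_left : m₁ ≤ m₁ ⊔ m₂)))
  have hgen : m₁ ⊔ m₂ = MeasurableSpace.generateFrom
      {u | ∃ s t, MeasurableSet[m₁] s ∧ MeasurableSet[m₂] t ∧ u = s ∩ t} := by
    apply le_antisymm
    · refine sup_le (fun s hs => ?_) fun t ht => ?_
      · exact MeasurableSpace.measurableSet_generateFrom
          ⟨s, Set.univ, hs, MeasurableSet.univ, by simp⟩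
      · exact MeasurableSpace.measurableSet_generateFrom
          ⟨Set.univ, t, MeasurableSet.univ, ht, by simp⟩
    · refine MeasurableSpace.generateFrom_le ?_
      rintro u ⟨s, t, hs, ht, rfl⟩
      exact MeasurableSet.inter (le_sup_left (a := m₁) (b := m₂) s hs)
        (le_sup_right (a := m₁) (b := m₂) t ht)
  have hpi : IsPiSystem {u | ∃ s t, MeasurableSet[m₁] s ∧ MeasurableSet[m₂] t ∧ u = s ∩ t} := by
    rintro _ ⟨s, t, hs, ht, rfl⟩ _ ⟨s', t', hs', ht', rfl⟩ _
    exact ⟨s ∩ s', t ∩ t', hs.inter hs', ht.inter ht', Set.inter_inter_inter_comm _ _ _ _⟩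
  refine MeasurableSpace.induction_on_inter
    (C := fun s _ => ∫ ω in s, (P[V | m₁]) ω ∂P = ∫ ω in s, V ω ∂P) hgen hpi ?_ ?_ ?_ ?_ s hs
  · simp
  · rintro _ ⟨s, t, hs, ht, rfl⟩
    rw [key s t hs ht V hV hVi, key s t hs ht _ (stronglyMeasurable_condExp.mono hm)
      integrable_condExp, setIntegral_condExp hm₁ hVi hs]
  · intro t ht h
    rw [setIntegral_compl (hle t ht) integrable_condExp, setIntegral_compl (hle t ht) hVi, h,
      integral_condExp hm₁]
  · intro f hd hf h
    rw [integral_iUnion (fun i => hle _ (hf i)) hd integrable_condExp.integrableOn,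
      integral_iUnion (fun i => hle _ (hf i)) hd hVi.integrableOn]
    exact tsum_congr h

/-- The measures with densities `V` and `P[V | k]` coincide on `k`. Arguing with densities avoids
any integrability condition on the weight `f`. -/
theorem lintegral_mul_condExp {k : MeasurableSpace Ω} (hk : k ≤ m0) {V : Ω → ℝ}
    (hVi : Integrable V P) (hV0 : 0 ≤ᵐ[P] V) {f : Ω → ℝ≥0∞} (hf : Measurable[k] f) :
    ∫⁻ ω, f ω * ENNReal.ofReal (V ω) ∂P = ∫⁻ ω, f ω * ENNReal.ofReal ((P[V | k]) ω) ∂P := by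
  have hC0 : 0 ≤ᵐ[P] P[V | k] := condExp_nonneg hV0
  have hVm : AEMeasurable (fun ω => ENNReal.ofReal (V ω)) P := hVi.aemeasurable.ennreal_ofReal
  have hCm : AEMeasurable (fun ω => ENNReal.ofReal ((P[V | k]) ω)) P :=
    integrable_condExp.aemeasurable.ennreal_ofReal
  have hmeas : (P.withDensity fun ω => ENNReal.ofReal (V ω)).trim hk =
      (P.withDensity fun ω => ENNReal.ofReal ((P[V | k]) ω)).trim hk := by
    refine @Measure.ext _ k _ _ fun s hs => ?_
    rw [trim_measurableSet_eq hk hs, trim_measurableSet_eq hk hs,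
      withDensity_apply _ (hk s hs), withDensity_apply _ (hk s hs),
      ← ofReal_integral_eq_lintegral_ofReal hVi.integrableOn (ae_restrict_of_ae hV0),
      ← ofReal_integral_eq_lintegral_ofReal integrable_condExp.integrableOn
        (ae_restrict_of_ae hC0), setIntegral_condExp hk hVi hs]
  have h1 := lintegral_trim (μ := P.withDensity fun ω => ENNReal.ofReal (V ω)) hk hf
  have h2 := lintegral_trim (μ := P.withDensity fun ω => ENNReal.ofReal ((P[V | k]) ω)) hk hf
  rw [hmeas, h2] at h1
  rw [lintegral_withDensity_eq_lintegral_mul₀ hVm (hf.mono hk le_rfl).aemeasurable,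
    lintegral_withDensity_eq_lintegral_mul₀ hCm (hf.mono hk le_rfl).aemeasurable] at h1
  simpa [mul_comm] using h1.symm

theorem integral_mul_eq_zero_of_condExp {k : MeasurableSpace Ω} (hk : k ≤ m0) {f V : Ω → ℝ}
    (hf : AEStronglyMeasurable[k] f P) (hV : Integrable V P) (hfV : Integrable (f * V) P)
    (h : P[V | k] =ᵐ[P] 0) : ∫ ω, f ω * V ω ∂P = 0 := by
  have h1 := condExp_mul_of_aestronglyMeasurable_left hf hfV hV
  have h2 := integral_condExp (f := f * V) (μ := P) hk
  rw [← Pi.mul_def, ← h2, integral_congr_ae h1]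
  refine integral_eq_zero_of_ae ?_
  filter_upwards [h] with ω hω
  simp [hω]

end CondExp

/-! ### Limit theorems for triangular arrays -/

section Arrays

variable {Ω : Type*} [MeasurableSpace Ω] {P : Measure Ω} [IsProbabilityMeasure P]

/-- Truncation at `K`. The truncated average has variance at most `K²/|S|`, and `|Y| ≤ η + Y²/η`
turns this into a bound in mean. The discarded tails enter twice, through the average and through
the expectation. Being explicit, the bound is uniform over the rows of an array. -/
theorem integral_abs_average_le {ξ : ℕ → Ω → ℝ} {S : Finset ℕ} (hS : S.Nonempty)
    (hint : Integrable (ξ 0) P) (hind : Pairwise fun i j => IndepFun (ξ i) (ξ j) P)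
    (hid : ∀ i, IdentDistrib (ξ i) (ξ 0) P P) {K η : ℝ} (hK : 0 ≤ K) (hη : 0 < η) :
    ∫ ω, |(S.card : ℝ)⁻¹ * ∑ i ∈ S, ξ i ω - ∫ ω', ξ 0 ω' ∂P| ∂P ≤
      η + K ^ 2 / (S.card * η) + 2 * ∫ ω in {ω | K < |ξ 0 ω|}, |ξ 0 ω| ∂P := by
  classical
  set τ : ℝ → ℝ := fun x => if |x| ≤ K then x else 0 with hτ
  have hτm : Measurable τ :=
    Measurable.ite (measurableSet_le measurable_id.abs measurable_const) measurable_id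
      measurable_const
  have hτb : ∀ x, |τ x| ≤ K := by
    intro x
    simp only [hτ]
    split_ifs with h
    · exact h
    · simpa using hK
  have hm : ∀ i, AEMeasurable (ξ i) P := fun i => (hid i).aemeasurable_fst
  have hn : (0 : ℝ) < S.card := by exact_mod_cast hS.card_pos
  have hτL : ∀ i, MemLp (fun ω => τ (ξ i ω)) 2 P := fun i =>
    MemLp.of_bound (hτm.comp_aemeasurable (hm i)).aestronglyMeasurable K
      (Eventually.of_forall fun ω => hτb _)
  have hτi : ∀ i, Integrable (fun ω => τ (ξ i ω)) P := fun i => (hτL i).integrable (by norm_num)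
  have hξi : ∀ i, Integrable (ξ i) P := fun i => (hid i).integrable_iff.2 hint
  have hτe : ∀ i, ∫ ω, τ (ξ i ω) ∂P = ∫ ω, τ (ξ 0 ω) ∂P := fun i =>
    ((hid i).comp hτm).integral_eq
  have hρe : ∀ i, ∫ ω, |ξ i ω - τ (ξ i ω)| ∂P = ∫ ω in {ω | K < |ξ 0 ω|}, |ξ 0 ω| ∂P := by
    intro i
    have h1 : ∫ ω, |ξ i ω - τ (ξ i ω)| ∂P = ∫ ω, |ξ 0 ω - τ (ξ 0 ω)| ∂P :=
      ((hid i).comp (u := fun x => |x - τ x|) ((measurable_id.sub hτm).abs)).integral_eq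
    have hset : NullMeasurableSet {ω | K < |ξ 0 ω|} P :=
      nullMeasurableSet_lt aemeasurable_const (hm 0).norm
    rw [h1, ← integral_indicator₀ hset]
    congr 1
    ext ω
    by_cases h : K < |ξ 0 ω|
    · simp [Set.indicator, h, hτ, not_le.2 h]
    · simp [Set.indicator, h, hτ, not_lt.1 h]
  set Y : Ω → ℝ := fun ω => (S.card : ℝ)⁻¹ * ∑ i ∈ S, τ (ξ i ω) - ∫ ω', τ (ξ 0 ω') ∂P with hY
  have hYL : MemLp Y 2 P := by
    have h1 : MemLp (fun ω => ∑ i ∈ S, τ (ξ i ω)) 2 P := memLp_finsetSum S fun i _ => hτL i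
    exact (h1.const_mul _).sub (memLp_const _)
  have hYi : Integrable Y P := hYL.integrable (by norm_num)
  have hY2 : ∫ ω, Y ω ^ 2 ∂P ≤ K ^ 2 / S.card := by
    have hvar : Var[fun ω => (S.card : ℝ)⁻¹ * ∑ i ∈ S, τ (ξ i ω); P] ≤ K ^ 2 / S.card := by
      have hsum := IndepFun.variance_sum (X := fun i ω => τ (ξ i ω)) (s := S) (fun i _ => hτL i)
        fun i _ j _ hij => (hind hij).comp hτm hτm
      have hfun : (∑ i ∈ S, fun ω => τ (ξ i ω)) = fun ω => ∑ i ∈ S, τ (ξ i ω) := by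
        ext ω; simp
      rw [hfun] at hsum
      rw [variance_const_mul, hsum]
      have hv : ∀ i ∈ S, Var[fun ω => τ (ξ i ω); P] ≤ K ^ 2 := by
        intro i _
        refine (variance_le_expectation_sq (hτL i).aestronglyMeasurable).trans ?_
        calc ∫ ω, ((fun ω => τ (ξ i ω)) ^ 2) ω ∂P ≤ ∫ _, K ^ 2 ∂P := by
              refine integral_mono (hτL i).integrable_sq (integrable_const _) fun ω => ?_
              exact sq_le_sq.2 ((hτb _).trans (le_abs_self K))
          _ = K ^ 2 := by simp
      calc ((S.card : ℝ)⁻¹) ^ 2 * ∑ i ∈ S, Var[fun ω => τ (ξ i ω); P]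
          ≤ ((S.card : ℝ)⁻¹) ^ 2 * (S.card * K ^ 2) := by
            gcongr
            simpa using Finset.sum_le_sum hv
        _ = K ^ 2 / S.card := by field_simp
    have hmean : ∫ ω, (S.card : ℝ)⁻¹ * ∑ i ∈ S, τ (ξ i ω) ∂P = ∫ ω', τ (ξ 0 ω') ∂P := by
      rw [integral_const_mul, integral_finsetSum _ fun i _ => hτi i]
      simp only [hτe, Finset.sum_const, nsmul_eq_mul]
      field_simp
    rw [variance_eq_integral] at hvar
    · simpa [hY, hmean] using hvar
    · exact (AEMeasurable.const_mul (Finset.aemeasurable_fun_sum _ fun i _ =>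
        (hτi i).aemeasurable) _)
  have hY1 : ∫ ω, |Y ω| ∂P ≤ η + K ^ 2 / (S.card * η) := by
    calc ∫ ω, |Y ω| ∂P ≤ ∫ ω, (η + η⁻¹ * Y ω ^ 2) ∂P := by
          refine integral_mono hYi.abs ((integrable_const _).add (hYL.integrable_sq.const_mul _))
            fun ω => ?_
          have : |Y ω| * η ≤ η * η + Y ω ^ 2 := by nlinarith [sq_abs (Y ω), sq_nonneg (|Y ω| - η)]
          have h3 := (le_div_iff₀ hη).2 this
          calc |Y ω| ≤ (η * η + Y ω ^ 2) / η := h3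
            _ = η + η⁻¹ * Y ω ^ 2 := by field_simp
      _ = η + η⁻¹ * ∫ ω, Y ω ^ 2 ∂P := by
          rw [integral_add (integrable_const _) (hYL.integrable_sq.const_mul _),
            integral_const_mul]
          simp
      _ ≤ η + η⁻¹ * (K ^ 2 / S.card) := by gcongr
      _ = η + K ^ 2 / (S.card * η) := by field_simp
  set R : ℝ := ∫ ω in {ω | K < |ξ 0 ω|}, |ξ 0 ω| ∂P
  have hdi : ∀ i, Integrable (fun ω => |ξ i ω - τ (ξ i ω)|) P := fun i => ((hξi i).sub (hτi i)).abs
  have hpoint : ∀ ω, |(S.card : ℝ)⁻¹ * ∑ i ∈ S, ξ i ω - ∫ ω', ξ 0 ω' ∂P| ≤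
      |Y ω| + (S.card : ℝ)⁻¹ * ∑ i ∈ S, |ξ i ω - τ (ξ i ω)| + R := by
    intro ω
    have h1 : (S.card : ℝ)⁻¹ * ∑ i ∈ S, ξ i ω - ∫ ω', ξ 0 ω' ∂P =
        Y ω + (S.card : ℝ)⁻¹ * ∑ i ∈ S, (ξ i ω - τ (ξ i ω)) -
          ∫ ω', (ξ 0 ω' - τ (ξ 0 ω')) ∂P := by
      rw [integral_sub (hξi 0) (hτi 0), Finset.sum_sub_distrib]
      simp only [hY]
      ring
    have h2 : |∫ ω', (ξ 0 ω' - τ (ξ 0 ω')) ∂P| ≤ R :=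
      (abs_integral_le_integral_abs).trans (hρe 0).le
    have h3 : |(S.card : ℝ)⁻¹ * ∑ i ∈ S, (ξ i ω - τ (ξ i ω))| ≤
        (S.card : ℝ)⁻¹ * ∑ i ∈ S, |ξ i ω - τ (ξ i ω)| := by
      rw [abs_mul, abs_of_pos (inv_pos.2 hn)]
      gcongr
      exact Finset.abs_sum_le_sum_abs _ _
    rw [h1]
    refine (abs_sub _ _).trans (add_le_add ((abs_add_le _ _).trans (add_le_add le_rfl h3)) h2)
  have hsi : Integrable (fun ω => (S.card : ℝ)⁻¹ * ∑ i ∈ S, |ξ i ω - τ (ξ i ω)|) P :=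
    (integrable_finsetSum _ fun i _ => hdi i).const_mul _
  calc ∫ ω, |(S.card : ℝ)⁻¹ * ∑ i ∈ S, ξ i ω - ∫ ω', ξ 0 ω' ∂P| ∂P
      ≤ ∫ ω, (|Y ω| + (S.card : ℝ)⁻¹ * ∑ i ∈ S, |ξ i ω - τ (ξ i ω)| + R) ∂P := by
        refine integral_mono ?_ ((hYi.abs.add hsi).add (integrable_const _)) hpoint
        exact ((((integrable_finsetSum _ fun i _ => hξi i).const_mul _).sub
          (integrable_const _)).abs)
    _ = ∫ ω, |Y ω| ∂P + R + R := by
        have h4 : ∫ ω, (S.card : ℝ)⁻¹ * ∑ i ∈ S, |ξ i ω - τ (ξ i ω)| ∂P = R := by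
          rw [integral_const_mul, integral_finsetSum _ fun i _ => hdi i]
          simp only [hρe, Finset.sum_const, nsmul_eq_mul]
          field_simp
        have hadd : Integrable (fun ω => |Y ω| + (S.card : ℝ)⁻¹ * ∑ i ∈ S, |ξ i ω - τ (ξ i ω)|) P :=
          hYi.abs.add hsi
        rw [integral_add hadd (integrable_const _), integral_add hYi.abs hsi, h4]
        simp
    _ ≤ η + K ^ 2 / (S.card * η) + 2 * R := by linarith

/-- The level `K` is fixed by the uniform tail bound before the number of summands grows.
Convergence holds in `L¹`, hence in probability. -/
theorem weak_law_array {ξ : ℕ → ℕ → Ω → ℝ} {S : ℕ → Finset ℕ}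
    (hS : Tendsto (fun N => (S N).card) atTop atTop)
    (hint : ∀ N, Integrable (ξ N 0) P) (hind : ∀ N, Pairwise fun i j => IndepFun (ξ N i) (ξ N j) P)
    (hid : ∀ N i, IdentDistrib (ξ N i) (ξ N 0) P P)
    (htail : ∀ ε : ℝ, 0 < ε → ∃ K : ℝ, 0 ≤ K ∧ ∀ N, ∫ ω in {ω | K < |ξ N 0 ω|}, |ξ N 0 ω| ∂P ≤ ε) :
    Tendsto (fun z : ℕ × Ω => ((S z.1).card : ℝ)⁻¹ * ∑ i ∈ S z.1, ξ z.1 i z.2 -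
      ∫ ω', ξ z.1 0 ω' ∂P) (wpa P) (𝓝 0) := by
  have hξi : ∀ N i, Integrable (ξ N i) P := fun N i => (hid N i).integrable_iff.2 (hint N)
  have hXi : ∀ N, Integrable (fun ω => ((S N).card : ℝ)⁻¹ * ∑ i ∈ S N, ξ N i ω -
      ∫ ω', ξ N 0 ω' ∂P) P := fun N =>
    ((integrable_finsetSum _ fun i _ => hξi N i).const_mul _).sub (integrable_const _)
  refine tendsto_wpa_of_lintegral (f := fun N ω => ((S N).card : ℝ)⁻¹ * ∑ i ∈ S N, ξ N i ω -
      ∫ ω', ξ N 0 ω' ∂P) (fun N => (hXi N).aemeasurable) ?_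
  simp only [← ofReal_integral_norm_eq_lintegral_enorm (hXi _)]
  rw [← ENNReal.ofReal_zero]
  refine ENNReal.tendsto_ofReal ?_
  rw [Metric.tendsto_nhds]
  intro ε hε
  obtain ⟨K, hK0, hK⟩ := htail (ε / 8) (by positivity)
  have hlim : Tendsto (fun N => K ^ 2 / (((S N).card : ℝ) * (ε / 4))) atTop (𝓝 0) := by
    refine Tendsto.const_div_atTop ?_ _
    exact (tendsto_natCast_atTop_atTop.comp hS).atTop_mul_const (by positivity)
  filter_upwards [hS.eventually_gt_atTop 0, hlim.eventually_lt_const (show 0 < ε / 4 by positivity)]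
    with N hN hN2
  have h := integral_abs_average_le (Finset.card_pos.1 hN) (hint N) (hind N) (hid N) hK0
    (show 0 < ε / 4 by positivity)
  simp only [Real.norm_eq_abs]
  rw [Real.dist_eq, sub_zero, abs_of_nonneg (integral_nonneg fun _ => abs_nonneg _)]
  linarith [hK N]

/-- For `|y| ≤ 1` the Taylor remainder is at most `|y|³ e`; for `|y| ≥ 1` the triangle inequality
suffices. The cubic bound serves the bulk and the quadratic one the tail in Lindeberg's argument. -/
theorem norm_exp_mul_I_sub_le (y : ℝ) :
    ‖Complex.exp (y * Complex.I) - 1 - y * Complex.I + y ^ 2 / 2‖ ≤ 4 * y ^ 2 ∧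
    ‖Complex.exp (y * Complex.I) - 1 - y * Complex.I + y ^ 2 / 2‖ ≤ 4 * |y| ^ 3 := by
  have hy : ‖(y : ℂ) * Complex.I‖ = |y| := by simp
  rcases le_total |y| 1 with h | h
  · have h1 := Complex.norm_exp_sub_sum_le_norm_mul_exp ((y : ℂ) * Complex.I) 3
    rw [hy] at h1
    have h2 : Complex.exp (y * Complex.I) - ∑ m ∈ Finset.range 3, (y * Complex.I) ^ m / m.factorial =
        Complex.exp (y * Complex.I) - 1 - y * Complex.I + y ^ 2 / 2 := by
      simp [Finset.sum_range_succ, mul_pow]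
      ring
    rw [h2] at h1
    have h3 : Real.exp |y| ≤ 4 := by
      have := Real.exp_one_lt_d9
      have h5 := Real.exp_le_exp.2 h
      linarith
    have h4 : |y| ^ 3 * Real.exp |y| ≤ 4 * |y| ^ 3 := by
      nlinarith [pow_nonneg (abs_nonneg y) 3]
    refine ⟨h1.trans (h4.trans ?_), h1.trans h4⟩
    rw [← sq_abs y]
    nlinarith [sq_nonneg |y|, abs_nonneg y]
  · have h1 : ‖Complex.exp (y * Complex.I) - 1 - y * Complex.I + y ^ 2 / 2‖ ≤
        1 + 1 + |y| + y ^ 2 / 2 := by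
      refine (norm_add_le _ _).trans (add_le_add ((norm_sub_le _ _).trans (add_le_add
        ((norm_sub_le _ _).trans (add_le_add ?_ ?_)) ?_)) ?_)
      · rw [Complex.norm_exp_ofReal_mul_I]
      · simp
      · simp
      · simp
    have h2 : 1 + 1 + |y| + y ^ 2 / 2 ≤ 4 * y ^ 2 := by
      rw [← sq_abs y]
      nlinarith
    refine ⟨h1.trans h2, h1.trans (h2.trans ?_)⟩
    rw [← sq_abs y]
    nlinarith [sq_nonneg |y|, abs_nonneg y]

end Arrays

end OrthMoment

namespace OrthMoment

/-! ### A central limit theorem for triangular arrays of random vectors -/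

section CentralLimit

variable {Ω : Type*} [MeasurableSpace Ω] {P : Measure Ω} {q : ℕ}

theorem inner_sq_eq_sum_outer (v t : Vec q) :
    (inner ℝ v t) ^ 2 = ∑ r, ∑ s, t r * t s * outer v r s := by
  have h : inner ℝ v t = ∑ r, t r * v r := by
    simp [PiLp.inner_apply]
  rw [h, sq, Finset.sum_mul_sum]
  refine Finset.sum_congr rfl fun r _ => Finset.sum_congr rfl fun s _ => ?_
  simp only [outer, Matrix.of_apply]
  ring

theorem abs_outer_le (v : Vec q) (r s : Fin q) : |outer v r s| ≤ ‖v‖ ^ 2 := by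
  simp only [outer, Matrix.of_apply, abs_mul, sq]
  exact mul_le_mul (PiLp.norm_apply_le v r) (PiLp.norm_apply_le v s) (abs_nonneg _) (norm_nonneg _)

theorem integrable_outer {ξ : Ω → Vec q} (hξ : MemLp ξ 2 P) (r s : Fin q) :
    Integrable (fun ω => outer (ξ ω) r s) P := by
  refine hξ.integrable_norm_pow (by norm_num) |>.mono ?_ (Eventually.of_forall fun ω => ?_)
  · have hm : ∀ r, AEMeasurable (fun ω => ξ ω r) P := fun r =>
      (by fun_prop : Measurable fun v : Vec q => v r).comp_aemeasurable
        hξ.aestronglyMeasurable.aemeasurable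
    exact ((hm r).mul (hm s)).aestronglyMeasurable
  · simpa using abs_outer_le (ξ ω) r s

theorem integral_inner_sq {ξ : Ω → Vec q} (hξ : MemLp ξ 2 P) (t : Vec q) :
    ∫ ω, (inner ℝ (ξ ω) t) ^ 2 ∂P = ∑ r, ∑ s, t r * t s * ∫ ω, outer (ξ ω) r s ∂P := by
  simp only [inner_sq_eq_sum_outer]
  rw [integral_finsetSum _ fun r _ => integrable_finsetSum _ fun s _ =>
    (integrable_outer hξ r s).const_mul _]
  refine Finset.sum_congr rfl fun r _ => ?_
  rw [integral_finsetSum _ fun s _ => (integrable_outer hξ r s).const_mul _]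
  exact Finset.sum_congr rfl fun s _ => integral_const_mul _ _

variable [IsProbabilityMeasure P]

theorem integral_norm_sq_le_of_tail {ξ : Ω → Vec q} (hξ : MemLp ξ 2 P) {K ε : ℝ}
    (htail : ∫ ω in {ω | K < ‖ξ ω‖}, ‖ξ ω‖ ^ 2 ∂P ≤ ε) : ∫ ω, ‖ξ ω‖ ^ 2 ∂P ≤ K ^ 2 + ε := by
  have hset : NullMeasurableSet {ω | K < ‖ξ ω‖} P :=
    nullMeasurableSet_lt aemeasurable_const hξ.aestronglyMeasurable.aemeasurable.norm
  have hi : Integrable (fun ω => ‖ξ ω‖ ^ 2) P := hξ.integrable_norm_pow (by norm_num)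
  calc ∫ ω, ‖ξ ω‖ ^ 2 ∂P
      ≤ ∫ ω, (K ^ 2 + {ω | K < ‖ξ ω‖}.indicator (fun ω => ‖ξ ω‖ ^ 2) ω) ∂P := by
        refine integral_mono hi ((integrable_const _).add (hi.indicator₀ hset)) fun ω => ?_
        by_cases h : K < ‖ξ ω‖
        · simp [Set.indicator, h, sq_nonneg]
        · simp only [Set.indicator, Set.mem_ofPred_eq, h, if_false, add_zero]
          exact pow_le_pow_left₀ (norm_nonneg _) (not_lt.1 h) 2
    _ = K ^ 2 + ∫ ω in {ω | K < ‖ξ ω‖}, ‖ξ ω‖ ^ 2 ∂P := by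
        rw [integral_add (integrable_const _) (hi.indicator₀ hset), integral_indicator₀ hset]
        simp
    _ ≤ K ^ 2 + ε := by gcongr

/-- Lindeberg's estimate: the mean zero removes the linear term of the exponential. Where `‖ξ‖ ≤ K`,
the cubic bound gains a factor `K/√N`; where `‖ξ‖ > K`, the quadratic bound is paid for by the tail
`ε`. -/
theorem norm_mul_charFun_sub_le {ξ : Ω → Vec q} (hξ : MemLp ξ 2 P) (hmean : ∫ ω, ξ ω ∂P = 0)
    {K ε : ℝ} (hK : 0 ≤ K) (htail : ∫ ω in {ω | K < ‖ξ ω‖}, ‖ξ ω‖ ^ 2 ∂P ≤ ε) (t : Vec q) {N : ℕ}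
    (hN : 0 < N) :
    ‖(N : ℂ) * (charFun (P.map ξ) ((√N)⁻¹ • t) - 1) +
        ((∫ ω, (inner ℝ (ξ ω) t) ^ 2 ∂P : ℝ) : ℂ) / 2‖ ≤
      4 * ‖t‖ ^ 3 * K * (K ^ 2 + ε) / √N + 4 * ‖t‖ ^ 2 * ε := by
  have hN0 : (0 : ℝ) < N := by exact_mod_cast hN
  have hs0 : 0 < √(N : ℝ) := Real.sqrt_pos.2 hN0
  have hss : √(N : ℝ) ^ 2 = N := Real.sq_sqrt hN0.le
  have hset : NullMeasurableSet {ω | K < ‖ξ ω‖} P :=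
    nullMeasurableSet_lt aemeasurable_const hξ.aestronglyMeasurable.aemeasurable.norm
  have hi : Integrable (fun ω => ‖ξ ω‖ ^ 2) P := hξ.integrable_norm_pow (by norm_num)
  set y : Ω → ℝ := fun ω => inner ℝ (ξ ω) ((√N)⁻¹ • t) with hy
  have hy' : ∀ ω, y ω = (√N)⁻¹ * inner ℝ (ξ ω) t := fun ω => by
    simp only [hy, inner_smul_right]
  have hwL : MemLp (fun ω => inner ℝ (ξ ω) t) 2 P := hξ.inner_const t
  have hyL : MemLp y 2 P := hξ.inner_const _
  have hyi : Integrable y P := hyL.integrable (by norm_num)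
  have hym : AEStronglyMeasurable (fun ω => Complex.exp (y ω * Complex.I)) P := by
    have := hyi.aestronglyMeasurable.aemeasurable
    exact (by fun_prop : AEMeasurable (fun ω => Complex.exp (y ω * Complex.I)) P).aestronglyMeasurable
  have hei : Integrable (fun ω => Complex.exp (y ω * Complex.I)) P := by
    refine (integrable_const (1 : ℝ)).mono' hym (Eventually.of_forall fun ω => ?_)
    rw [Complex.norm_exp_ofReal_mul_I]
  have hy0 : ∫ ω, y ω ∂P = 0 := by
    have := integral_inner (𝕜 := ℝ) (hξ.integrable (by norm_num)) ((√(N : ℝ))⁻¹ • t)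
    rw [hmean, inner_zero_right] at this
    simpa only [hy, real_inner_comm] using this
  have hysq : (N : ℝ) * ∫ ω, y ω ^ 2 ∂P = ∫ ω, (inner ℝ (ξ ω) t) ^ 2 ∂P := by
    rw [← integral_const_mul]
    congr 1
    ext ω
    rw [hy', mul_pow, inv_pow, hss]
    field_simp
  have hyC : Integrable (fun ω => (y ω : ℂ) * Complex.I) P := hyi.ofReal.mul_const _
  have hy2C : Integrable (fun ω => (y ω : ℂ) ^ 2 / 2) P := by
    have := (hyL.integrable_sq.ofReal (𝕜 := ℂ)).div_const 2
    simpa using this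
  have hchar : charFun (P.map ξ) ((√N)⁻¹ • t) = ∫ ω, Complex.exp (y ω * Complex.I) ∂P := by
    rw [charFun_apply, integral_map hξ.aestronglyMeasurable.aemeasurable
      (by fun_prop)]
  have hrep : (N : ℂ) * (charFun (P.map ξ) ((√N)⁻¹ • t) - 1) +
      ((∫ ω, (inner ℝ (ξ ω) t) ^ 2 ∂P : ℝ) : ℂ) / 2 = ∫ ω, (N : ℂ) *
        (Complex.exp (y ω * Complex.I) - 1 - y ω * Complex.I + y ω ^ 2 / 2) ∂P := by
    have e1 : Integrable (fun ω => Complex.exp (y ω * Complex.I) - 1) P :=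
      hei.sub (integrable_const _)
    have e2 : Integrable (fun ω => Complex.exp (y ω * Complex.I) - 1 - y ω * Complex.I) P :=
      e1.sub hyC
    have e3 : ∫ ω, (y ω : ℂ) ∂P = 0 := by
      rw [integral_complex_ofReal, hy0, Complex.ofReal_zero]
    rw [integral_const_mul, integral_add e2 hy2C, integral_sub e1 hyC,
      integral_sub hei (integrable_const _), hchar, integral_mul_const, e3,
      ← hysq, integral_div]
    have : ∫ ω, (y ω : ℂ) ^ 2 ∂P = ((∫ ω, y ω ^ 2 ∂P : ℝ) : ℂ) := by
      rw [← integral_complex_ofReal]; simp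
    rw [this]
    simp
    ring
  rw [hrep]
  have hbound : ∀ ω, ‖(N : ℂ) * (Complex.exp (y ω * Complex.I) - 1 - y ω * Complex.I +
      y ω ^ 2 / 2)‖ ≤ 4 * ‖t‖ ^ 3 * K / √N * ‖ξ ω‖ ^ 2 +
        4 * ‖t‖ ^ 2 * {ω | K < ‖ξ ω‖}.indicator (fun ω => ‖ξ ω‖ ^ 2) ω := by
    intro ω
    obtain ⟨h2, h3⟩ := norm_exp_mul_I_sub_le (y ω)
    have hin : |inner ℝ (ξ ω) t| ≤ ‖ξ ω‖ * ‖t‖ := abs_real_inner_le_norm _ _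
    have hyb : |y ω| ≤ (√N)⁻¹ * (‖ξ ω‖ * ‖t‖) := by
      rw [hy', abs_mul, abs_of_pos (inv_pos.2 hs0)]
      gcongr
    rw [norm_mul, Complex.norm_natCast]
    by_cases h : K < ‖ξ ω‖
    · have e1 : N * (4 * y ω ^ 2) ≤ 4 * ‖t‖ ^ 2 * ‖ξ ω‖ ^ 2 := by
        have : y ω ^ 2 ≤ ((√N)⁻¹ * (‖ξ ω‖ * ‖t‖)) ^ 2 := by
          rw [← sq_abs]; exact pow_le_pow_left₀ (abs_nonneg _) hyb 2
        calc N * (4 * y ω ^ 2) ≤ N * (4 * ((√N)⁻¹ * (‖ξ ω‖ * ‖t‖)) ^ 2) := by gcongr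
          _ = 4 * ‖t‖ ^ 2 * ‖ξ ω‖ ^ 2 := by
            rw [mul_pow, inv_pow, hss]; field_simp
      simp only [Set.indicator, Set.mem_ofPred_eq, h, if_true]
      have e2 : 0 ≤ 4 * ‖t‖ ^ 3 * K / √N * ‖ξ ω‖ ^ 2 := by positivity
      have e3 := mul_le_mul_of_nonneg_left h2 hN0.le
      linarith
    · have h := not_lt.1 h
      have e1 : N * (4 * |y ω| ^ 3) ≤ 4 * ‖t‖ ^ 3 * K / √N * ‖ξ ω‖ ^ 2 := by
        calc N * (4 * |y ω| ^ 3) ≤ N * (4 * ((√N)⁻¹ * (‖ξ ω‖ * ‖t‖)) ^ 3) := by gcongr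
          _ = √N ^ 2 * (4 * ((√N)⁻¹ * (‖ξ ω‖ * ‖t‖)) ^ 3) := by rw [hss]
          _ = 4 * ‖t‖ ^ 3 * ‖ξ ω‖ / √N * ‖ξ ω‖ ^ 2 := by field_simp
          _ ≤ 4 * ‖t‖ ^ 3 * K / √N * ‖ξ ω‖ ^ 2 := by gcongr
      simp only [Set.indicator, Set.mem_ofPred_eq, not_lt.2 h, if_false, mul_zero, add_zero]
      have e3 := mul_le_mul_of_nonneg_left h3 hN0.le
      linarith
  have hbi : Integrable (fun ω => 4 * ‖t‖ ^ 3 * K / √N * ‖ξ ω‖ ^ 2 +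
      4 * ‖t‖ ^ 2 * {ω | K < ‖ξ ω‖}.indicator (fun ω => ‖ξ ω‖ ^ 2) ω) P :=
    (hi.const_mul _).add ((hi.indicator₀ hset).const_mul _)
  refine (norm_integral_le_of_norm_le hbi (Eventually.of_forall hbound)).trans ?_
  rw [integral_add (hi.const_mul _) ((hi.indicator₀ hset).const_mul _), integral_const_mul,
    integral_const_mul, integral_indicator₀ hset]
  refine add_le_add ?_ (by gcongr)
  calc 4 * ‖t‖ ^ 3 * K / √N * ∫ ω, ‖ξ ω‖ ^ 2 ∂P
      ≤ 4 * ‖t‖ ^ 3 * K / √N * (K ^ 2 + ε) :=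
        mul_le_mul_of_nonneg_left (integral_norm_sq_le_of_tail hξ htail) (by positivity)
    _ = 4 * ‖t‖ ^ 3 * K * (K ^ 2 + ε) / √N := by ring

theorem tendsto_mul_charFun_sub {ξ : ℕ → Ω → Vec q} (hξ : ∀ N, MemLp (ξ N) 2 P)
    (hmean : ∀ N, ∫ ω, ξ N ω ∂P = 0)
    (htail : ∀ ε : ℝ, 0 < ε → ∃ K : ℝ, 0 ≤ K ∧
      ∀ N, ∫ ω in {ω | K < ‖ξ N ω‖}, ‖ξ N ω‖ ^ 2 ∂P ≤ ε)
    {Om : Matrix (Fin q) (Fin q) ℝ}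
    (hcov : ∀ r s, Tendsto (fun N => ∫ ω, outer (ξ N ω) r s ∂P) atTop (𝓝 (Om r s))) (t : Vec q) :
    Tendsto (fun N : ℕ => (N : ℂ) * (charFun (P.map (ξ N)) ((√N)⁻¹ • t) - 1)) atTop
      (𝓝 (-((∑ r, ∑ s, t r * t s * Om r s : ℝ) : ℂ) / 2)) := by
  have h1 : Tendsto (fun N => ((∫ ω, (inner ℝ (ξ N ω) t) ^ 2 ∂P : ℝ) : ℂ) / 2) atTop
      (𝓝 (((∑ r, ∑ s, t r * t s * Om r s : ℝ) : ℂ) / 2)) := by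
    refine Tendsto.div_const ((Complex.continuous_ofReal.tendsto _).comp ?_) _
    simp only [integral_inner_sq (hξ _)]
    exact tendsto_finsetSum _ fun r _ => tendsto_finsetSum _ fun s _ => (hcov r s).const_mul _
  have h2 : Tendsto (fun N : ℕ => (N : ℂ) * (charFun (P.map (ξ N)) ((√N)⁻¹ • t) - 1) +
      ((∫ ω, (inner ℝ (ξ N ω) t) ^ 2 ∂P : ℝ) : ℂ) / 2) atTop (𝓝 0) := by
    rw [Metric.tendsto_nhds]
    intro ε hε
    -- This tail level makes the contribution `4‖t‖²·` tail at most `ε/2`.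
    obtain ⟨K, hK, hKN⟩ := htail (ε / (8 * (‖t‖ ^ 2 + 1))) (by positivity)
    have hlim : Tendsto (fun N : ℕ => 4 * ‖t‖ ^ 3 * K * (K ^ 2 + ε / (8 * (‖t‖ ^ 2 + 1))) / √N) atTop
        (𝓝 0) := by
      refine Tendsto.const_div_atTop ?_ _
      exact Real.tendsto_sqrt_atTop.comp tendsto_natCast_atTop_atTop
    filter_upwards [hlim.eventually_lt_const (half_pos hε), eventually_gt_atTop 0] with N hN hN0
    rw [dist_zero_right]
    refine (norm_mul_charFun_sub_le (hξ N) (hmean N) hK (hKN N) t hN0).trans_lt ?_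
    have : 4 * ‖t‖ ^ 2 * (ε / (8 * (‖t‖ ^ 2 + 1))) ≤ ε / 2 := by
      rw [mul_div_assoc', div_le_div_iff₀ (by positivity) (by positivity)]
      nlinarith [sq_nonneg ‖t‖]
    linarith
  have := h2.sub h1
  simp only [add_sub_cancel_right, zero_sub] at this
  rwa [← neg_div] at this

/-- The characteristic function of the sum is `(1 + c_N)^N` with `N c_N → -t'Ωt/2`, so it tends to
that of the Gaussian, and Lévy's continuity theorem applies. `Om` may be singular. -/
theorem clt_array {ξ : ℕ → ℕ → Ω → Vec q} (hind : ∀ N, iIndepFun (ξ N) P)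
    (hid : ∀ N i, IdentDistrib (ξ N i) (ξ N 0) P P) (hξ : ∀ N, MemLp (ξ N 0) 2 P)
    (hmean : ∀ N, ∫ ω, ξ N 0 ω ∂P = 0)
    (htail : ∀ ε : ℝ, 0 < ε → ∃ K : ℝ, 0 ≤ K ∧
      ∀ N, ∫ ω in {ω | K < ‖ξ N 0 ω‖}, ‖ξ N 0 ω‖ ^ 2 ∂P ≤ ε)
    {Om : Matrix (Fin q) (Fin q) ℝ}
    (hcov : ∀ r s, Tendsto (fun N => ∫ ω, outer (ξ N 0 ω) r s ∂P) atTop (𝓝 (Om r s)))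
    (hOm : Om.PosSemidef) :
    TendstoInDistribution (fun (N : ℕ) ω => (√N)⁻¹ • ∑ i ∈ Finset.range N, ξ N i ω) atTop id
      (fun _ => P) (multivariateGaussian 0 Om) := by
  have hm : ∀ N i, AEMeasurable (ξ N i) P := fun N i => (hid N i).aemeasurable_fst
  have hsm : ∀ N, AEMeasurable (fun ω => ∑ i ∈ Finset.range N, ξ N i ω) P := fun N =>
    Finset.aemeasurable_fun_sum _ fun i _ => hm N i
  have hsm' : ∀ N : ℕ, AEMeasurable (fun ω => (√N)⁻¹ • ∑ i ∈ Finset.range N, ξ N i ω) P :=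
    fun N => (hsm N).const_smul ((√N)⁻¹)
  refine ⟨hsm', aemeasurable_id, ?_⟩
  refine ProbabilityMeasure.tendsto_of_tendsto_charFun fun t => ?_
  simp only [ProbabilityMeasure.coe_mk, Measure.map_id]
  have hchar : ∀ N : ℕ, charFun (P.map fun ω => (√N)⁻¹ • ∑ i ∈ Finset.range N, ξ N i ω) t =
      (1 + (charFun (P.map (ξ N 0)) ((√N)⁻¹ • t) - 1)) ^ N := by
    intro N
    rw [charFun_map_smul_comp (hsm N), iIndepFun.charFun_map_fun_finsetSum_eq_prod
      (fun i _ => hm N i) ((hind N).restrict _)]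
    simp [fun i => (hid N i).map_eq]
  simp only [hchar]
  rw [charFun_multivariateGaussian hOm]
  have hlim := Complex.tendsto_one_add_pow_exp_of_tendsto
    (tendsto_mul_charFun_sub hξ hmean htail hcov t)
  convert hlim using 3
  simp only [inner_zero_right, Complex.ofReal_zero, zero_mul, zero_sub, neg_div]
  congr 3
  simp only [dotProduct, Matrix.mulVec, Finset.mul_sum]
  refine Finset.sum_congr rfl fun r _ => Finset.sum_congr rfl fun s _ => by ring

end CentralLimit

end OrthMoment

namespace OrthMoment

/-! ### Random variables as functions of the individuals -/

/-- The type of all variables attached to one individual. -/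
abbrev UnitData (d p : ℕ) : Type := Vec d × ℝ × (ℕ → ℝ) × (ℕ → Vec p)

/-- The σ-algebra generated by `α` and `X_1, …, X_T`. -/
abbrev UnitData.sigXα (d p T : ℕ) : MeasurableSpace (UnitData d p) :=
  MeasurableSpace.comap (fun v => v.2.1) inferInstance ⊔
    ⨆ t ∈ Finset.Icc 1 T, MeasurableSpace.comap (fun v => v.2.2.2 t) inferInstance

theorem sigXα_eq_comap {Ω : Type*} {d p : ℕ} (D : Panel Ω d p) (T i : ℕ) :
    D.sigXα T i = (UnitData.sigXα d p T).comap (D.unit i) := by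
  simp only [Panel.sigXα, UnitData.sigXα, MeasurableSpace.comap_sup, MeasurableSpace.comap_iSup,
    MeasurableSpace.comap_comp]
  rfl

section Units

variable {Ω : Type*} [MeasurableSpace Ω] {P : Measure Ω} {d p k q : ℕ} {D : Panel Ω d p}
  {m : Vec d → ℝ → Vec k → Vec q} {β₀ : Vec p} {μ₀ : Vec k}

/-- The pair of `W` and `α`. -/
def UnitData.wα (v : UnitData d p) : Vec d × ℝ := (v.1, v.2.1)

theorem UnitData.measurable_wα : Measurable (UnitData.wα : UnitData d p → Vec d × ℝ) :=
  measurable_fst.prodMk (measurable_fst.comp measurable_snd)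

theorem UnitData.sigXα_le (T : ℕ) :
    UnitData.sigXα d p T ≤ (inferInstance : MeasurableSpace (UnitData d p)) := by
  refine sup_le (Measurable.comap_le (by fun_prop)) (iSup₂_le fun t _ => Measurable.comap_le ?_)
  fun_prop

theorem Sampling.measurable_unit (h : Sampling P D) (i : ℕ) : Measurable (D.unit i) :=
  (h.meas_W i).prodMk ((h.meas_α i).prodMk ((measurable_pi_lambda _ fun t => h.meas_Y i t).prodMk
    (measurable_pi_lambda _ fun t => h.meas_X i t)))

theorem Sampling.map_unit (h : Sampling P D) (i : ℕ) : P.map (D.unit i) = P.map (D.unit 0) :=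
  (h.ident i).map_eq

theorem Sampling.identDistrib_comp (h : Sampling P D) {F : Type*} [MeasurableSpace F]
    {φ : UnitData d p → F} (hφ : Measurable φ) (i : ℕ) :
    IdentDistrib (fun ω => φ (D.unit i ω)) (fun ω => φ (D.unit 0 ω)) P P := (h.ident i).comp hφ

theorem Sampling.sigXα_le (h : Sampling P D) (T i : ℕ) : D.sigXα T i ≤ ‹MeasurableSpace Ω› :=
  sup_le (h.meas_α i).comap_le (iSup₂_le fun t _ => (h.meas_X i t).comap_le)

/-- `f i = φ(W_i, α_i)` almost surely for a function `φ` that is strongly measurable. -/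
def IsUnitFun (P : Measure Ω) (D : Panel Ω d p) {F : Type*} [TopologicalSpace F] (f : ℕ → Ω → F) :
    Prop :=
  ∃ φ : Vec d × ℝ → F, StronglyMeasurable φ ∧ ∀ i, ∀ᵐ ω ∂P, f i ω = φ (D.W i ω, D.α i ω)

namespace IsUnitFun

variable {F F' : Type*} [TopologicalSpace F] [TopologicalSpace F']

/-- `limUnder` is a total function and strongly measurable; its values where the sequence diverges
do not matter. -/
theorem of_tendsto [TopologicalSpace.IsCompletelyMetrizableSpace F] [Nonempty F] {f : ℕ → Ω → F}
    {g : ℕ → ℕ → Ω → F} (hg : ∀ n, IsUnitFun P D (g n))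
    (h : ∀ i, ∀ᵐ ω ∂P, Tendsto (fun n => g n i ω) atTop (𝓝 (f i ω))) : IsUnitFun P D f := by
  choose φ hφ hgφ using hg
  refine ⟨fun v => limUnder atTop fun n => φ n v, StronglyMeasurable.limUnder hφ, fun i => ?_⟩
  filter_upwards [h i, ae_all_iff.2 fun n => hgφ n i] with ω h1 h2
  simp only [h2] at h1
  exact h1.limUnder_eq.symm

theorem comp_continuous {f : ℕ → Ω → F} (hf : IsUnitFun P D f) {c : F → F'} (hc : Continuous c) :
    IsUnitFun P D fun i ω => c (f i ω) := by
  obtain ⟨φ, hφ, h⟩ := hf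
  exact ⟨fun v => c (φ v), hc.comp_stronglyMeasurable hφ, fun i => (h i).mono fun ω h => congrArg c h⟩

theorem sub {F : Type*} [NormedAddCommGroup F] {f g : ℕ → Ω → F} (hf : IsUnitFun P D f)
    (hg : IsUnitFun P D g) : IsUnitFun P D fun i ω => f i ω - g i ω := by
  obtain ⟨φ, hφ, h⟩ := hf
  obtain ⟨ψ, hψ, h'⟩ := hg
  refine ⟨fun v => φ v - ψ v, hφ.sub hψ, fun i => ?_⟩
  filter_upwards [h i, h' i] with ω h1 h2
  rw [h1, h2]

theorem const_smul {F : Type*} [NormedAddCommGroup F] [NormedSpace ℝ F] {f : ℕ → Ω → F}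
    (hf : IsUnitFun P D f) (c : ℝ) : IsUnitFun P D fun i ω => c • f i ω :=
  hf.comp_continuous (continuous_const_smul c)

theorem sum {F κ : Type*} [NormedAddCommGroup F] {f : κ → ℕ → Ω → F} (s : Finset κ)
    (hf : ∀ c ∈ s, IsUnitFun P D (f c)) : IsUnitFun P D fun i ω => ∑ c ∈ s, f c i ω := by
  classical
  induction s using Finset.induction_on with
  | empty => exact ⟨fun _ => 0, stronglyMeasurable_const, fun i => by simp⟩
  | insert a s ha ih =>
    obtain ⟨φ, hφ, h⟩ := hf a (Finset.mem_insert_self _ _)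
    obtain ⟨ψ, hψ, h'⟩ := ih fun c hc => hf c (Finset.mem_insert_of_mem hc)
    refine ⟨fun v => φ v + ψ v, hφ.add hψ, fun i => ?_⟩
    filter_upwards [h i, h' i] with ω h1 h2
    rw [Finset.sum_insert ha, h1, h2]

theorem eLpNorm_eq {F : Type*} [NormedAddCommGroup F] {f : ℕ → Ω → F} (hf : IsUnitFun P D f)
    (hs : Sampling P D) (r : ℝ≥0∞) (i : ℕ) : eLpNorm (f i) r P = eLpNorm (f 0) r P := by
  obtain ⟨φ, hφ, h⟩ := hf
  have hm := fun i => (hs.meas_W i).prodMk (hs.meas_α i)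
  have hlaw : P.map (fun ω => (D.W i ω, D.α i ω)) = P.map (fun ω => (D.W 0 ω, D.α 0 ω)) :=
    ((hs.ident i).comp UnitData.measurable_wα).map_eq
  have key : ∀ i, eLpNorm (f i) r P = eLpNorm φ r (P.map fun ω => (D.W i ω, D.α i ω)) := fun i => by
    rw [eLpNorm_congr_ae (h i), eLpNorm_map_measure hφ.aestronglyMeasurable (hm i).aemeasurable]
    rfl
  rw [key, key, hlaw]

end IsUnitFun

theorem tendsto_slope_nat {F : Type*} [NormedAddCommGroup F] [NormedSpace ℝ F] {f : ℝ → F} {f' : F}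
    {x : ℝ} (h : HasDerivAt f f' x) :
    Tendsto (fun n : ℕ => ((n : ℝ) + 1) • (f (x + ((n : ℝ) + 1)⁻¹) - f x)) atTop (𝓝 f') := by
  have h1 := h.tendsto_slope_zero
  have h2 : Tendsto (fun n : ℕ => ((n : ℝ) + 1)⁻¹) atTop (𝓝[≠] 0) := by
    refine tendsto_nhdsWithin_iff.2 ⟨?_, Eventually.of_forall fun n => ?_⟩
    · exact tendsto_inv_atTop_zero.comp
        (tendsto_atTop_add_const_right _ _ tendsto_natCast_atTop_atTop)
    · simp only [Set.mem_compl_iff, Set.mem_singleton_iff, inv_eq_zero]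
      positivity
  refine (h1.comp h2).congr fun n => ?_
  simp

theorem isUnitFun_m (hm : ∀ μ, Measurable fun z : Vec d × ℝ => m z.1 z.2 μ) (s : ℝ) (μ : Vec k) :
    IsUnitFun P D fun i ω => m (D.W i ω) (D.α i ω + s) μ := by
  refine ⟨fun v => m v.1 (v.2 + s) μ, Measurable.stronglyMeasurable ?_, fun i => ae_of_all _ fun _ => rfl⟩
  exact (hm μ).comp (measurable_fst.prodMk (measurable_snd.add_const s))

/-- Measurability of `m` is assumed, that of its derivatives is not, and smoothness holds only
almost surely. The derivative is an almost sure limit of measurable difference quotients along the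
steps `1/(n+1)`. -/
theorem isUnitFun_dα (hm : ∀ μ, Measurable fun z : Vec d × ℝ => m z.1 z.2 μ)
    (hsm : ∀ i, ∀ᵐ ω ∂P, ContDiff ℝ 2 fun s => m (D.W i ω) s μ₀) :
    IsUnitFun P D fun i ω => dα m (D.W i ω) (D.α i ω) μ₀ := by
  refine IsUnitFun.of_tendsto (fun n : ℕ => ((isUnitFun_m hm (((n : ℝ) + 1)⁻¹) μ₀).sub
    (isUnitFun_m hm 0 μ₀)).const_smul ((n : ℝ) + 1)) fun i => ?_
  filter_upwards [hsm i] with ω h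
  have := tendsto_slope_nat ((h.differentiable (by norm_num)) (D.α i ω)).hasDerivAt
  simpa only [add_zero, dα] using this

theorem clm_eq_sum (L : Vec k →L[ℝ] Vec q) :
    L = ∑ c, (EuclideanSpace.proj c : Vec k →L[ℝ] ℝ).smulRight (L (EuclideanSpace.single c 1)) := by
  ext v : 1
  conv_lhs => rw [← (EuclideanSpace.basisFun (Fin k) ℝ).sum_repr v]
  simp

/-- Each column is a limit of difference quotients in one coordinate direction. The shift `s` of the
second argument is kept so that a further difference quotient in `α` can be taken. -/
theorem isUnitFun_dμ (hm : ∀ μ, Measurable fun z : Vec d × ℝ => m z.1 z.2 μ) {μ : Vec k}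
    (hdiff : ∀ i, ∀ᵐ ω ∂P, ∀ s, DifferentiableAt ℝ (fun ν => m (D.W i ω) s ν) μ) (s : ℝ) :
    IsUnitFun P D fun i ω => dμ m (D.W i ω) (D.α i ω + s) μ := by
  have hcol : ∀ c, IsUnitFun P D fun i ω =>
      dμ m (D.W i ω) (D.α i ω + s) μ (EuclideanSpace.single c 1) := by
    intro c
    refine IsUnitFun.of_tendsto (fun n : ℕ =>
      ((isUnitFun_m hm s (μ + (((n : ℝ) + 1)⁻¹) • EuclideanSpace.single c (1 : ℝ))).sub
        (isUnitFun_m hm s μ)).const_smul ((n : ℝ) + 1)) fun i => ?_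
    filter_upwards [hdiff i] with ω h
    have h1 := (h (D.α i ω + s)).hasFDerivAt
    have h2 : HasDerivAt (fun r : ℝ => m (D.W i ω) (D.α i ω + s)
        (μ + r • EuclideanSpace.single c (1 : ℝ)))
        (dμ m (D.W i ω) (D.α i ω + s) μ (EuclideanSpace.single c 1)) 0 := by
      have h3 : HasDerivAt (fun r : ℝ => μ + r • EuclideanSpace.single c (1 : ℝ))
          (EuclideanSpace.single c (1 : ℝ)) 0 := by
        simpa using ((hasDerivAt_id (0 : ℝ)).smul_const
          (EuclideanSpace.single c (1 : ℝ))).const_add μ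
      exact HasFDerivAt.comp_hasDerivAt_of_eq (0 : ℝ) h1 h3 (by simp)
    have := tendsto_slope_nat h2
    simpa only [zero_add, zero_smul, add_zero] using this
  have h := IsUnitFun.sum (P := P) (D := D) Finset.univ fun c _ =>
    (hcol c).comp_continuous (c := fun v =>
      (EuclideanSpace.proj c : Vec k →L[ℝ] ℝ).smulRight v)
      (ContinuousLinearMap.smulRightL ℝ (Vec k) (Vec q) (EuclideanSpace.proj c)).continuous
  obtain ⟨φ, hφ, h⟩ := h
  refine ⟨φ, hφ, fun i => ?_⟩
  filter_upwards [h i] with ω h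
  rw [← h]
  exact clm_eq_sum _

theorem isUnitFun_dαμ (hm : ∀ μ, Measurable fun z : Vec d × ℝ => m z.1 z.2 μ) {μ : Vec k}
    (hdiff : ∀ i, ∀ᵐ ω ∂P, ∀ s, DifferentiableAt ℝ (fun ν => m (D.W i ω) s ν) μ)
    (hdiff2 : ∀ i, ∀ᵐ ω ∂P, ContDiff ℝ 2 fun s => dμ m (D.W i ω) s μ) :
    IsUnitFun P D fun i ω => dαμ m (D.W i ω) (D.α i ω) μ := by
  refine IsUnitFun.of_tendsto (fun n : ℕ => ((isUnitFun_dμ hm hdiff (((n : ℝ) + 1)⁻¹)).sub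
    (isUnitFun_dμ hm hdiff 0)).const_smul ((n : ℝ) + 1)) fun i => ?_
  filter_upwards [hdiff2 i] with ω h
  have := tendsto_slope_nat ((h.differentiable (by norm_num)) (D.α i ω)).hasDerivAt
  simpa only [add_zero, dαμ] using this

/-- The supremum over a ball of the norm of a function that is continuous there is, almost surely,
a measurable function of `(W_i, α_i)`. -/
theorem exists_measurable_iSup_ball {F : Type*} [NormedAddCommGroup F] {f : ℕ → Ω → Vec k → F}
    {ρ : ℝ} (hf : ∀ μ ∈ Metric.ball μ₀ ρ, IsUnitFun P D fun i ω => f i ω μ)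
    (hcont : ∀ i, ∀ᵐ ω ∂P, ContinuousOn (f i ω) (Metric.ball μ₀ ρ)) (n : ℕ) :
    ∃ φ : Vec d × ℝ → ℝ≥0∞, Measurable φ ∧ ∀ i, ∀ᵐ ω ∂P,
      ⨆ μ ∈ Metric.ball μ₀ ρ, ‖f i ω μ‖ₑ ^ n = φ (D.W i ω, D.α i ω) := by
  obtain ⟨S, hSc, hSd⟩ := TopologicalSpace.exists_countable_dense (Metric.ball μ₀ ρ)
  have hS := hSc.to_subtype
  choose φ hφ h using fun μ : S => hf μ.1 μ.1.2
  refine ⟨fun v => ⨆ μ : S, ‖φ μ v‖ₑ ^ n, Measurable.iSup fun μ => (hφ μ).enorm.pow_const n,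
    fun i => ?_⟩
  filter_upwards [hcont i, ae_all_iff.2 fun μ => h μ i] with ω h1 h2
  simp only [← h2]
  have h3 : Continuous fun μ : Metric.ball μ₀ ρ => ‖f i ω μ‖ₑ ^ n :=
    (ENNReal.continuous_pow n).comp
      (continuous_enorm.comp (continuousOn_iff_continuous_domRestrict.1 h1))
  rw [iSup_subtype']
  refine le_antisymm (iSup_le fun μ => ?_) (iSup_le fun μ => le_iSup_of_le μ.1 le_rfl)
  -- By continuity the countable supremum over the dense set `S` already bounds every point of the
  -- ball.
  have hcl : IsClosed {μ : Metric.ball μ₀ ρ | ‖f i ω μ‖ₑ ^ n ≤ ⨆ μ : S, ‖f i ω μ‖ₑ ^ n} :=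
    isClosed_le h3 continuous_const
  have hsub : closure S ⊆ {μ : Metric.ball μ₀ ρ | ‖f i ω μ‖ₑ ^ n ≤ ⨆ μ : S, ‖f i ω μ‖ₑ ^ n} :=
    hcl.closure_subset_iff.2 fun μ hμ =>
      le_iSup (fun μ : S => ‖f i ω μ‖ₑ ^ n) ⟨μ, hμ⟩
  exact hsub (hSd μ)

end Units

end OrthMoment

namespace OrthMoment

/-! ### Functions of the data of one individual and moment bounds uniform in the horizon -/

section DataFunctions

variable {Ω : Type*} [MeasurableSpace Ω] {P : Measure Ω} {d p k q L : ℕ} {D : Panel Ω d p}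
  {A : Procedure Ω p k q L} {m : Vec d → ℝ → Vec k → Vec q} {β₀ : Vec p} {μ₀ : Vec k} {g : ℝ}

/-- `f i` is, almost surely, the same measurable function of the data of individual `i` for
every `i`. -/
def IsDataFun (P : Measure Ω) (D : Panel Ω d p) {F : Type*} [MeasurableSpace F] (f : ℕ → Ω → F) :
    Prop :=
  ∃ φ : UnitData d p → F, Measurable φ ∧ ∀ i, f i =ᵐ[P] fun ω => φ (D.unit i ω)

namespace IsDataFun

variable {F F' : Type*} [MeasurableSpace F] [MeasurableSpace F'] {f : ℕ → Ω → F}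

theorem of_measurable {φ : UnitData d p → F} (hφ : Measurable φ) :
    IsDataFun P D fun i ω => φ (D.unit i ω) := ⟨φ, hφ, fun _ => EventuallyEq.rfl⟩

theorem comp (hf : IsDataFun P D f) {c : F → F'} (hc : Measurable c) :
    IsDataFun P D fun i ω => c (f i ω) := by
  obtain ⟨φ, hφ, h⟩ := hf
  exact ⟨fun v => c (φ v), hc.comp hφ, fun i => (h i).mono fun ω h => congrArg c h⟩

theorem prodMk (hf : IsDataFun P D f) {f' : ℕ → Ω → F'} (hf' : IsDataFun P D f') :
    IsDataFun P D fun i ω => (f i ω, f' i ω) := by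
  obtain ⟨φ, hφ, h⟩ := hf
  obtain ⟨ψ, hψ, h'⟩ := hf'
  refine ⟨fun v => (φ v, ψ v), hφ.prodMk hψ, fun i => ?_⟩
  filter_upwards [h i, h' i] with ω h1 h2
  simp only [h1, h2]

theorem aemeasurable (hf : IsDataFun P D f) (hs : Sampling P D) (i : ℕ) : AEMeasurable (f i) P := by
  obtain ⟨φ, hφ, h⟩ := hf
  exact ⟨fun ω => φ (D.unit i ω), hφ.comp (hs.measurable_unit i), h i⟩

theorem identDistrib (hf : IsDataFun P D f) (hs : Sampling P D) (i : ℕ) :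
    IdentDistrib (f i) (f 0) P P := by
  have hm := hf.aemeasurable hs
  obtain ⟨φ, hφ, h⟩ := hf
  have h0 := (hs.measurable_unit 0)
  exact ((IdentDistrib.of_ae_eq (hm i) (h i)).trans (hs.identDistrib_comp hφ i)).trans
    (IdentDistrib.of_ae_eq (hm 0) (h 0)).symm

theorem iIndepFun (hf : IsDataFun P D f) (hs : Sampling P D) : iIndepFun f P := by
  obtain ⟨φ, hφ, h⟩ := hf
  exact (hs.indep.comp (fun _ => φ) fun _ => hφ).congr fun i => (h i).symm

theorem lintegral_eq {f : ℕ → Ω → ℝ≥0∞} (hf : IsDataFun P D f) (hs : Sampling P D) (i : ℕ) :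
    ∫⁻ ω, f i ω ∂P = ∫⁻ ω, f 0 ω ∂P := (hf.identDistrib hs i).lintegral_eq

end IsDataFun

theorem IsUnitFun.isDataFun {F : Type*} [NormedAddCommGroup F] [MeasurableSpace F] [BorelSpace F]
    {f : ℕ → Ω → F} (hf : IsUnitFun P D f) : IsDataFun P D f := by
  obtain ⟨φ, hφ, h⟩ := hf
  exact ⟨fun v => φ v.wα, hφ.measurable.comp UnitData.measurable_wα, h⟩

theorem isDataFun_u (t : ℕ) : IsDataFun P D fun i => D.u β₀ i t := by
  refine IsDataFun.of_measurable
    (φ := fun v : UnitData d p => v.2.2.1 t - inner ℝ (v.2.2.2 t) β₀ - v.2.1) ?_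
  fun_prop

theorem isDataFun_ubar (T : ℕ) : IsDataFun P D fun i => D.ubar β₀ T i := by
  refine IsDataFun.of_measurable
    (φ := fun v : UnitData d p => ((T : ℝ) - 1)⁻¹ * ∑ t ∈ Finset.Icc 1 (T - 1),
      (v.2.2.1 t - inner ℝ (v.2.2.2 t) β₀ - v.2.1)) ?_
  fun_prop

theorem isDataFun_α : IsDataFun P D D.α :=
  IsDataFun.of_measurable (φ := fun v : UnitData d p => v.2.1) (by fun_prop)

theorem isDataFun_dα (hmodel : ModelAssumption P D m β₀ μ₀) (hmom : MomentAssumption P D A m β₀ μ₀) :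
    IsUnitFun P D fun i ω => dα m (D.W i ω) (D.α i ω) μ₀ :=
  isUnitFun_dα hmodel.meas hmom.smooth

/-- The common function is the conditional expectation on the space of unit data under the law of
individual `0`, which is the law of every individual. -/
theorem isDataFun_a [IsProbabilityMeasure P] (hs : Sampling P D)
    (hmodel : ModelAssumption P D m β₀ μ₀) (hrate : RateAssumption P D A m β₀ μ₀ g)
    (hmom : MomentAssumption P D A m β₀ μ₀) (T : ℕ) : IsDataFun P D fun i => D.a P m μ₀ T i := by
  obtain ⟨ψ, hψ, h⟩ := isDataFun_dα hmodel hmom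
  have hψm : Measurable fun v : UnitData d p => ψ v.wα :=
    hψ.measurable.comp UnitData.measurable_wα
  refine ⟨(P.map (D.unit 0))[fun v => ψ v.wα | UnitData.sigXα d p T],
    (stronglyMeasurable_condExp.mono (UnitData.sigXα_le T)).measurable, fun i => ?_⟩
  have h1 : D.a P m μ₀ T i =ᵐ[P] P[(fun v : UnitData d p => ψ v.wα) ∘ D.unit i |
      (UnitData.sigXα d p T).comap (D.unit i)] := by
    rw [← sigXα_eq_comap]
    exact condExp_congr_ae (h i)
  have hint : Integrable (fun v : UnitData d p => ψ v.wα) (P.map (D.unit i)) := by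
    rw [integrable_map_measure hψm.aestronglyMeasurable (hs.measurable_unit i).aemeasurable]
    exact (hrate.dα_integrable i).congr (h i)
  have h2 := condExp_comp_map (P := P) (UnitData.sigXα_le T) (hs.measurable_unit i) hint
  rw [hs.map_unit i] at h2
  exact h1.trans h2

theorem isDataFun_e [IsProbabilityMeasure P] (hs : Sampling P D)
    (hmodel : ModelAssumption P D m β₀ μ₀) (hrate : RateAssumption P D A m β₀ μ₀ g)
    (hmom : MomentAssumption P D A m β₀ μ₀) (T : ℕ) : IsDataFun P D fun i => D.e P m μ₀ T i :=
  ((isDataFun_dα hmodel hmom).isDataFun.prodMk (isDataFun_a hs hmodel hrate hmom T)).comp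
    (c := fun z => z.1 - z.2) (by fun_prop)

theorem isDataFun_mstar [IsProbabilityMeasure P] (hs : Sampling P D)
    (hmodel : ModelAssumption P D m β₀ μ₀) (hrate : RateAssumption P D A m β₀ μ₀ g)
    (hmom : MomentAssumption P D A m β₀ μ₀) (T : ℕ) :
    IsDataFun P D fun i => D.mstar P m β₀ μ₀ T i := by
  have h1 : IsDataFun P D fun i ω => m (D.W i ω) (D.α i ω) μ₀ :=
    IsDataFun.of_measurable (φ := fun v : UnitData d p => m v.1 v.2.1 μ₀)
      ((hmodel.meas μ₀).comp UnitData.measurable_wα)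
  exact (h1.prodMk ((isDataFun_u (β₀ := β₀) T).prodMk (isDataFun_a hs hmodel hrate hmom T))).comp
    (c := fun z => z.1 + z.2.1 • z.2.2) (by fun_prop)

theorem lintegral_enorm_pow_eq {F : Type*} [NormedAddCommGroup F] (f : Ω → F) {n : ℕ} (hn : n ≠ 0) :
    ∫⁻ ω, ‖f ω‖ₑ ^ n ∂P = eLpNorm f n P ^ n := by
  have h := eLpNorm_nnreal_pow_eq_lintegral (f := f) (μ := P) (p := n) (by exact_mod_cast hn)
  simp only [NNReal.coe_natCast, ENNReal.rpow_natCast, ENNReal.coe_natCast] at h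
  exact h.symm

theorem aestronglyMeasurable_e (hrate : RateAssumption P D A m β₀ μ₀ g) (T i : ℕ) :
    AEStronglyMeasurable (D.e P m μ₀ T i) P :=
  (hrate.dα_integrable i).aestronglyMeasurable.sub integrable_condExp.aestronglyMeasurable

theorem memLp_e (hrate : RateAssumption P D A m β₀ μ₀ g) (hmom : MomentAssumption P D A m β₀ μ₀)
    (N i : ℕ) : MemLp (D.e P m μ₀ (A.T N) i) 4 P := by
  refine ⟨aestronglyMeasurable_e hrate _ i, ?_⟩
  have h := hmom.e_fourth N i
  rw [lintegral_enorm_pow_eq _ (by norm_num)] at h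
  by_contra hcon
  rw [not_lt, top_le_iff] at hcon
  simp [hcon] at h

/-- The derivative is `a_i + e_i` for any horizon; the one at `N = 0` is as good as any other. -/
theorem memLp_dα [IsProbabilityMeasure P] (hrate : RateAssumption P D A m β₀ μ₀ g)
    (hmom : MomentAssumption P D A m β₀ μ₀) (i : ℕ) :
    MemLp (fun ω => dα m (D.W i ω) (D.α i ω) μ₀) 2 P := by
  have h1 : MemLp (D.e P m μ₀ (A.T 0) i) 2 P :=
    (memLp_e hrate hmom 0 i).mono_exponent (by norm_num)
  have h2 := h1.add (hrate.a_sq 0 i)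
  refine h2.ae_eq (ae_of_all _ fun ω => ?_)
  simp [Panel.e]

theorem exists_eLpNorm_dα_le [IsProbabilityMeasure P] (hs : Sampling P D)
    (hmodel : ModelAssumption P D m β₀ μ₀) (hrate : RateAssumption P D A m β₀ μ₀ g)
    (hmom : MomentAssumption P D A m β₀ μ₀) :
    ∃ C : ℝ≥0∞, C ≠ ∞ ∧ ∀ i, eLpNorm (fun ω => dα m (D.W i ω) (D.α i ω) μ₀) 2 P ≤ C :=
  ⟨_, (memLp_dα hrate hmom 0).2.ne, fun i =>
    ((isDataFun_dα hmodel hmom).eLpNorm_eq hs 2 i).le⟩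

/-- Conditional expectation contracts `L²`, and the derivative being conditioned does not depend on
`T`. -/
theorem exists_lintegral_a_le [IsProbabilityMeasure P] (hs : Sampling P D)
    (hmodel : ModelAssumption P D m β₀ μ₀) (hrate : RateAssumption P D A m β₀ μ₀ g)
    (hmom : MomentAssumption P D A m β₀ μ₀) :
    ∃ C : ℝ≥0∞, C ≠ ∞ ∧ ∀ T i, ∫⁻ ω, ‖D.a P m μ₀ T i ω‖ₑ ^ 2 ∂P ≤ C := by
  obtain ⟨C, hC, h⟩ := exists_eLpNorm_dα_le hs hmodel hrate hmom
  refine ⟨C ^ 2, ENNReal.pow_ne_top hC, fun T i => ?_⟩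
  rw [lintegral_enorm_pow_eq _ two_ne_zero]
  exact pow_le_pow_left' ((eLpNorm_condExp_le_eLpNorm _ (by norm_num)).trans (h i)) 2

/-- The tower property: a longer covariate path refines the projection, and `a_{T'} - a_T` is the
projection of the earlier residual. -/
theorem e_eq_sub_condExp [IsProbabilityMeasure P] (hs : Sampling P D)
    (hrate : RateAssumption P D A m β₀ μ₀ g) {T T' : ℕ} (hT : T ≤ T') (i : ℕ) :
    D.e P m μ₀ T' i =ᵐ[P] D.e P m μ₀ T i - P[D.e P m μ₀ T i | D.sigXα T' i] := by
  have hle : D.sigXα T i ≤ D.sigXα T' i :=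
    sup_le_sup le_rfl (biSup_mono fun t ht => Finset.Icc_subset_Icc_right hT ht)
  have h1 : P[D.e P m μ₀ T i | D.sigXα T' i] =ᵐ[P] D.a P m μ₀ T' i - D.a P m μ₀ T i := by
    have h2 := condExp_sub (hrate.dα_integrable i)
      (integrable_condExp (f := fun ω => dα m (D.W i ω) (D.α i ω) μ₀) (m := D.sigXα T i)
        (μ := P)) (D.sigXα T' i)
    refine h2.trans (EventuallyEq.sub EventuallyEq.rfl (EventuallyEq.of_eq ?_))
    exact condExp_of_stronglyMeasurable (hs.sigXα_le T' i) (stronglyMeasurable_condExp.mono hle)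
      integrable_condExp
  filter_upwards [h1] with ω h
  simp only [Pi.sub_apply, h, Panel.e]
  abel

/-- The assumption bounds the fourth moment only for each `N` separately. By `e_eq_sub_condExp` the
residual at the shortest horizon controls all others: their `L⁴` norms are at most twice its norm.
-/
theorem exists_lintegral_e_le [IsProbabilityMeasure P] (hs : Sampling P D)
    (hmodel : ModelAssumption P D m β₀ μ₀) (hrate : RateAssumption P D A m β₀ μ₀ g)
    (hmom : MomentAssumption P D A m β₀ μ₀) :
    ∃ C : ℝ≥0∞, C ≠ ∞ ∧ ∀ N i, ∫⁻ ω, ‖D.e P m μ₀ (A.T N) i ω‖ₑ ^ 4 ∂P ≤ C := by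
  -- `T` takes values in `ℕ` and so attains a minimum, although it need not be monotone.
  obtain ⟨N₀, hN₀⟩ : ∃ N₀, ∀ N, A.T N₀ ≤ A.T N :=
    ⟨_, fun N => not_lt.1 (Function.not_lt_argmin A.T N)⟩
  refine ⟨(2 * eLpNorm (D.e P m μ₀ (A.T N₀) 0) 4 P) ^ 4,
    ENNReal.pow_ne_top (ENNReal.mul_ne_top (by simp) (memLp_e hrate hmom N₀ 0).2.ne),
    fun N i => ?_⟩
  have hid : eLpNorm (D.e P m μ₀ (A.T N₀) i) 4 P = eLpNorm (D.e P m μ₀ (A.T N₀) 0) 4 P :=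
    ((isDataFun_e hs hmodel hrate hmom (A.T N₀)).identDistrib hs i).eLpNorm_eq 4
  rw [lintegral_enorm_pow_eq _ (by norm_num)]
  refine pow_le_pow_left' ?_ 4
  rw [← hid, two_mul]
  have hm := aestronglyMeasurable_e (μ₀ := μ₀) hrate (A.T N₀) i
  have h4 : ((4 : ℕ) : ℝ≥0∞) = 4 := by norm_num
  rw [h4, eLpNorm_congr_ae (e_eq_sub_condExp hs hrate (hN₀ N) i)]
  exact (eLpNorm_sub_le hm integrable_condExp.aestronglyMeasurable (by norm_num)).trans
    (add_le_add le_rfl (eLpNorm_condExp_le_eLpNorm _ (by norm_num)))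

theorem exists_lintegral_e_sq_le [IsProbabilityMeasure P] (hs : Sampling P D)
    (hmodel : ModelAssumption P D m β₀ μ₀) (hrate : RateAssumption P D A m β₀ μ₀ g)
    (hmom : MomentAssumption P D A m β₀ μ₀) :
    ∃ C : ℝ≥0∞, C ≠ ∞ ∧ ∀ N i, ∫⁻ ω, ‖D.e P m μ₀ (A.T N) i ω‖ₑ ^ 2 ∂P ≤ C := by
  obtain ⟨C, hC, h⟩ := exists_lintegral_e_le hs hmodel hrate hmom
  refine ⟨1 + C, by simp [hC], fun N i => ?_⟩
  calc ∫⁻ ω, ‖D.e P m μ₀ (A.T N) i ω‖ₑ ^ 2 ∂P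
      ≤ ∫⁻ ω, (1 + ‖D.e P m μ₀ (A.T N) i ω‖ₑ ^ 4) ∂P := by
        refine lintegral_mono fun ω => ?_
        rcases le_total ‖D.e P m μ₀ (A.T N) i ω‖ₑ 1 with h1 | h1
        · exact (pow_le_one' h1 2).trans le_self_add
        · exact (pow_le_pow_right' h1 (by norm_num)).trans le_add_self
    _ ≤ 1 + C := by
        rw [lintegral_add_left measurable_const]
        simpa using h N i

/-- Minkowski's inequality for the average of `T - 1` vectors whose `L²` norms have a common bound.
-/
theorem exists_lintegral_Xbar_le [IsProbabilityMeasure P] (hs : Sampling P D)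
    (hmom : MomentAssumption P D A m β₀ μ₀) :
    ∃ C : ℝ≥0∞, C ≠ ∞ ∧ ∀ T, 2 ≤ T → ∀ i, ∫⁻ ω, ‖D.Xbar T i ω‖ₑ ^ 2 ∂P ≤ C := by
  obtain ⟨C, h⟩ := hmom.X_sq
  have hpow : ∀ i t, 1 ≤ t → eLpNorm (D.X i t) 2 P ≤ (C : ℝ≥0∞) ^ (1 / 2 : ℝ) := by
    intro i t ht
    have h1 := h i t ht
    rw [lintegral_enorm_pow_eq _ two_ne_zero, ← ENNReal.rpow_natCast] at h1
    have h2 := ENNReal.rpow_le_rpow h1 (show (0 : ℝ) ≤ 1 / 2 by norm_num)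
    rwa [← ENNReal.rpow_mul, show (((2 : ℕ) : ℝ) * (1 / 2)) = 1 by norm_num,
      ENNReal.rpow_one] at h2
  refine ⟨((C : ℝ≥0∞) ^ (1 / 2 : ℝ)) ^ 2,
    ENNReal.pow_ne_top (ENNReal.rpow_ne_top_of_nonneg (by norm_num) (by simp)), fun T hT i => ?_⟩
  rw [lintegral_enorm_pow_eq _ two_ne_zero]
  refine pow_le_pow_left' ?_ 2
  have hsum : (D.Xbar T i) = (((T : ℝ) - 1)⁻¹) • ∑ t ∈ Finset.Icc 1 (T - 1), D.X i t := by
    ext1 ω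
    simp [Panel.Xbar]
  have hT1 : (0 : ℝ) < (T - 1 : ℕ) := by
    have : 0 < T - 1 := by omega
    exact_mod_cast this
  have hcast : (T : ℝ) - 1 = (T - 1 : ℕ) := by
    rw [Nat.cast_sub (by omega)]; simp
  rw [hsum, eLpNorm_const_smul, hcast]
  calc ‖((T - 1 : ℕ) : ℝ)⁻¹‖ₑ * eLpNorm (∑ t ∈ Finset.Icc 1 (T - 1), D.X i t) 2 P
      ≤ ‖((T - 1 : ℕ) : ℝ)⁻¹‖ₑ * ∑ t ∈ Finset.Icc 1 (T - 1), (C : ℝ≥0∞) ^ (1 / 2 : ℝ) := by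
        gcongr
        refine (eLpNorm_sum_le (fun t _ => (hs.meas_X i t).aestronglyMeasurable)
          (by norm_num)).trans (Finset.sum_le_sum fun t ht => hpow i t (Finset.mem_Icc.1 ht).1)
    _ = (C : ℝ≥0∞) ^ (1 / 2 : ℝ) := by
        rw [Finset.sum_const, Nat.card_Icc, Nat.add_sub_cancel, nsmul_eq_mul, ← mul_assoc,
          ← ofReal_norm, Real.norm_of_nonneg (by positivity),
          ENNReal.ofReal_inv_of_pos hT1, ENNReal.ofReal_natCast,
          ENNReal.inv_mul_cancel (by exact_mod_cast hT1.ne') (by simp), one_mul]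

end DataFunctions

end OrthMoment

namespace OrthMoment

/-! ### Weighted sums of errors with conditional mean zero -/

section Orthogonality

variable {Ω E : Type*} {m0 : MeasurableSpace Ω} {P : Measure Ω}
  [NormedAddCommGroup E] [InnerProductSpace ℝ E]

theorem lintegral_norm_sum_sq_of_orthogonal {ι : Type*} {w : ι → Ω → E} (S : Finset ι)
    (hw : ∀ i ∈ S, MemLp (w i) 2 P)
    (horth : ∀ i ∈ S, ∀ j ∈ S, i ≠ j → ∫ ω, inner ℝ (w i ω) (w j ω) ∂P = 0) :
    ∫⁻ ω, ‖∑ i ∈ S, w i ω‖ₑ ^ 2 ∂P = ∑ i ∈ S, ∫⁻ ω, ‖w i ω‖ₑ ^ 2 ∂P := by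
  have hconv : ∀ f : Ω → E, MemLp f 2 P →
      ∫⁻ ω, ‖f ω‖ₑ ^ 2 ∂P = ENNReal.ofReal (∫ ω, ‖f ω‖ ^ 2 ∂P) := by
    intro f hf
    rw [ofReal_integral_eq_lintegral_ofReal (hf.integrable_norm_pow (by norm_num))
      (ae_of_all _ fun ω => by positivity)]
    refine lintegral_congr fun ω => ?_
    rw [ENNReal.ofReal_pow (norm_nonneg _), ofReal_norm]
  have hinner : ∀ i ∈ S, ∀ j ∈ S, Integrable (fun ω => inner ℝ (w i ω) (w j ω)) P :=
    fun i hi j hj =>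
    ((hw i hi).norm.integrable_mul (hw j hj).norm).mono
      ((hw i hi).aestronglyMeasurable.inner (hw j hj).aestronglyMeasurable)
      (ae_of_all _ fun ω => by simpa using norm_inner_le_norm (𝕜 := ℝ) (w i ω) (w j ω))
  rw [hconv _ (memLp_finsetSum S hw), Finset.sum_congr rfl fun i hi => hconv _ (hw i hi),
    ← ENNReal.ofReal_sum_of_nonneg fun i _ => integral_nonneg fun ω => by positivity]
  congr 1
  have h1 : ∀ ω, ‖∑ i ∈ S, w i ω‖ ^ 2 = ∑ i ∈ S, ∑ j ∈ S, inner ℝ (w i ω) (w j ω) := by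
    intro ω
    rw [← real_inner_self_eq_norm_sq, sum_inner]
    simp only [inner_sum]
  simp only [h1]
  rw [integral_finsetSum _ fun i hi => integrable_finsetSum _ fun j hj => hinner i hi j hj]
  refine Finset.sum_congr rfl fun i hi => ?_
  rw [integral_finsetSum _ fun j hj => hinner i hi j hj,
    Finset.sum_eq_single i (fun j hj hji => horth i hi j hj hji.symm) (fun h => absurd hi h)]
  simp only [real_inner_self_eq_norm_sq]

variable [IsProbabilityMeasure P]

/-- Given `F ⊔ G` the weight `v` and the set of integration are known. By independence the
conditional variance of `u` given `F ⊔ G` is that given `F`, which is at most `C` on this set. -/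
theorem setLIntegral_smul_sq_le {F G k : MeasurableSpace Ω} (hF : F ≤ k) (hk : k ≤ m0) (hG : G ≤ m0)
    (hind : Indep k G P) {u : Ω → ℝ} (hu : StronglyMeasurable[k] u) (hu2 : MemLp u 2 P)
    {v : Ω → E} (hv : StronglyMeasurable[F ⊔ G] v) {B : Set Ω} (hB : MeasurableSet[G] B) (C : ℝ) :
    ∫⁻ ω in B ∩ {ω | (P[fun ω' => u ω' ^ 2 | F]) ω ≤ C}, ‖u ω • v ω‖ₑ ^ 2 ∂P ≤
      ENNReal.ofReal C * ∫⁻ ω in B, ‖v ω‖ₑ ^ 2 ∂P := by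
  have hFG : F ⊔ G ≤ m0 := sup_le (hF.trans hk) hG
  set κ : Ω → ℝ := P[fun ω' => u ω' ^ 2 | F] with hκ
  have hκF : Measurable[F] κ := stronglyMeasurable_condExp.measurable
  have hκm : MeasurableSet[F ⊔ G] {ω | κ ω ≤ C} :=
    (le_sup_left (a := F) (b := G)) _ (hκF measurableSet_Iic)
  have hBm : MeasurableSet[F ⊔ G] B := (le_sup_right (a := F) (b := G)) _ hB
  have hset : MeasurableSet[F ⊔ G] (B ∩ {ω | κ ω ≤ C}) := hBm.inter hκm
  set f : Ω → ℝ≥0∞ := (B ∩ {ω | κ ω ≤ C}).indicator fun ω => ‖v ω‖ₑ ^ 2 with hf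
  have hvm : Measurable[F ⊔ G] fun ω => ‖v ω‖ₑ ^ 2 := hv.enorm.pow_const 2
  have hfm : Measurable[F ⊔ G] f := hvm.indicator hset
  have hcond : P[fun ω' => u ω' ^ 2 | F ⊔ G] =ᵐ[P] κ :=
    condExp_sup_of_indep hF hk hG hind (hu.pow 2) hu2.integrable_sq
  have h1 := lintegral_mul_condExp hFG hu2.integrable_sq (ae_of_all _ fun ω => sq_nonneg _) hfm
  calc ∫⁻ ω in B ∩ {ω | κ ω ≤ C}, ‖u ω • v ω‖ₑ ^ 2 ∂P
      = ∫⁻ ω, f ω * ENNReal.ofReal (u ω ^ 2) ∂P := by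
        rw [← lintegral_indicator (hFG _ hset)]
        refine lintegral_congr fun ω => ?_
        simp only [hf, Set.indicator]
        split_ifs
        · rw [enorm_smul, mul_pow, mul_comm, ← sq_abs (u ω), ENNReal.ofReal_pow (abs_nonneg _),
            ← Real.norm_eq_abs, ofReal_norm]
        · simp
    _ = ∫⁻ ω, f ω * ENNReal.ofReal ((P[fun ω' => u ω' ^ 2 | F ⊔ G]) ω) ∂P := h1
    _ ≤ ∫⁻ ω, ENNReal.ofReal C * B.indicator (fun ω => ‖v ω‖ₑ ^ 2) ω ∂P := by
        refine lintegral_mono_ae ?_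
        filter_upwards [hcond] with ω hω
        rw [hω]
        by_cases h : ω ∈ B ∩ {ω | κ ω ≤ C}
        · simp only [hf, Set.indicator, h, h.1, if_true]
          rw [mul_comm]
          gcongr
          exact h.2
        · simp [hf, Set.indicator, h]
    _ = ENNReal.ofReal C * ∫⁻ ω in B, ‖v ω‖ₑ ^ 2 ∂P := by
        rw [lintegral_const_mul' _ _ ENNReal.ofReal_ne_top, lintegral_indicator (hG _ hB)]

theorem integral_mul_eq_zero_of_indep {F G k : MeasurableSpace Ω} (hF : F ≤ k) (hk : k ≤ m0)
    (hG : G ≤ m0) (hind : Indep k G P) {u f : Ω → ℝ} (hu : StronglyMeasurable[k] u)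
    (hui : Integrable u P) (hu0 : P[u | F] =ᵐ[P] 0) (hf : StronglyMeasurable[F ⊔ G] f)
    (hfu : Integrable (f * u) P) : ∫ ω, f ω * u ω ∂P = 0 :=
  integral_mul_eq_zero_of_condExp (sup_le (hF.trans hk) hG) hf.aestronglyMeasurable hui hfu
    ((condExp_sup_of_indep hF hk hG hind hu hui).trans hu0)

end Orthogonality

/-! ### Measurability of the first-stage estimates with respect to an arbitrary σ-algebra -/

section Measurability

variable {Ω : Type*} [MeasurableSpace Ω] {d p k q L : ℕ} {D : Panel Ω d p}
  {A : Procedure Ω p k q L}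

theorem measurable_Xbar {T i : ℕ} (hX : ∀ t ∈ Finset.Icc 1 T, Measurable (D.X i t)) :
    Measurable (D.Xbar T i) := by
  unfold Panel.Xbar
  refine Measurable.const_smul (Finset.measurable_fun_sum _ fun t ht => hX t ?_) ((T : ℝ) - 1)⁻¹
  exact Finset.Icc_subset_Icc_right (Nat.sub_le T 1) ht

theorem measurable_Ybar {T i : ℕ} (hY : ∀ t ∈ Finset.Ico 1 T, Measurable (D.Y i t)) :
    Measurable (D.Ybar T i) := by
  unfold Panel.Ybar
  refine Measurable.const_mul (Finset.measurable_fun_sum _ fun t ht => hY t ?_) _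
  simp only [Finset.mem_Icc, Finset.mem_Ico] at ht ⊢
  omega

theorem measurable_αt {N : ℕ} {l : Fin L} {i : ℕ} (hY : Measurable (D.Ybar (A.T N) i))
    (hX : ∀ t ∈ Finset.Icc 1 (A.T N), Measurable (D.X i t)) (hβ : Measurable (A.βt N l)) :
    Measurable (A.αt D N l i) :=
  hY.sub ((measurable_Xbar hX).inner hβ)

theorem measurable_at {N : ℕ} {l : Fin L} {i : ℕ} (hY : Measurable (D.Ybar (A.T N) i))
    (hX : ∀ t ∈ Finset.Icc 1 (A.T N), Measurable (D.X i t)) (hβ : Measurable (A.βt N l))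
    (hπ : ∀ j r, Measurable fun ω => A.πt N l ω j r)
    (hdict : Measurable fun z : (Fin (A.T N) → Vec p) × ℝ => A.dict N z.1 z.2) :
    Measurable (A.at_ D N l i) := by
  have hpath : Measurable (D.Xpath (A.T N) i) := by
    refine measurable_pi_lambda _ fun s => hX _ ?_
    simp only [Finset.mem_Icc]
    exact ⟨Nat.le_add_left 1 s, s.2⟩
  have hb := hdict.comp (hpath.prodMk (measurable_αt hY hX hβ))
  unfold Procedure.at_
  refine (WithLp.measurable_toLp 2 _).comp (measurable_pi_lambda _ fun r => ?_)
  exact Finset.measurable_fun_sum _ fun j _ => ((measurable_pi_apply j).comp hb).mul (hπ j r)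

end Measurability

/-! ### Information sets of individuals and of folds, and their independence -/

section PanelSigmaAlgebras

variable {Ω : Type*} {d p k q L : ℕ} {D : Panel Ω d p} {A : Procedure Ω p k q L}

/-- The σ-algebra generated by all variables attached to individual `i`. -/
abbrev Panel.sigUnit (D : Panel Ω d p) (i : ℕ) : MeasurableSpace Ω :=
  MeasurableSpace.comap (D.unit i) inferInstance

theorem measurable_sigUnit {F : Type*} [MeasurableSpace F] {φ : UnitData d p → F}
    (hφ : Measurable φ) (i : ℕ) : Measurable[D.sigUnit i] fun ω => φ (D.unit i ω) :=
  hφ.comp (comap_measurable _)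

theorem sigPast_le_sigUnit (i t : ℕ) : D.sigPast i t ≤ D.sigUnit i := by
  refine sup_le (sup_le ?_ ?_) (iSup₂_le fun s _ => sup_le ?_ ?_)
  · exact (measurable_sigUnit (D := D) (φ := fun v => v.2.2.2 t) (by fun_prop) i).comap_le
  · exact (measurable_sigUnit (D := D) (φ := fun v => v.2.1) (by fun_prop) i).comap_le
  · exact (measurable_sigUnit (D := D) (φ := fun v => v.2.2.1 s) (by fun_prop) i).comap_le
  · exact (measurable_sigUnit (D := D) (φ := fun v => v.2.2.2 s) (by fun_prop) i).comap_le

/-- The average `Ybar` omits period `T`. This is what lets sequential exogeneity apply to `u_iT`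
given everything `ã_il` uses from individual `i`. -/
theorem sigXYα_le_sigPast {T : ℕ} (hT : 1 ≤ T) (i : ℕ) : D.sigXYα T i ≤ D.sigPast i T := by
  have hX : ∀ t ∈ Finset.Icc 1 T, MeasurableSpace.comap (D.X i t) inferInstance ≤
      D.sigPast i T := by
    intro t ht
    rw [Finset.mem_Icc] at ht
    rcases ht.2.lt_or_eq with h | rfl
    · exact le_trans (le_trans le_sup_right (le_iSup₂_of_le t (Finset.mem_Ico.2 ⟨ht.1, h⟩) le_rfl))
        le_sup_right
    · exact le_sup_left.trans le_sup_left
  refine sup_le (sup_le (le_sup_right.trans le_sup_left) (iSup₂_le hX)) ?_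
  refine Measurable.comap_le ?_
  refine @measurable_Ybar Ω (D.sigPast i T) d p D T i fun t ht => ?_
  exact Measurable.of_comap_le (le_trans (le_trans le_sup_left (le_iSup₂_of_le t ht le_rfl))
    le_sup_right)

theorem sigOut_le_iSup (N : ℕ) (l : Fin L) :
    A.sigOut D N l ≤ ⨆ j ∈ ((Finset.range N \ A.fold N l : Finset ℕ) : Set ℕ), D.sigUnit j := by
  refine iSup₂_le fun j hj => le_trans ?_ (le_iSup₂_of_le j (by simpa using hj) le_rfl)
  refine sup_le ?_ (iSup₂_le fun t _ => sup_le ?_ ?_)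
  · exact (measurable_sigUnit (D := D) (φ := fun v => v.1) (by fun_prop) j).comap_le
  · exact (measurable_sigUnit (D := D) (φ := fun v => v.2.2.1 t) (by fun_prop) j).comap_le
  · exact (measurable_sigUnit (D := D) (φ := fun v => v.2.2.2 t) (by fun_prop) j).comap_le

theorem sigOut_le_compl {N : ℕ} {l : Fin L} {i : ℕ} (hi : i ∈ A.fold N l) :
    A.sigOut D N l ≤ ⨆ j ∈ ({i}ᶜ : Set ℕ), D.sigUnit j := by
  refine (sigOut_le_iSup N l).trans (biSup_mono fun j hj => ?_)
  rintro rfl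
  simp [hi] at hj

theorem stronglyMeasurable_u (β₀ : Vec p) (i t : ℕ) :
    StronglyMeasurable[D.sigUnit i] (D.u β₀ i t) :=
  (measurable_sigUnit (D := D)
    (φ := fun v => v.2.2.1 t - inner ℝ (v.2.2.2 t) β₀ - v.2.1)
    (by fun_prop) i).stronglyMeasurable

variable [MeasurableSpace Ω] {P : Measure Ω} {m : Vec d → ℝ → Vec k → Vec q} {β₀ : Vec p}
  {μ₀ : Vec k} {g : ℝ} {Θ : Set (Vec k)}

theorem Sampling.sigUnit_le (hs : Sampling P D) (i : ℕ) : D.sigUnit i ≤ ‹MeasurableSpace Ω› :=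
  (hs.measurable_unit i).comap_le

theorem Sampling.sigOut_le (hs : Sampling P D) (N : ℕ) (l : Fin L) :
    A.sigOut D N l ≤ ‹MeasurableSpace Ω› :=
  (sigOut_le_iSup N l).trans (iSup₂_le fun j _ => hs.sigUnit_le j)

theorem Sampling.indep_compl (hs : Sampling P D) (i : ℕ) :
    Indep (D.sigUnit i) (⨆ j ∈ ({i}ᶜ : Set ℕ), D.sigUnit j) P := by
  have h := indep_iSup_of_disjoint (fun i => hs.sigUnit_le i) hs.indep
    (S := {i}) (T := {i}ᶜ) disjoint_compl_right
  simpa using h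

theorem Sampling.indep_sigOut (hs : Sampling P D) {N : ℕ} {l : Fin L} {i : ℕ}
    (hi : i ∈ A.fold N l) : Indep (D.sigUnit i) (A.sigOut D N l) P :=
  indep_of_indep_of_le_right (hs.indep_compl i) (sigOut_le_compl hi)

theorem Sampling.indep_sigOut_sup (hs : Sampling P D) {N : ℕ} {l : Fin L} {i j : ℕ}
    (hj : j ∈ A.fold N l) (hij : i ≠ j) :
    Indep (D.sigUnit j) (A.sigOut D N l ⊔ D.sigUnit i) P :=
  indep_of_indep_of_le_right (hs.indep_compl j)
    (sup_le (sigOut_le_compl hj) (le_iSup₂_of_le i (by simpa using hij) le_rfl))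

/-- The unshrunk `α̃_il` is the argument of the dictionary. The shrunk estimate would involve the
other individuals of the fold and destroy this measurability. -/
theorem measurable_at_sigXYα (hA : A.IsValid D m P Θ) (N : ℕ) (l : Fin L) (i : ℕ) :
    Measurable[D.sigXYα (A.T N) i ⊔ A.sigOut D N l] (A.at_ D N l i) := by
  refine @measurable_at Ω (D.sigXYα (A.T N) i ⊔ A.sigOut D N l) d p k q L D A N l i ?_ ?_ ?_ ?_
    (hA.dict_meas N)
  · exact Measurable.of_comap_le (le_trans le_sup_right le_sup_left)
  · intro t ht
    exact Measurable.of_comap_le (le_trans (le_trans (le_trans (le_iSup₂_of_le t ht le_rfl)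
      le_sup_right) le_sup_left) le_sup_left)
  · exact (hA.βt_out N l).mono le_sup_right le_rfl
  · exact fun j r => (hA.πt_out N l j r).mono le_sup_right le_rfl

theorem stronglyMeasurable_at_sub_a (hA : A.IsValid D m P Θ) (N : ℕ) (l : Fin L) (i : ℕ) :
    StronglyMeasurable[D.sigXYα (A.T N) i ⊔ A.sigOut D N l]
      fun ω => A.at_ D N l i ω - D.a P m μ₀ (A.T N) i ω := by
  refine StronglyMeasurable.sub ?_ ?_
  · exact (measurable_at_sigXYα hA N l i).stronglyMeasurable
  · exact stronglyMeasurable_condExp.mono (le_trans le_sup_left le_sup_left)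

end PanelSigmaAlgebras

end OrthMoment

namespace OrthMoment

/-! ### From conditional means given the out-of-fold data to stochastic bounds -/

section ConditionalMeans

variable {Ω : Type*} [mΩ : MeasurableSpace Ω] {P : Measure Ω}

/-- Markov's inequality for a dominating variable that may depend on `η`. This freedom is needed
because the cut-off in `cutErr` changes with the desired precision. -/
theorem tendsto_wpa_of_lintegral_le {X : ℕ × Ω → ℝ}
    (h : ∀ η : ℝ, 0 < η → ∃ Y : ℕ → Ω → ℝ≥0∞, (∀ N, AEMeasurable (Y N) P) ∧
      (∀ᶠ N in atTop, ∫⁻ ω, Y N ω ∂P ≤ ENNReal.ofReal η) ∧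
      ∀ᶠ z in wpa P, ‖X z‖ₑ ≤ Y z.1 z.2) : Tendsto X (wpa P) (𝓝 0) := by
  rw [Metric.tendsto_nhds]
  intro ε hε
  rw [eventually_wpa, ENNReal.tendsto_atTop_zero]
  intro κ hκ
  by_cases hκ' : κ = ∞
  · exact ⟨0, fun _ _ => by simp [hκ']⟩
  have hκ2 : 0 < κ.toReal := ENNReal.toReal_pos hκ.ne' hκ'
  obtain ⟨Y, hYm, hY, hXY⟩ := h (ε * (κ.toReal / 2)) (by positivity)
  have h1 := (eventually_wpa.1 hXY).eventually_le_const (ENNReal.half_pos hκ.ne')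
  rw [← eventually_atTop]
  filter_upwards [h1, hY] with N hN1 hN2
  have h3 : P {ω | ENNReal.ofReal ε ≤ Y N ω} ≤ κ / 2 := by
    refine (meas_ge_le_lintegral_div (hYm N) (by simpa using hε) (by simp)).trans ?_
    refine (ENNReal.div_le_div_right hN2 _).trans ?_
    rw [ENNReal.ofReal_mul hε.le, mul_comm, ENNReal.mul_div_cancel_right (by simpa using hε) (by simp),
      ENNReal.ofReal_div_of_pos two_pos, ENNReal.ofReal_toReal hκ']
    simp
  rw [← ENNReal.add_halves κ]
  refine (measure_mono ?_).trans ((measure_union_le _ _).trans (add_le_add hN1 h3))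
  intro ω hω
  by_cases hX : ‖X (N, ω)‖ₑ ≤ Y N ω
  · right
    refine le_trans ?_ hX
    rw [← ofReal_norm]
    simpa using ENNReal.ofReal_le_ofReal (not_lt.1 hω)
  · left
    simpa using hX

variable [IsProbabilityMeasure P]

/-- The event belongs to `G`, so on it each `f i` may be replaced by its conditional mean, and the
average of these is at most `η` there. -/
theorem sum_setLIntegral_le {G : MeasurableSpace Ω} (hG : G ≤ mΩ) (S : Finset ℕ) {f : ℕ → Ω → ℝ}
    (hf : ∀ i ∈ S, Integrable (f i) P) (hf0 : ∀ i ∈ S, ∀ ω, 0 ≤ f i ω) {η : ℝ} (hη : 0 ≤ η) :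
    ∑ i ∈ S, ∫⁻ ω in {ω | (S.card : ℝ)⁻¹ * ∑ i ∈ S, (P[f i | G]) ω ≤ η}, ENNReal.ofReal (f i ω) ∂P ≤
      ENNReal.ofReal (S.card * η) := by
  set B := {ω | (S.card : ℝ)⁻¹ * ∑ i ∈ S, (P[f i | G]) ω ≤ η} with hB
  have hZ : Measurable[G] fun ω => (S.card : ℝ)⁻¹ * ∑ i ∈ S, (P[f i | G]) ω := by
    refine Measurable.const_mul (Finset.measurable_fun_sum _ fun i _ => ?_) _
    exact stronglyMeasurable_condExp.measurable
  have hBm : MeasurableSet[G] B := hZ measurableSet_Iic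
  have h1 : ∀ i ∈ S, ∫⁻ ω in B, ENNReal.ofReal (f i ω) ∂P =
      ENNReal.ofReal (∫ ω in B, (P[f i | G]) ω ∂P) := by
    intro i hi
    rw [setIntegral_condExp hG (hf i hi) hBm,
      ofReal_integral_eq_lintegral_ofReal (hf i hi).integrableOn (ae_of_all _ (hf0 i hi))]
  rw [Finset.sum_congr rfl h1, ← ENNReal.ofReal_sum_of_nonneg]
  · refine ENNReal.ofReal_le_ofReal ?_
    rw [← integral_finsetSum _ fun i _ => integrable_condExp.integrableOn]
    rcases S.eq_empty_or_nonempty with rfl | hS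
    · simp
    have hc : (0 : ℝ) < S.card := by exact_mod_cast hS.card_pos
    have hint : Integrable (fun ω => ∑ i ∈ S, (P[f i | G]) ω) P :=
      integrable_finsetSum _ fun i _ => integrable_condExp
    calc ∫ ω in B, ∑ i ∈ S, (P[f i | G]) ω ∂P ≤ ∫ _ in B, S.card * η ∂P := by
            refine setIntegral_mono_on hint.integrableOn (integrable_const _).integrableOn
              (hG _ hBm) fun ω hω => ?_
            have : (S.card : ℝ)⁻¹ * ∑ i ∈ S, (P[f i | G]) ω ≤ η := hω
            rwa [inv_mul_le_iff₀ hc] at this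
        _ = P.real B * (S.card * η) := by rw [setIntegral_const, smul_eq_mul]
        _ ≤ 1 * (S.card * η) := by
            gcongr
            exact measureReal_le_one
        _ = S.card * η := one_mul _
  · intro i hi
    refine setIntegral_nonneg_of_ae ?_
    exact condExp_nonneg (ae_of_all _ (hf0 i hi))

variable {d p k q L : ℕ} {D : Panel Ω d p} {A : Procedure Ω p k q L}
  {m : Vec d → ℝ → Vec k → Vec q} {β₀ : Vec p} {μ₀ : Vec k} {g : ℝ} {Θ : Set (Vec k)}

theorem fold_subset_range (hA : A.IsValid D m P Θ) (N : ℕ) (l : Fin L) :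
    A.fold N l ⊆ Finset.range N := by
  rw [← hA.fold_cover N]
  exact Finset.subset_biUnion_of_mem _ (Finset.mem_univ l)

theorem fold_card_le (hA : A.IsValid D m P Θ) (N : ℕ) (l : Fin L) : (A.fold N l).card ≤ N := by
  simpa using Finset.card_le_card (fold_subset_range hA N l)

theorem sum_setLIntegral_fold_le (hs : Sampling P D) (hA : A.IsValid D m P Θ) (N : ℕ) (l : Fin L)
    {f : ℕ → Ω → ℝ} (hf : ∀ i ∈ A.fold N l, Integrable (f i) P)
    (hf0 : ∀ i ∈ A.fold N l, ∀ ω, 0 ≤ f i ω) {η : ℝ} (hη : 0 ≤ η) :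
    ENNReal.ofReal ((N : ℝ)⁻¹) * ∑ i ∈ A.fold N l, ∫⁻ ω in {ω | (A.foldMean N l fun i =>
      (P[f i | A.sigOut D N l]) ω) ≤ η}, ENNReal.ofReal (f i ω) ∂P ≤ ENNReal.ofReal η := by
  rcases Nat.eq_zero_or_pos N with rfl | hN
  · simp
  have hN' : (0 : ℝ) < N := by exact_mod_cast hN
  refine (mul_le_mul_right (sum_setLIntegral_le (hs.sigOut_le N l) _ hf hf0 hη) _).trans ?_
  rw [← ENNReal.ofReal_mul (by positivity)]
  refine ENNReal.ofReal_le_ofReal ?_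
  rw [inv_mul_le_iff₀ hN']
  gcongr
  exact_mod_cast fold_card_le hA N l

/-- Conditional Markov inequality: on the event where the averaged conditional means are at most
`M`, the average has integral at most `M`. The complement has probability at most `ε/2`. -/
theorem tight_of_condExp (hs : Sampling P D) (hA : A.IsValid D m P Θ) (l : Fin L)
    {f : ℕ → ℕ → Ω → ℝ} (hf : ∀ N, ∀ i ∈ A.fold N l, Integrable (f N i) P)
    (hf0 : ∀ N, ∀ i ∈ A.fold N l, ∀ ω, 0 ≤ f N i ω)
    (h : IsBigOp P (fun N ω => A.foldMean N l fun i => (P[f N i | A.sigOut D N l]) ω)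
      fun _ => 1) :
    Tight (wpa P) fun z => (z.1 : ℝ)⁻¹ * ∑ i ∈ A.fold z.1 l, f z.1 i z.2 := by
  refine tight_of_measure_le fun ε hε => ?_
  by_cases hε' : ε = ∞
  · exact ⟨0, by simp [hε']⟩
  obtain ⟨M₀, hM₀⟩ := h (ε / 2) (ENNReal.half_pos hε.ne')
  have hε2 : 0 < ε.toReal := ENNReal.toReal_pos hε.ne' hε'
  set M := |M₀| with hM
  refine ⟨(M + 1) / (ε.toReal / 2), ?_⟩
  filter_upwards [hM₀] with N hN
  set B := {ω | (A.foldMean N l fun i => (P[f N i | A.sigOut D N l]) ω) ≤ M} with hB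
  have hBc : P Bᶜ ≤ ε / 2 := by
    refine le_trans (measure_mono fun ω hω => ?_) hN
    have h1 : M < A.foldMean N l fun i => (P[f N i | A.sigOut D N l]) ω := not_le.1 hω
    simp only [mul_one, Set.mem_ofPred_eq]
    exact (le_abs_self M₀).trans_lt (h1.trans_le (le_abs_self _))
  have hsum := sum_setLIntegral_fold_le hs hA N l (hf N) (hf0 N) (abs_nonneg M₀)
  have hmeas : ∀ i ∈ A.fold N l, AEMeasurable (fun ω => ENNReal.ofReal (f N i ω)) (P.restrict B) :=
    fun i hi => (hf N i hi).aemeasurable.ennreal_ofReal.restrict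
  have hX : ∀ ω, ENNReal.ofReal ((N : ℝ)⁻¹ * ∑ i ∈ A.fold N l, f N i ω) =
      ENNReal.ofReal ((N : ℝ)⁻¹) * ∑ i ∈ A.fold N l, ENNReal.ofReal (f N i ω) := fun ω => by
    rw [ENNReal.ofReal_mul (by positivity), ENNReal.ofReal_sum_of_nonneg fun i hi => hf0 N i hi ω]
  have hint : ∫⁻ ω in B, ENNReal.ofReal ((N : ℝ)⁻¹ * ∑ i ∈ A.fold N l, f N i ω) ∂P ≤
      ENNReal.ofReal M := by
    simp only [hX]
    rw [lintegral_const_mul'' _ (Finset.aemeasurable_fun_sum _ hmeas),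
      lintegral_finsetSum' _ hmeas]
    exact hsum
  have hXm : AEMeasurable (fun ω => ENNReal.ofReal ((N : ℝ)⁻¹ * ∑ i ∈ A.fold N l, f N i ω))
      (P.restrict B) := by
    simp only [hX]
    exact (Finset.aemeasurable_fun_sum _ hmeas).const_mul _
  have hpos : 0 < (M + 1) / (ε.toReal / 2) := by positivity
  have hmk := meas_ge_le_lintegral_div hXm (ε := ENNReal.ofReal ((M + 1) / (ε.toReal / 2)))
    (by simpa using hpos) (by simp)
  have hbd : P.restrict B {ω | ENNReal.ofReal ((M + 1) / (ε.toReal / 2)) ≤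
      ENNReal.ofReal ((N : ℝ)⁻¹ * ∑ i ∈ A.fold N l, f N i ω)} ≤ ε / 2 := by
    refine hmk.trans ((ENNReal.div_le_div_right hint _).trans ?_)
    rw [ENNReal.div_le_iff (by simpa using hpos) (by simp)]
    have : ε / 2 = ENNReal.ofReal (ε.toReal / 2) := by
      rw [ENNReal.ofReal_div_of_pos two_pos, ENNReal.ofReal_toReal hε']; simp
    rw [this, ← ENNReal.ofReal_mul (by positivity)]
    refine ENNReal.ofReal_le_ofReal ?_
    rw [mul_div_cancel₀ _ (by positivity)]
    linarith
  have hBm : MeasurableSet B := by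
    refine hs.sigOut_le (A := A) N l _ ?_
    have hZ : Measurable[A.sigOut D N l] fun ω =>
        A.foldMean N l fun i => (P[f N i | A.sigOut D N l]) ω := by
      refine Measurable.const_mul (Finset.measurable_fun_sum _ fun i _ => ?_) _
      exact stronglyMeasurable_condExp.measurable
    exact hZ measurableSet_Iic
  rw [Measure.restrict_apply' hBm] at hbd
  conv_rhs => rw [← ENNReal.add_halves ε]
  refine (measure_mono ?_).trans ((measure_union_le _ _).trans (add_le_add hbd hBc))
  intro ω hω
  by_cases hωB : ω ∈ B
  · left
    refine ⟨?_, hωB⟩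
    have hω : (M + 1) / (ε.toReal / 2) < |(N : ℝ)⁻¹ * ∑ i ∈ A.fold N l, f N i ω| := hω
    rw [abs_of_nonneg (mul_nonneg (by positivity)
      (Finset.sum_nonneg fun i hi => hf0 N i hi ω))] at hω
    exact ENNReal.ofReal_le_ofReal hω.le
  · exact Or.inr hωB

end ConditionalMeans

/-! ### Errors of the estimated `a` weighted by the residual of the last period -/

section WeightedErrors

variable {Ω : Type*} [MeasurableSpace Ω] {P : Measure Ω} [IsProbabilityMeasure P]
  {d p k q L : ℕ} {D : Panel Ω d p} {A : Procedure Ω p k q L}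
  {m : Vec d → ℝ → Vec k → Vec q} {β₀ : Vec p} {μ₀ : Vec k} {g : ℝ} {Θ : Set (Vec k)}

/-- The conditional second moment of the estimation error of `a` given the out-of-fold data,
averaged over the fold. -/
noncomputable def aErr (P : Measure Ω) (D : Panel Ω d p) (A : Procedure Ω p k q L)
    (m : Vec d → ℝ → Vec k → Vec q) (μ₀ : Vec k) (l : Fin L) (N : ℕ) (ω : Ω) : ℝ :=
  A.foldMean N l fun i =>
    (P[fun ω' => ‖A.at_ D N l i ω' - D.a P m μ₀ (A.T N) i ω'‖ ^ 2 | A.sigOut D N l]) ω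

/-- The weighted error `(ã_il - a_i) u_iT`, cut off where `aErr` or the conditional variance of
`u_iT` is large. -/
noncomputable def cutErr (P : Measure Ω) (D : Panel Ω d p) (A : Procedure Ω p k q L)
    (m : Vec d → ℝ → Vec k → Vec q) (β₀ : Vec p) (μ₀ : Vec k) (η C : ℝ) (l : Fin L) (N i : ℕ) :
    Ω → Vec q :=
  ({ω | aErr P D A m μ₀ l N ω ≤ η} ∩
    {ω | (P[fun ω' => D.u β₀ i (A.T N) ω' ^ 2 | D.sigXYα (A.T N) i]) ω ≤ C}).indicator
    fun ω => D.u β₀ i (A.T N) ω • (A.at_ D N l i ω - D.a P m μ₀ (A.T N) i ω)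

theorem measurable_aErr (l : Fin L) (N : ℕ) :
    Measurable[A.sigOut D N l] (aErr P D A m μ₀ l N) := by
  refine Measurable.const_mul (Finset.measurable_fun_sum _ fun i _ => ?_) _
  exact stronglyMeasurable_condExp.measurable

theorem memLp_at_sub_a (hrate : RateAssumption P D A m β₀ μ₀ g) {N : ℕ} {l : Fin L} {i : ℕ}
    (hi : i ∈ A.fold N l) :
    MemLp (fun ω => A.at_ D N l i ω - D.a P m μ₀ (A.T N) i ω) 2 P :=
  (hrate.at_sq N l i hi).sub (hrate.a_sq N i)

theorem lintegral_cutErr_le (hs : Sampling P D) (hA : A.IsValid D m P Θ)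
    (hmodel : ModelAssumption P D m β₀ μ₀)
    (η C : ℝ) {N : ℕ} {l : Fin L} {i : ℕ} (hi : i ∈ A.fold N l) :
    ∫⁻ ω, ‖cutErr P D A m β₀ μ₀ η C l N i ω‖ₑ ^ 2 ∂P ≤ ENNReal.ofReal C *
      ∫⁻ ω in {ω | aErr P D A m μ₀ l N ω ≤ η},
        ENNReal.ofReal (‖A.at_ D N l i ω - D.a P m μ₀ (A.T N) i ω‖ ^ 2) ∂P := by
  have hT : 1 ≤ A.T N := one_le_two.trans (hA.two_le_T N)
  have hF : D.sigXYα (A.T N) i ≤ D.sigUnit i :=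
    (sigXYα_le_sigPast hT i).trans (sigPast_le_sigUnit i _)
  have h := setLIntegral_smul_sq_le hF (hs.sigUnit_le i) (hs.sigOut_le N l) (hs.indep_sigOut hi)
    (stronglyMeasurable_u β₀ i (A.T N)) (hmodel.sq_integrable i _ hT)
    (stronglyMeasurable_at_sub_a (P := P) (m := m) (μ₀ := μ₀) hA N l i)
    (measurable_aErr (P := P) (D := D) (A := A) (m := m) (μ₀ := μ₀) l N (measurableSet_Iic (a := η))) C
  have hBm : MeasurableSet ({ω | aErr P D A m μ₀ l N ω ≤ η} ∩
    {ω | (P[fun ω' => D.u β₀ i (A.T N) ω' ^ 2 | D.sigXYα (A.T N) i]) ω ≤ C}) := by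
    refine MeasurableSet.inter ?_ ?_
    · exact hs.sigOut_le (A := A) N l _ (measurable_aErr l N measurableSet_Iic)
    · have : Measurable[D.sigXYα (A.T N) i]
        (P[fun ω' => D.u β₀ i (A.T N) ω' ^ 2 | D.sigXYα (A.T N) i]) :=
        stronglyMeasurable_condExp.measurable
      exact (hF.trans (hs.sigUnit_le i)) _ (this measurableSet_Iic)
  calc ∫⁻ ω, ‖cutErr P D A m β₀ μ₀ η C l N i ω‖ₑ ^ 2 ∂P
      = ∫⁻ ω in {ω | aErr P D A m μ₀ l N ω ≤ η} ∩
        {ω | (P[fun ω' => D.u β₀ i (A.T N) ω' ^ 2 | D.sigXYα (A.T N) i]) ω ≤ C},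
        ‖D.u β₀ i (A.T N) ω • (A.at_ D N l i ω - D.a P m μ₀ (A.T N) i ω)‖ₑ ^ 2 ∂P := by
        rw [← lintegral_indicator hBm]
        refine lintegral_congr fun ω => ?_
        simp only [cutErr, Set.indicator]
        split_ifs <;> simp
    _ ≤ _ := h
    _ = _ := by
        simp only [ENNReal.ofReal_pow (norm_nonneg _), ofReal_norm]
        rfl

theorem memLp_cutErr (hs : Sampling P D) (hA : A.IsValid D m P Θ)
    (hmodel : ModelAssumption P D m β₀ μ₀) (hrate : RateAssumption P D A m β₀ μ₀ g)
    (η C : ℝ) {N : ℕ} {l : Fin L} {i : ℕ} (hi : i ∈ A.fold N l) :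
    MemLp (cutErr P D A m β₀ μ₀ η C l N i) 2 P := by
  have hT : 1 ≤ A.T N := one_le_two.trans (hA.two_le_T N)
  have hF : D.sigXYα (A.T N) i ≤ D.sigUnit i :=
    (sigXYα_le_sigPast hT i).trans (sigPast_le_sigUnit i _)
  refine ⟨AEStronglyMeasurable.indicator ?_ (MeasurableSet.inter ?_ ?_), ?_⟩
  · exact (hmodel.sq_integrable i _ hT).aestronglyMeasurable.smul
      (memLp_at_sub_a hrate hi).aestronglyMeasurable
  · exact hs.sigOut_le (A := A) N l _ (measurable_aErr l N measurableSet_Iic)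
  · have : Measurable[D.sigXYα (A.T N) i]
      (P[fun ω' => D.u β₀ i (A.T N) ω' ^ 2 | D.sigXYα (A.T N) i]) :=
      stronglyMeasurable_condExp.measurable
    exact (hF.trans (hs.sigUnit_le i)) _ (this measurableSet_Iic)
  · have h1 := lintegral_cutErr_le hs hA hmodel η C hi
    have h2 : ∫⁻ ω in {ω | aErr P D A m μ₀ l N ω ≤ η},
        ENNReal.ofReal (‖A.at_ D N l i ω - D.a P m μ₀ (A.T N) i ω‖ ^ 2) ∂P < ∞ := by
      refine lt_of_le_of_lt (setLIntegral_le_lintegral _ _) ?_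
      have := ((memLp_at_sub_a hrate hi).integrable_norm_pow (p := 2) (by norm_num)).lintegral_lt_top
      simpa using this
    have h3 := h1.trans_lt (ENNReal.mul_lt_top ENNReal.ofReal_lt_top h2)
    rw [lintegral_enorm_pow_eq _ two_ne_zero] at h3
    by_contra hcon
    rw [not_lt, top_le_iff] at hcon
    simp [hcon] at h3

/-- Condition on the past of `j`, the out-of-fold data and everything about `i`. Every factor except
`u_jT` is then known, and `u_jT` has conditional mean zero, since `j` is independent of `i` and of
the other folds. The cut-off only multiplies by the indicator of a known event and does not disturb
this. -/
theorem integral_inner_cutErr (hs : Sampling P D) (hA : A.IsValid D m P Θ)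
    (hmodel : ModelAssumption P D m β₀ μ₀) (hrate : RateAssumption P D A m β₀ μ₀ g)
    (η C : ℝ) {N : ℕ} {l : Fin L} {i j : ℕ} (hi : i ∈ A.fold N l) (hj : j ∈ A.fold N l)
    (hij : i ≠ j) :
    ∫ ω, inner ℝ (cutErr P D A m β₀ μ₀ η C l N i ω) (cutErr P D A m β₀ μ₀ η C l N j ω) ∂P = 0 := by
  have hT : 1 ≤ A.T N := one_le_two.trans (hA.two_le_T N)
  set B := {ω | aErr P D A m μ₀ l N ω ≤ η}
  have hBm : MeasurableSet[A.sigOut D N l] B := measurable_aErr l N measurableSet_Iic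
  have hκ : ∀ i, MeasurableSet[D.sigXYα (A.T N) i]
      {ω | (P[fun ω' => D.u β₀ i (A.T N) ω' ^ 2 | D.sigXYα (A.T N) i]) ω ≤ C} := fun i => by
    have : Measurable[D.sigXYα (A.T N) i]
      (P[fun ω' => D.u β₀ i (A.T N) ω' ^ 2 | D.sigXYα (A.T N) i]) :=
      stronglyMeasurable_condExp.measurable
    exact this measurableSet_Iic
  set v : ℕ → Ω → Vec q := fun i ω => A.at_ D N l i ω - D.a P m μ₀ (A.T N) i ω
  have hv : ∀ i, StronglyMeasurable[D.sigXYα (A.T N) i ⊔ A.sigOut D N l] (v i) :=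
    stronglyMeasurable_at_sub_a hA N l
  set f : Ω → ℝ := fun ω => inner ℝ (cutErr P D A m β₀ μ₀ η C l N i ω)
    ((B ∩ {ω | (P[fun ω' => D.u β₀ j (A.T N) ω' ^ 2 | D.sigXYα (A.T N) j]) ω ≤ C}).indicator
      (v j) ω) with hf
  have hfeq : (fun ω => inner ℝ (cutErr P D A m β₀ μ₀ η C l N i ω)
      (cutErr P D A m β₀ μ₀ η C l N j ω)) = f * D.u β₀ j (A.T N) := by
    ext ω
    simp only [hf, Pi.mul_apply]
    rw [show cutErr P D A m β₀ μ₀ η C l N j ω = D.u β₀ j (A.T N) ω •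
      (B ∩ {ω | (P[fun ω' => D.u β₀ j (A.T N) ω' ^ 2 | D.sigXYα (A.T N) j]) ω ≤ C}).indicator
        (v j) ω by
      simp only [cutErr, Set.indicator]
      split_ifs <;> simp_all [v, B]]
    rw [inner_smul_right, mul_comm]
  have hfm : StronglyMeasurable[D.sigPast j (A.T N) ⊔ (A.sigOut D N l ⊔ D.sigUnit i)] f := by
    have le1 : A.sigOut D N l ≤ D.sigPast j (A.T N) ⊔ (A.sigOut D N l ⊔ D.sigUnit i) :=
      le_trans le_sup_left le_sup_right
    have le2 : D.sigUnit i ≤ D.sigPast j (A.T N) ⊔ (A.sigOut D N l ⊔ D.sigUnit i) :=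
      le_trans le_sup_right le_sup_right
    have le3 : D.sigXYα (A.T N) i ≤ D.sigPast j (A.T N) ⊔ (A.sigOut D N l ⊔ D.sigUnit i) :=
      ((sigXYα_le_sigPast hT i).trans (sigPast_le_sigUnit i _)).trans le2
    have le4 : D.sigXYα (A.T N) j ≤ D.sigPast j (A.T N) ⊔ (A.sigOut D N l ⊔ D.sigUnit i) :=
      (sigXYα_le_sigPast hT j).trans le_sup_left
    refine StronglyMeasurable.inner ?_ ?_
    · refine StronglyMeasurable.indicator ?_ ((le1 _ hBm).inter (le3 _ (hκ i)))
      exact ((stronglyMeasurable_u β₀ i _).mono le2).smul ((hv i).mono (sup_le le3 le1))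
    · exact ((hv j).mono (sup_le le4 le1)).indicator ((le1 _ hBm).inter (le4 _ (hκ j)))
  have hint : Integrable (f * D.u β₀ j (A.T N)) P := by
    rw [← hfeq]
    have h1 := memLp_cutErr hs hA hmodel hrate η C hi
    have h2 := memLp_cutErr hs hA hmodel hrate η C hj
    exact (h1.norm.integrable_mul h2.norm).mono
      (h1.aestronglyMeasurable.inner h2.aestronglyMeasurable)
      (ae_of_all _ fun ω => by simpa using norm_inner_le_norm (𝕜 := ℝ) _ _)
  rw [hfeq]
  exact integral_mul_eq_zero_of_indep (sigPast_le_sigUnit j (A.T N)) (hs.sigUnit_le j)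
    (sup_le (hs.sigOut_le N l) (hs.sigUnit_le i)) (hs.indep_sigOut_sup hj hij)
    (stronglyMeasurable_u β₀ j _) ((hmodel.sq_integrable j _ hT).integrable (by norm_num))
    (hmodel.exogenous j _ hT) hfm hint

theorem lintegral_sum_cutErr_le (hs : Sampling P D) (hA : A.IsValid D m P Θ)
    (hmodel : ModelAssumption P D m β₀ μ₀) (hrate : RateAssumption P D A m β₀ μ₀ g)
    {η : ℝ} (hη : 0 ≤ η) (C : ℝ) (N : ℕ) (l : Fin L) :
    ENNReal.ofReal ((N : ℝ)⁻¹) * ∑ i ∈ A.fold N l, ∫⁻ ω,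
      ‖cutErr P D A m β₀ μ₀ η C l N i ω‖ₑ ^ 2 ∂P ≤ ENNReal.ofReal C * ENNReal.ofReal η := by
  refine (mul_le_mul_right (Finset.sum_le_sum fun i hi =>
    lintegral_cutErr_le hs hA hmodel η C hi) _).trans ?_
  rw [← Finset.mul_sum, mul_left_comm]
  refine mul_le_mul_right ?_ _
  exact sum_setLIntegral_fold_le hs hA N l
    (fun i hi => (memLp_at_sub_a hrate hi).integrable_norm_pow (by norm_num))
    (fun i _ ω => by positivity) hη

theorem tendsto_aErr (hrate : RateAssumption P D A m β₀ μ₀ g) (l : Fin L) :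
    Tendsto (fun z : ℕ × Ω => aErr P D A m μ₀ l z.1 z.2) (wpa P) (𝓝 0) := by
  obtain ⟨ζ, h1, h2, h3, -⟩ := hrate.a_rate
  -- Here `g < 1` is used: `ζ ≥ 1 - g > 0`, so the assumed rate forces convergence to zero.
  have hζ : 0 < ζ := by linarith [hrate.g_upper]
  have h4 := (h3 l).tendsto_wpa (by
    filter_upwards [eventually_gt_atTop 0] with N hN
    have : (0 : ℝ) < N := by exact_mod_cast hN
    positivity)
  refine squeeze_zero_norm' ?_ h4
  filter_upwards [eventually_wpa_of_atTop (eventually_ge_atTop 1)] with z hz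
  have h5 : (z.1 : ℝ) ^ (-ζ) ≤ 1 := Real.rpow_le_one_of_one_le_of_nonpos
    (by exact_mod_cast hz) (by linarith)
  have h6 : 0 < (z.1 : ℝ) ^ (-ζ) := by
    have : (0 : ℝ) < z.1 := by exact_mod_cast hz
    positivity
  exact le_mul_of_one_le_left (norm_nonneg _) ((one_le_inv₀ h6).2 h5)

theorem eventually_cutErr_eq (hA : A.IsValid D m P Θ) (hrate : RateAssumption P D A m β₀ μ₀ g)
    {C : ℝ} (hC : WithProbApproachingOne P fun N ω => ∀ i < N,
      (P[fun ω' => D.u β₀ i (A.T N) ω' ^ 2 | D.sigXYα (A.T N) i]) ω ≤ C)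
    {η : ℝ} (hη : 0 < η) (l : Fin L) :
    ∀ᶠ z in wpa P, ∀ i ∈ A.fold z.1 l, cutErr P D A m β₀ μ₀ η C l z.1 i z.2 =
      D.u β₀ i (A.T z.1) z.2 • (A.at_ D z.1 l i z.2 - D.a P m μ₀ (A.T z.1) i z.2) := by
  have h1 : ∀ᶠ z in wpa P, ∀ i < z.1,
      (P[fun ω' => D.u β₀ i (A.T z.1) ω' ^ 2 | D.sigXYα (A.T z.1) i]) z.2 ≤ C :=
    eventually_wpa.2 hC
  filter_upwards [h1, (tendsto_aErr hrate l).eventually_le_const hη] with z h2 h3 i hi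
  have h4 : i < z.1 := Finset.mem_range.1 (fold_subset_range hA _ _ hi)
  simp only [cutErr, Set.indicator]
  rw [if_pos ⟨h3, h2 i h4⟩]

/-- With probability approaching one the errors equal their truncated versions. These are
orthogonal, so the second moment of the normalized sum is the average second moment, which is at
most `C` times the cut-off level. -/
theorem tendsto_sum_weighted_errors (hs : Sampling P D) (hA : A.IsValid D m P Θ)
    (hmodel : ModelAssumption P D m β₀ μ₀) (hrate : RateAssumption P D A m β₀ μ₀ g)
    (hmom : MomentAssumption P D A m β₀ μ₀) (l : Fin L) :
    Tendsto (fun z : ℕ × Ω => (z.1 : ℝ)⁻¹ * ‖∑ i ∈ A.fold z.1 l,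
      D.u β₀ i (A.T z.1) z.2 • (A.at_ D z.1 l i z.2 - D.a P m μ₀ (A.T z.1) i z.2)‖ ^ 2)
      (wpa P) (𝓝 0) := by
  obtain ⟨C, hC⟩ := hmom.cond_var
  refine tendsto_wpa_of_lintegral_le fun η hη => ?_
  -- The second moment will be bounded by `C η'`, hence by `η`; the constant `C` is not known to be
  -- positive.
  set η' := η / (|C| + 1) with hη'
  have hη'0 : 0 < η' := by positivity
  have hmem := fun N i (hi : i ∈ A.fold N l) => memLp_cutErr hs hA hmodel hrate η' C hi
  refine ⟨fun N ω => ENNReal.ofReal ((N : ℝ)⁻¹) *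
    ‖∑ i ∈ A.fold N l, cutErr P D A m β₀ μ₀ η' C l N i ω‖ₑ ^ 2, fun N => ?_,
    Eventually.of_forall fun N => ?_, ?_⟩
  · exact ((memLp_finsetSum _ (hmem N)).aestronglyMeasurable.enorm.pow_const 2).const_mul _
  · rw [lintegral_const_mul' _ _ ENNReal.ofReal_ne_top, lintegral_norm_sum_sq_of_orthogonal _
      (hmem N) fun i hi j hj hij => integral_inner_cutErr hs hA hmodel hrate η' C hi hj hij]
    refine (lintegral_sum_cutErr_le hs hA hmodel hrate hη'0.le C N l).trans ?_
    rw [← ENNReal.ofReal_mul' hη'0.le]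
    refine ENNReal.ofReal_le_ofReal ?_
    rw [hη', mul_div_assoc', div_le_iff₀ (by positivity), mul_comm]
    gcongr
    linarith [le_abs_self C]
  · filter_upwards [eventually_cutErr_eq hA hrate hC hη'0 l] with z hz
    rw [← Finset.sum_congr rfl hz, enorm_mul, ← ofReal_norm, Real.norm_of_nonneg (by positivity)]
    simp

/-- Here the squares are summed directly, so the same moment bound suffices without orthogonality.
-/
theorem tendsto_sum_sq_weighted_errors (hs : Sampling P D) (hA : A.IsValid D m P Θ)
    (hmodel : ModelAssumption P D m β₀ μ₀) (hrate : RateAssumption P D A m β₀ μ₀ g)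
    (hmom : MomentAssumption P D A m β₀ μ₀) (l : Fin L) :
    Tendsto (fun z : ℕ × Ω => (z.1 : ℝ)⁻¹ * ∑ i ∈ A.fold z.1 l,
      ‖D.u β₀ i (A.T z.1) z.2 • (A.at_ D z.1 l i z.2 - D.a P m μ₀ (A.T z.1) i z.2)‖ ^ 2)
      (wpa P) (𝓝 0) := by
  obtain ⟨C, hC⟩ := hmom.cond_var
  refine tendsto_wpa_of_lintegral_le fun η hη => ?_
  set η' := η / (|C| + 1) with hη'
  have hη'0 : 0 < η' := by positivity
  have hmem := fun N i (hi : i ∈ A.fold N l) => memLp_cutErr hs hA hmodel hrate η' C hi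
  have hm : ∀ N, ∀ i ∈ A.fold N l,
      AEMeasurable (fun ω => ‖cutErr P D A m β₀ μ₀ η' C l N i ω‖ₑ ^ 2) P := fun N i hi =>
    (hmem N i hi).aestronglyMeasurable.enorm.pow_const 2
  refine ⟨fun N ω => ENNReal.ofReal ((N : ℝ)⁻¹) *
    ∑ i ∈ A.fold N l, ‖cutErr P D A m β₀ μ₀ η' C l N i ω‖ₑ ^ 2, fun N => ?_,
    Eventually.of_forall fun N => ?_, ?_⟩
  · exact (Finset.aemeasurable_fun_sum _ (hm N)).const_mul _
  · rw [lintegral_const_mul' _ _ ENNReal.ofReal_ne_top, lintegral_finsetSum' _ (hm N)]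
    refine (lintegral_sum_cutErr_le hs hA hmodel hrate hη'0.le C N l).trans ?_
    rw [← ENNReal.ofReal_mul' hη'0.le]
    refine ENNReal.ofReal_le_ofReal ?_
    rw [hη', mul_div_assoc', div_le_iff₀ (by positivity), mul_comm]
    gcongr
    linarith [le_abs_self C]
  · filter_upwards [eventually_cutErr_eq hA hrate hC hη'0 l] with z hz
    rw [Finset.sum_congr rfl fun i hi => congrArg (fun v => ‖v‖ ^ 2) (hz i hi).symm, enorm_mul,
      ← ofReal_norm,
      Real.norm_of_nonneg (by positivity)]
    gcongr
    refine (enorm_sum_le _ _).trans (le_of_eq ?_)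
    simp

end WeightedErrors

end OrthMoment

namespace OrthMoment

/-! ### Averages over a fold -/

section FoldAverages

variable {Ω : Type*} {p k q L : ℕ} {A : Procedure Ω p k q L} {l : Fin L}
  {f f' : ℕ → ℕ × Ω → ℝ} {z : ℕ × Ω}

/-- `N⁻¹ ∑_{i ∈ I_l} f i`. -/
noncomputable def foldAvg (A : Procedure Ω p k q L) (l : Fin L) (f : ℕ → ℕ × Ω → ℝ) (z : ℕ × Ω) : ℝ :=
  (z.1 : ℝ)⁻¹ * ∑ i ∈ A.fold z.1 l, f i z

theorem foldAvg_nonneg (hf : ∀ i, 0 ≤ f i z) : 0 ≤ foldAvg A l f z :=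
  mul_nonneg (by positivity) (Finset.sum_nonneg fun i _ => hf i)

theorem foldAvg_mono (h : ∀ i ∈ A.fold z.1 l, f i z ≤ f' i z) : foldAvg A l f z ≤ foldAvg A l f' z :=
  mul_le_mul_of_nonneg_left (Finset.sum_le_sum h) (by positivity)

theorem foldAvg_add : foldAvg A l (fun i z => f i z + f' i z) z =
    foldAvg A l f z + foldAvg A l f' z := by
  simp [foldAvg, Finset.sum_add_distrib, mul_add]

theorem foldAvg_const_mul (c : ℕ × Ω → ℝ) : foldAvg A l (fun i z => c z * f i z) z =
    c z * foldAvg A l f z := by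
  simp only [foldAvg, ← Finset.mul_sum]
  ring

theorem foldAvg_mul_le_sqrt :
    foldAvg A l (fun i z => f i z * f' i z) z ≤
      √(foldAvg A l (fun i z => f i z ^ 2) z) * √(foldAvg A l (fun i z => f' i z ^ 2) z) := by
  have h := Finset.sum_mul_sq_le_sq_mul_sq (A.fold z.1 l) (fun i => f i z) (fun i => f' i z)
  rw [← Real.sqrt_mul (foldAvg_nonneg fun i => sq_nonneg _)]
  refine Real.le_sqrt_of_sq_le ?_
  simp only [foldAvg]
  calc ((z.1 : ℝ)⁻¹ * ∑ i ∈ A.fold z.1 l, f i z * f' i z) ^ 2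
      = ((z.1 : ℝ)⁻¹) ^ 2 * (∑ i ∈ A.fold z.1 l, f i z * f' i z) ^ 2 := by ring
    _ ≤ ((z.1 : ℝ)⁻¹) ^ 2 * ((∑ i ∈ A.fold z.1 l, f i z ^ 2) * ∑ i ∈ A.fold z.1 l, f' i z ^ 2) := by
        gcongr
    _ = _ := by ring

/-- A sum of products is at most the product of the sums. The loss of a factor `N` is harmless when
the averages tend to zero fast enough, and no moments beyond those of the factors are required. -/
theorem foldAvg_mul_le (hf : ∀ i, 0 ≤ f i z) (hf' : ∀ i, 0 ≤ f' i z) :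
    foldAvg A l (fun i z => f i z * f' i z) z ≤
      z.1 * (foldAvg A l f z * foldAvg A l f' z) := by
  rcases Nat.eq_zero_or_pos z.1 with h | h
  · simp [foldAvg, h]
  have h0 : (0 : ℝ) < z.1 := by exact_mod_cast h
  have h1 : ∑ i ∈ A.fold z.1 l, f i z * f' i z ≤
      (∑ i ∈ A.fold z.1 l, f i z) * ∑ i ∈ A.fold z.1 l, f' i z := by
    rw [Finset.sum_mul]
    refine Finset.sum_le_sum fun i hi => ?_
    gcongr
    · exact hf i
    · exact Finset.single_le_sum (f := fun i => f' i z) (fun i _ => hf' i) hi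
  calc foldAvg A l (fun i z => f i z * f' i z) z
      ≤ (z.1 : ℝ)⁻¹ * ((∑ i ∈ A.fold z.1 l, f i z) * ∑ i ∈ A.fold z.1 l, f' i z) := by
        simp only [foldAvg]
        gcongr
    _ = _ := by
        simp only [foldAvg]
        field_simp

theorem le_foldAvg (hf : ∀ i, 0 ≤ f i z) {i : ℕ} (hi : i ∈ A.fold z.1 l) (hz : 0 < z.1) :
    f i z ≤ z.1 * foldAvg A l f z := by
  have h0 : (0 : ℝ) < z.1 := by exact_mod_cast hz
  simp only [foldAvg]
  rw [mul_inv_cancel_left₀ h0.ne']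
  exact Finset.single_le_sum (f := fun i => f i z) (fun i _ => hf i) hi

theorem norm_sum_le_foldAvg {E : Type*} [NormedAddCommGroup E] {v : ℕ → ℕ × Ω → E}
    (h : ∀ i ∈ A.fold z.1 l, ‖v i z‖ ≤ f i z) :
    (√(z.1 : ℝ))⁻¹ * ‖∑ i ∈ A.fold z.1 l, v i z‖ ≤ √(z.1 : ℝ) * foldAvg A l f z := by
  have h1 : ‖∑ i ∈ A.fold z.1 l, v i z‖ ≤ ∑ i ∈ A.fold z.1 l, f i z :=
    (norm_sum_le _ _).trans (Finset.sum_le_sum h)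
  rcases Nat.eq_zero_or_pos z.1 with h2 | h2
  · simp [h2]
  have h0 : 0 < √(z.1 : ℝ) := Real.sqrt_pos.2 (by exact_mod_cast h2)
  have h3 : (z.1 : ℝ) = √(z.1 : ℝ) * √(z.1 : ℝ) := (Real.mul_self_sqrt (by positivity)).symm
  have h4 : √(z.1 : ℝ) * foldAvg A l f z = (√(z.1 : ℝ))⁻¹ * ∑ i ∈ A.fold z.1 l, f i z := by
    simp only [foldAvg]
    rw [← mul_assoc]
    congr 1
    nth_rewrite 2 [h3]
    field_simp
  rw [h4]
  gcongr

variable [MeasurableSpace Ω] {P : Measure Ω} [IsProbabilityMeasure P] {d : ℕ} {D : Panel Ω d p}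
  {m : Vec d → ℝ → Vec k → Vec q} {β₀ : Vec p} {μ₀ : Vec k} {g : ℝ} {Θ : Set (Vec k)}

/-- `|I_l| ≤ N`, so dividing by `N` instead of the size of the fold can only decrease the average.
-/
theorem abs_foldAvg_le_foldMean (hA : A.IsValid D m P Θ) (hf : ∀ i, 0 ≤ f i z) :
    |foldAvg A l f z| ≤ ‖A.foldMean z.1 l fun i => f i z‖ := by
  rw [abs_of_nonneg (foldAvg_nonneg hf)]
  refine le_trans ?_ (le_abs_self _)
  simp only [foldAvg, Procedure.foldMean]
  rcases (A.fold z.1 l).eq_empty_or_nonempty with h | h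
  · simp [h]
  have h0 : (0 : ℝ) < (A.fold z.1 l).card := by exact_mod_cast h.card_pos
  refine mul_le_mul_of_nonneg_right ?_ (Finset.sum_nonneg fun i _ => hf i)
  exact inv_anti₀ h0 (by exact_mod_cast fold_card_le hA _ _)

theorem tight_foldAvg (hA : A.IsValid D m P Θ) {f : ℕ → ℕ → Ω → ℝ} {C : ℝ≥0∞} (hC : C ≠ ∞)
    (hf : ∀ N i, AEMeasurable (f N i) P) (h : ∀ N i, ∫⁻ ω, ‖f N i ω‖ₑ ∂P ≤ C) (l : Fin L) :
    Tight (wpa P) (foldAvg A l fun i z => f z.1 i z.2) := by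
  refine (tight_average (S := fun N => A.fold N l) hC (fun N => fold_subset_range hA N l) hf h).mono
    (Eventually.of_forall fun z => ?_)
  simp only [foldAvg]
  rw [abs_mul, abs_mul]
  exact mul_le_mul_of_nonneg_left ((Finset.abs_sum_le_sum_abs _ _).trans (le_abs_self _))
    (abs_nonneg _)

/-! ### Rates -/

theorem T_growth_bounds (hrate : RateAssumption P D A m β₀ μ₀ g) :
    ∃ c : ℝ, 0 < c ∧ ∀ᶠ N : ℕ in atTop, (N : ℝ) ^ g ≤ c * A.T N ∧ (A.T N : ℝ) ≤ c * (N : ℝ) ^ g := by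
  obtain ⟨h1, h2⟩ := hrate.T_growth
  obtain ⟨c₁, hc₁, h1⟩ := h1.exists_pos
  obtain ⟨c₂, hc₂, h2⟩ := h2.exists_pos
  refine ⟨max c₁ c₂, lt_max_of_lt_left hc₁, ?_⟩
  filter_upwards [h1.bound, h2.bound] with N h3 h4
  rw [Real.norm_of_nonneg (by positivity), Real.norm_of_nonneg (by positivity)] at h3 h4
  constructor
  · exact h4.trans (by gcongr; exact le_max_right _ _)
  · exact h3.trans (by gcongr; exact le_max_left _ _)

theorem eventually_T_pos (hA : A.IsValid D m P Θ) : ∀ᶠ N in atTop, (0 : ℝ) < (A.T N : ℝ)⁻¹ :=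
  Eventually.of_forall fun N => by
    have := hA.two_le_T N
    have : (0 : ℝ) < A.T N := by exact_mod_cast (by omega : 0 < A.T N)
    positivity

theorem tight_rpow_mul_foldAvg (hA : A.IsValid D m P Θ) (hrate : RateAssumption P D A m β₀ μ₀ g)
    {f : ℕ → ℕ × Ω → ℝ} (hf : ∀ i z, 0 ≤ f i z)
    (h : IsBigOp P (fun N ω => A.foldMean N l fun i => f i (N, ω)) fun N => (A.T N : ℝ)⁻¹) :
    Tight (wpa P) fun z => (z.1 : ℝ) ^ g * foldAvg A l f z := by
  obtain ⟨c, hc, hT⟩ := T_growth_bounds hrate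
  have h1 := (h.tight (eventually_T_pos hA)).const_mul c
  refine h1.mono ?_
  filter_upwards [eventually_wpa_of_atTop hT] with z hz
  have h2 := abs_foldAvg_le_foldMean (A := A) (l := l) (z := z) hA fun i => hf i z
  rw [inv_inv, abs_mul, abs_of_nonneg (show (0 : ℝ) ≤ (z.1 : ℝ) ^ g by positivity),
    abs_of_nonneg (show (0 : ℝ) ≤ c * ((A.T z.1 : ℝ) * ‖A.foldMean z.1 l fun i => f i (z.1, z.2)‖) by
      positivity), ← mul_assoc]
  exact mul_le_mul hz.1 h2 (abs_nonneg _) (by positivity)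

theorem tendsto_rpow_wpa {s : ℝ} (hs : s < 0) :
    Tendsto (fun z : ℕ × Ω => (z.1 : ℝ) ^ s) (wpa P) (𝓝 0) := by
  have h : Tendsto (fun N : ℕ => (N : ℝ) ^ s) atTop (𝓝 0) := by
    simpa [Function.comp_def] using
      (tendsto_rpow_neg_atTop (y := -s) (by linarith)).comp tendsto_natCast_atTop_atTop
  exact tendsto_wpa_of_atTop (f := fun N : ℕ => (N : ℝ) ^ s) h

theorem tendsto_rpow_mul {f : ℕ × Ω → ℝ} {s : ℝ} (hf : Tight (wpa P) fun z => (z.1 : ℝ) ^ g * f z)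
    (hs : s < g) : Tendsto (fun z => (z.1 : ℝ) ^ s * f z) (wpa P) (𝓝 0) := by
  refine (hf _ (tendsto_rpow_wpa (P := P) (sub_neg.2 hs))).congr' ?_
  filter_upwards [eventually_wpa_of_atTop (eventually_gt_atTop 0)] with z hz
  have h0 : (0 : ℝ) < z.1 := by exact_mod_cast hz
  rw [← mul_assoc, ← Real.rpow_add h0]
  congr 2
  ring

theorem tight_αhat (hA : A.IsValid D m P Θ) (hrate : RateAssumption P D A m β₀ μ₀ g)
    (halpha : FixedEffectAssumption P D A m β₀ μ₀ g) (l : Fin L) :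
    Tight (wpa P) fun z => (z.1 : ℝ) ^ g *
      foldAvg A l (fun i z => (A.αhat D z.1 l i z.2 - D.α i z.2) ^ 2) z :=
  tight_rpow_mul_foldAvg hA hrate (fun _ _ => sq_nonneg _) (halpha.αhat_rate l)

theorem tight_αt (hA : A.IsValid D m P Θ) (hrate : RateAssumption P D A m β₀ μ₀ g)
    (halpha : FixedEffectAssumption P D A m β₀ μ₀ g) (l : Fin L) :
    Tight (wpa P) fun z => (z.1 : ℝ) ^ g *
      foldAvg A l (fun i z => (A.αt D z.1 l i z.2 - D.α i z.2) ^ 2) z :=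
  tight_rpow_mul_foldAvg hA hrate (fun _ _ => sq_nonneg _) (halpha.αt_rate l)

/-- The mean square error is `O_p(N^{-g})`, and `g > 1/2`. -/
theorem tendsto_sqrt_mul_αhat (hA : A.IsValid D m P Θ) (hrate : RateAssumption P D A m β₀ μ₀ g)
    (halpha : FixedEffectAssumption P D A m β₀ μ₀ g) (l : Fin L) :
    Tendsto (fun z : ℕ × Ω => √(z.1 : ℝ) *
      foldAvg A l (fun i z => (A.αhat D z.1 l i z.2 - D.α i z.2) ^ 2) z) (wpa P) (𝓝 0) := by
  simp only [Real.sqrt_eq_rpow]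
  exact tendsto_rpow_mul (tight_αhat hA hrate halpha l) hrate.g_lower

theorem tendsto_foldAvg_αhat (hA : A.IsValid D m P Θ) (hrate : RateAssumption P D A m β₀ μ₀ g)
    (halpha : FixedEffectAssumption P D A m β₀ μ₀ g) (l : Fin L) :
    Tendsto (foldAvg A l fun i z => (A.αhat D z.1 l i z.2 - D.α i z.2) ^ 2) (wpa P) (𝓝 0) := by
  simpa using tendsto_rpow_mul (tight_αhat hA hrate halpha l)
    (show (0 : ℝ) < g by linarith [hrate.g_lower])

theorem tendsto_foldAvg_αt (hA : A.IsValid D m P Θ) (hrate : RateAssumption P D A m β₀ μ₀ g)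
    (halpha : FixedEffectAssumption P D A m β₀ μ₀ g) (l : Fin L) :
    Tendsto (foldAvg A l fun i z => (A.αt D z.1 l i z.2 - D.α i z.2) ^ 2) (wpa P) (𝓝 0) := by
  simpa using tendsto_rpow_mul (tight_αt hA hrate halpha l)
    (show (0 : ℝ) < g by linarith [hrate.g_lower])

/-- By `foldAvg_mul_le` the average of the fourth powers is at most `N` times the squared average of
the squares, that is, the square of a sequence already known to vanish. -/
theorem tendsto_foldAvg_αhat_fourth (hA : A.IsValid D m P Θ)
    (hrate : RateAssumption P D A m β₀ μ₀ g)
    (halpha : FixedEffectAssumption P D A m β₀ μ₀ g) (l : Fin L) :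
    Tendsto (foldAvg A l fun i z => (A.αhat D z.1 l i z.2 - D.α i z.2) ^ 4) (wpa P) (𝓝 0) := by
  have h := (tendsto_sqrt_mul_αhat hA hrate halpha l).pow 2
  rw [zero_pow two_ne_zero] at h
  refine squeeze_zero (fun z => foldAvg_nonneg fun i => by positivity) (fun z => ?_) h
  have h1 := foldAvg_mul_le (A := A) (l := l) (z := z)
    (f := fun i z => (A.αhat D z.1 l i z.2 - D.α i z.2) ^ 2)
    (f' := fun i z => (A.αhat D z.1 l i z.2 - D.α i z.2) ^ 2)
    (fun i => sq_nonneg _) (fun i => sq_nonneg _)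
  simp only [← pow_add, Nat.reduceAdd] at h1
  refine h1.trans (le_of_eq ?_)
  rw [mul_pow, Real.sq_sqrt (by positivity), sq]

/-- `‖ã_il - a_i‖²` averaged over the fold is of smaller order than `N^{g-1}`. -/
theorem tendsto_rpow_mul_at_sub_a (hA : A.IsValid D m P Θ)
    (hrate : RateAssumption P D A m β₀ μ₀ g) (l : Fin L) :
    Tendsto (fun z => (z.1 : ℝ) ^ (1 - g) *
      foldAvg A l (fun i z => ‖A.at_ D z.1 l i z.2 - D.a P m μ₀ (A.T z.1) i z.2‖ ^ 2) z)
      (wpa P) (𝓝 0) := by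
  obtain ⟨ζ, h1, h2, -, h3⟩ := hrate.a_rate
  have h4 := (h3 l).tendsto_wpa (by
    filter_upwards [eventually_gt_atTop 0] with N hN
    have : (0 : ℝ) < N := by exact_mod_cast hN
    positivity)
  refine squeeze_zero_norm' ?_ h4
  filter_upwards [eventually_wpa_of_atTop (eventually_ge_atTop 1)] with z hz
  have h5 : (1 : ℝ) ≤ z.1 := by exact_mod_cast hz
  rw [norm_mul, Real.norm_of_nonneg (show (0 : ℝ) ≤ (z.1 : ℝ) ^ (1 - g) by positivity),
    Real.rpow_neg (by positivity), inv_inv]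
  refine mul_le_mul (Real.rpow_le_rpow_of_exponent_le h5 h1) ?_ (norm_nonneg _) (by positivity)
  exact abs_foldAvg_le_foldMean (z := z) hA fun i => by positivity

theorem tendsto_foldAvg_at_sub_a (hA : A.IsValid D m P Θ)
    (hrate : RateAssumption P D A m β₀ μ₀ g) (l : Fin L) :
    Tendsto (foldAvg A l fun i z => ‖A.at_ D z.1 l i z.2 - D.a P m μ₀ (A.T z.1) i z.2‖ ^ 2)
      (wpa P) (𝓝 0) := by
  refine squeeze_zero' (Eventually.of_forall fun z => foldAvg_nonneg fun i => by positivity) ?_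
    (tendsto_rpow_mul_at_sub_a hA hrate l)
  filter_upwards [eventually_wpa_of_atTop (eventually_ge_atTop 1)] with z hz
  have h5 : (1 : ℝ) ≤ z.1 := by exact_mod_cast hz
  exact le_mul_of_one_le_left (foldAvg_nonneg fun i => by positivity)
    (Real.one_le_rpow h5 (by linarith [hrate.g_upper]))

/-- Split `N = N^g N^{1-g}`: the first factor keeps the error of `α̂` bounded, the second still lets
that of `ã` vanish. -/
theorem tendsto_mul_αhat_mul_at_sub_a (hA : A.IsValid D m P Θ)
    (hrate : RateAssumption P D A m β₀ μ₀ g)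
    (halpha : FixedEffectAssumption P D A m β₀ μ₀ g) (l : Fin L) :
    Tendsto (fun z : ℕ × Ω => (z.1 : ℝ) *
      (foldAvg A l (fun i z => (A.αhat D z.1 l i z.2 - D.α i z.2) ^ 2) z *
      foldAvg A l (fun i z => ‖A.at_ D z.1 l i z.2 - D.a P m μ₀ (A.T z.1) i z.2‖ ^ 2) z))
      (wpa P) (𝓝 0) := by
  refine (tight_αhat hA hrate halpha l _ (tendsto_rpow_mul_at_sub_a hA hrate l)).congr' ?_
  filter_upwards [eventually_wpa_of_atTop (eventually_gt_atTop 0)] with z hz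
  have h0 : (0 : ℝ) < z.1 := by exact_mod_cast hz
  have h1 : (z.1 : ℝ) = (z.1 : ℝ) ^ (1 - g) * (z.1 : ℝ) ^ g := by
    rw [← Real.rpow_add h0]; simp
  conv_rhs => rw [h1]
  ring

theorem tendsto_T_atTop (hrate : RateAssumption P D A m β₀ μ₀ g) :
    Tendsto (fun N => (A.T N : ℝ)) atTop atTop := by
  obtain ⟨c, hc, hT⟩ := T_growth_bounds hrate
  have h1 : Tendsto (fun N : ℕ => c⁻¹ * (N : ℝ) ^ g) atTop atTop :=
    ((tendsto_rpow_atTop (by linarith [hrate.g_lower])).comp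
      tendsto_natCast_atTop_atTop).const_mul_atTop (by positivity)
  refine tendsto_atTop_mono' _ ?_ h1
  filter_upwards [hT] with N hN
  rw [inv_mul_le_iff₀ hc]
  exact hN.1

/-- The first stage pools `N T` observations, which leaves a spare factor `T^{-1/2}`. -/
theorem tendsto_sqrt_mul_βt (hA : A.IsValid D m P Θ) (hrate : RateAssumption P D A m β₀ μ₀ g)
    (l : Fin L) :
    Tendsto (fun z : ℕ × Ω => √(z.1 : ℝ) * ‖A.βt z.1 l z.2 - β₀‖) (wpa P) (𝓝 0) := by
  have h0 : ∀ᶠ N : ℕ in atTop, 0 < (√((N : ℝ) * A.T N))⁻¹ := by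
    filter_upwards [eventually_gt_atTop 0] with N hN
    have := hA.two_le_T N
    have h1 : (0 : ℝ) < N := by exact_mod_cast hN
    have h2 : (0 : ℝ) < A.T N := by exact_mod_cast (by omega : 0 < A.T N)
    positivity
  have hTi : Tendsto (fun N => (√(A.T N : ℝ))⁻¹) atTop (𝓝 0) :=
    (Real.tendsto_sqrt_atTop.comp (tendsto_T_atTop hrate)).inv_tendsto_atTop
  refine ((hrate.βt_rate l).tight h0 _ (tendsto_wpa_of_atTop hTi)).congr fun z => ?_
  have := hA.two_le_T z.1
  have h2 : (0 : ℝ) < A.T z.1 := by exact_mod_cast (by omega : 0 < A.T z.1)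
  beta_reduce
  rw [inv_inv, Real.sqrt_mul (by positivity)]
  have h3 : 0 < √(A.T z.1 : ℝ) := Real.sqrt_pos.2 h2
  field_simp

theorem tight_foldAvg_norm_pow {E : Type*} [NormedAddCommGroup E] (hA : A.IsValid D m P Θ)
    {f : ℕ → ℕ → Ω → E} (n : ℕ)
    (hf : ∀ N i, AEStronglyMeasurable (f N i) P)
    (h : ∃ C : ℝ≥0∞, C ≠ ∞ ∧ ∀ N i, ∫⁻ ω, ‖f N i ω‖ₑ ^ n ∂P ≤ C) (l : Fin L) :
    Tight (wpa P) (foldAvg A l fun i z => ‖f z.1 i z.2‖ ^ n) := by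
  obtain ⟨C, hC, h⟩ := h
  refine tight_foldAvg (f := fun N i ω => ‖f N i ω‖ ^ n) hA hC
    (fun N i => (hf N i).norm.aemeasurable.pow_const n) (fun N i => ?_) l
  simpa using h N i

theorem tight_foldAvg_a (hs : Sampling P D) (hA : A.IsValid D m P Θ)
    (hmodel : ModelAssumption P D m β₀ μ₀) (hrate : RateAssumption P D A m β₀ μ₀ g)
    (hmom : MomentAssumption P D A m β₀ μ₀) (l : Fin L) :
    Tight (wpa P) (foldAvg A l fun i z => ‖D.a P m μ₀ (A.T z.1) i z.2‖ ^ 2) := by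
  obtain ⟨C, hC, h⟩ := exists_lintegral_a_le hs hmodel hrate hmom
  exact tight_foldAvg_norm_pow (f := fun N i => D.a P m μ₀ (A.T N) i) hA 2
    (fun N i => integrable_condExp.aestronglyMeasurable) ⟨C, hC, fun N i => h _ i⟩ l

theorem tight_foldAvg_e_sq (hs : Sampling P D) (hA : A.IsValid D m P Θ)
    (hmodel : ModelAssumption P D m β₀ μ₀) (hrate : RateAssumption P D A m β₀ μ₀ g)
    (hmom : MomentAssumption P D A m β₀ μ₀) (l : Fin L) :
    Tight (wpa P) (foldAvg A l fun i z => ‖D.e P m μ₀ (A.T z.1) i z.2‖ ^ 2) :=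
  tight_foldAvg_norm_pow (f := fun N i => D.e P m μ₀ (A.T N) i) hA 2
    (fun _ i => aestronglyMeasurable_e hrate _ i) (exists_lintegral_e_sq_le hs hmodel hrate hmom) l

theorem tight_foldAvg_e_fourth (hs : Sampling P D) (hA : A.IsValid D m P Θ)
    (hmodel : ModelAssumption P D m β₀ μ₀) (hrate : RateAssumption P D A m β₀ μ₀ g)
    (hmom : MomentAssumption P D A m β₀ μ₀) (l : Fin L) :
    Tight (wpa P) (foldAvg A l fun i z => ‖D.e P m μ₀ (A.T z.1) i z.2‖ ^ 4) :=
  tight_foldAvg_norm_pow (f := fun N i => D.e P m μ₀ (A.T N) i) hA 4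
    (fun _ i => aestronglyMeasurable_e hrate _ i) (exists_lintegral_e_le hs hmodel hrate hmom) l

theorem tight_foldAvg_X (hs : Sampling P D) (hA : A.IsValid D m P Θ)
    (hmom : MomentAssumption P D A m β₀ μ₀) (l : Fin L) :
    Tight (wpa P) (foldAvg A l fun i z => ‖D.X i (A.T z.1) z.2‖ ^ 2) := by
  obtain ⟨C, h⟩ := hmom.X_sq
  exact tight_foldAvg_norm_pow (f := fun N i => D.X i (A.T N)) hA 2
    (fun N i => (hs.meas_X i _).aestronglyMeasurable)
    ⟨C, by simp, fun N i => h i _ (one_le_two.trans (hA.two_le_T N))⟩ l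

theorem tight_foldAvg_Xbar (hs : Sampling P D) (hA : A.IsValid D m P Θ)
    (hmom : MomentAssumption P D A m β₀ μ₀) (l : Fin L) :
    Tight (wpa P) (foldAvg A l fun i z => ‖D.Xbar (A.T z.1) i z.2‖ ^ 2) := by
  obtain ⟨C, hC, h⟩ := exists_lintegral_Xbar_le hs hmom
  exact tight_foldAvg_norm_pow (f := fun N i => D.Xbar (A.T N) i) hA 2
    (fun N i => (measurable_Xbar fun t _ => hs.meas_X i t).aestronglyMeasurable)
    ⟨C, hC, fun N i => h _ (hA.two_le_T N) i⟩ l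

theorem tight_foldAvg_at (hs : Sampling P D) (hA : A.IsValid D m P Θ)
    (hmodel : ModelAssumption P D m β₀ μ₀) (hrate : RateAssumption P D A m β₀ μ₀ g)
    (hmom : MomentAssumption P D A m β₀ μ₀) (l : Fin L) :
    Tight (wpa P) (foldAvg A l fun i z => ‖A.at_ D z.1 l i z.2‖ ^ 2) := by
  have h1 := (Tight.of_tendsto (tendsto_foldAvg_at_sub_a hA hrate l)).add
    (tight_foldAvg_a hs hA hmodel hrate hmom l)
  refine (h1.const_mul 2).mono (Eventually.of_forall fun z => ?_)
  rw [abs_of_nonneg (foldAvg_nonneg fun i => by positivity)]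
  refine le_trans ?_ (le_abs_self _)
  rw [← foldAvg_add, ← foldAvg_const_mul (c := fun _ => 2)]
  refine foldAvg_mono fun i _ => ?_
  have h2 : A.at_ D z.1 l i z.2 = (A.at_ D z.1 l i z.2 - D.a P m μ₀ (A.T z.1) i z.2) +
    D.a P m μ₀ (A.T z.1) i z.2 := by abel
  calc ‖A.at_ D z.1 l i z.2‖ ^ 2 ≤ (‖A.at_ D z.1 l i z.2 - D.a P m μ₀ (A.T z.1) i z.2‖ +
        ‖D.a P m μ₀ (A.T z.1) i z.2‖) ^ 2 := by
        gcongr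
        conv_lhs => rw [h2]
        exact norm_add_le _ _
    _ ≤ _ := add_sq_le

end FoldAverages

end OrthMoment

namespace OrthMoment

/-! ### The estimation error of the fixed effects against the residual `e_i` -/

section FixedEffectErrors

variable {Ω : Type*} [MeasurableSpace Ω] {P : Measure Ω} [IsProbabilityMeasure P]
  {d p k q L : ℕ} {D : Panel Ω d p} {A : Procedure Ω p k q L}
  {m : Vec d → ℝ → Vec k → Vec q} {β₀ : Vec p} {μ₀ : Vec k} {g : ℝ} {Θ : Set (Vec k)}

/-- Averaging the regression over `t < T` returns `α_i` exactly, since there are `T - 1 ≠ 0` such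
periods. -/
theorem αt_sub_α (hA : A.IsValid D m P Θ) (β₀ : Vec p) (N : ℕ) (l : Fin L) (i : ℕ) (ω : Ω) :
    A.αt D N l i ω - D.α i ω = D.ubar β₀ (A.T N) i ω -
      inner ℝ (D.Xbar (A.T N) i ω) (A.βt N l ω - β₀) := by
  have h2 := hA.two_le_T N
  have hT : ((A.T N : ℝ) - 1) ≠ 0 := by
    have : (2 : ℝ) ≤ A.T N := by exact_mod_cast h2
    linarith
  have hu : D.ubar β₀ (A.T N) i ω = D.Ybar (A.T N) i ω - inner ℝ (D.Xbar (A.T N) i ω) β₀ -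
      D.α i ω := by
    simp only [Panel.ubar, Panel.Ybar, Panel.Xbar, Panel.u, Finset.sum_sub_distrib,
      Finset.sum_const, Nat.card_Icc, inner_smul_left, sum_inner, mul_sub, nsmul_eq_mul]
    rw [show A.T N - 1 + 1 - 1 = A.T N - 1 by omega, Nat.cast_sub (by omega), Nat.cast_one,
      inv_mul_cancel_left₀ hT]
    simp
  rw [hu, inner_sub_right, Procedure.αt]
  ring

theorem integral_inner_eq_zero_of_indepFun {v w : Ω → Vec q} (h : IndepFun v w P)
    (hv : MemLp v 2 P) (hw : MemLp w 2 P) (h0 : ∫ ω, v ω ∂P = 0) :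
    ∫ ω, inner ℝ (v ω) (w ω) ∂P = 0 := by
  have hc : ∀ {v : Ω → Vec q}, MemLp v 2 P → ∀ r, MemLp (fun ω => v ω r) 2 P := fun h r =>
    (EuclideanSpace.proj r : Vec q →L[ℝ] ℝ).comp_memLp' h
  have hi : ∀ r, ∫ ω, v ω r ∂P = 0 := fun r => by
    have := (EuclideanSpace.proj r : Vec q →L[ℝ] ℝ).integral_comp_comm (hv.integrable one_le_two)
    simpa [h0] using this
  simp only [PiLp.inner_apply]
  rw [integral_finsetSum]
  · refine Finset.sum_eq_zero fun r _ => ?_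
    have h1 : IndepFun (fun ω => v ω r) (fun ω => w ω r) P :=
      h.comp (φ := fun x : Vec q => x r) (ψ := fun x : Vec q => x r) (by fun_prop) (by fun_prop)
    have h2 := h1.integral_mul_eq_mul_integral (hc hv r).1 (hc hw r).1
    simp only [Pi.mul_apply] at h2
    simp only [RCLike.inner_apply, conj_trivial]
    simp_rw [mul_comm (w _ r)]
    rw [show (∫ ω, v ω r * w ω r ∂P) = _ from h2, hi r, zero_mul]
  · intro r _
    simp only [RCLike.inner_apply, conj_trivial]
    exact (hc hw r).integrable_mul (hc hv r)

theorem ennreal_add_sq_le (x y : ℝ≥0∞) : (x + y) ^ 2 ≤ 2 * x ^ 2 + 2 * y ^ 2 := by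
  have h := ENNReal.rpow_add_le_mul_rpow_add_rpow x y (one_le_two (α := ℝ))
  norm_num [mul_add] at h
  exact_mod_cast h

/-- Chebyshev's inequality. The centred summands are orthogonal with vanishing second moments, and
at most `N` copies of the mean add up to `√N · o(N^{-1/2})` after normalization. -/
theorem tendsto_sqrt_inv_mul_norm_sum (hs : Sampling P D) {w : ℕ → ℕ → Ω → Vec q}
    {S : ℕ → Finset ℕ} (hS : ∀ N, S N ⊆ Finset.range N) (hw : ∀ N, IsDataFun P D (w N))
    (hsq : Tendsto (fun N => ∫⁻ ω, ‖w N 0 ω‖ₑ ^ 2 ∂P) atTop (𝓝 0))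
    (hmean : (fun N => ∫ ω, w N 0 ω ∂P) =o[atTop] fun N => ((N : ℝ) ^ (-(1 / 2) : ℝ))) :
    Tendsto (fun z : ℕ × Ω => (√(z.1 : ℝ))⁻¹ * ‖∑ i ∈ S z.1, w z.1 i z.2‖) (wpa P) (𝓝 0) := by
  set c : ℕ → Vec q := fun N => ∫ ω, w N 0 ω ∂P
  set v : ℕ → ℕ → Ω → Vec q := fun N i ω => w N i ω - c N
  have hv : ∀ N, IsDataFun P D (v N) := fun N => (hw N).comp (c := fun x => x - c N) (by fun_prop)
  have hvm : ∀ N i, AEStronglyMeasurable (v N i) P := fun N i =>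
    ((hv N).aemeasurable hs i).aestronglyMeasurable
  have hc : Tendsto (fun N : ℕ => √(N : ℝ) * ‖c N‖) atTop (𝓝 0) := by
    have h1 := hmean.norm_left.tendsto_div_nhds_zero
    refine h1.congr' ?_
    filter_upwards [eventually_gt_atTop 0] with N hN
    rw [Real.rpow_neg (by positivity), Real.sqrt_eq_rpow, div_inv_eq_mul, mul_comm]
  have hc0 : Tendsto (fun N : ℕ => ‖c N‖) atTop (𝓝 0) := by
    refine squeeze_zero' (Eventually.of_forall fun _ => norm_nonneg _) ?_ hc
    filter_upwards [eventually_ge_atTop 1] with N hN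
    exact le_mul_of_one_le_left (norm_nonneg _) (Real.one_le_sqrt.2 (by exact_mod_cast hN))
  have hb : ∀ N i, ∫⁻ ω, ‖v N i ω‖ₑ ^ 2 ∂P ≤ 2 * ∫⁻ ω, ‖w N 0 ω‖ₑ ^ 2 ∂P + 2 * ‖c N‖ₑ ^ 2 := by
    intro N i
    rw [((hv N).comp (c := fun x => ‖x‖ₑ ^ 2) (by fun_prop)).lintegral_eq hs i]
    calc ∫⁻ ω, ‖v N 0 ω‖ₑ ^ 2 ∂P ≤ ∫⁻ ω, (2 * ‖w N 0 ω‖ₑ ^ 2 + 2 * ‖c N‖ₑ ^ 2) ∂P := by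
          refine lintegral_mono fun ω => ?_
          have h1 : ‖v N 0 ω‖ₑ ^ 2 ≤ (‖w N 0 ω‖ₑ + ‖c N‖ₑ) ^ 2 := by
            gcongr; exact enorm_sub_le
          refine h1.trans ?_
          exact ennreal_add_sq_le _ _
      _ = _ := by
          rw [lintegral_add_right _ measurable_const, lintegral_const_mul' _ _ (by simp)]
          simp
  have hb0 : Tendsto (fun N => 2 * ∫⁻ ω, ‖w N 0 ω‖ₑ ^ 2 ∂P + 2 * ‖c N‖ₑ ^ 2) atTop (𝓝 0) := by
    have h1 : Tendsto (fun N => ‖c N‖ₑ) atTop (𝓝 0) := by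
      have := tendsto_zero_iff_norm_tendsto_zero.2 hc0
      simpa using this.enorm
    have h2 := (ENNReal.Tendsto.const_mul hsq (Or.inr (by simp : (2 : ℝ≥0∞) ≠ ∞))).add
      (ENNReal.Tendsto.const_mul (ENNReal.Tendsto.pow (n := 2) h1) (Or.inr (by simp : (2 : ℝ≥0∞) ≠ ∞)))
    simpa using h2
  have hmem : ∀ᶠ N in atTop, ∀ i, MemLp (v N i) 2 P := by
    filter_upwards [hb0.eventually (gt_mem_nhds zero_lt_one)] with N hN i
    refine ⟨hvm N i, ?_⟩
    have h1 := lintegral_enorm_pow_eq (P := P) (v N i) two_ne_zero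
    have h2 : eLpNorm (v N i) (2 : ℕ) P ^ 2 < ∞ := by
      rw [← h1]; exact ((hb N i).trans_lt hN).trans ENNReal.one_lt_top
    simpa using h2
  have hsum : Tendsto (fun z : ℕ × Ω => (z.1 : ℝ)⁻¹ * ‖∑ i ∈ S z.1, v z.1 i z.2‖ ^ 2) (wpa P)
      (𝓝 0) := by
    refine tendsto_wpa_of_lintegral (f := fun N ω => (N : ℝ)⁻¹ * ‖∑ i ∈ S N, v N i ω‖ ^ 2)
      (fun N => ?_) ?_
    · exact ((Finset.aestronglyMeasurable_fun_sum _ fun i _ => hvm N i).norm.aemeasurable.pow_const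
        2).const_mul _
    · refine tendsto_of_tendsto_of_tendsto_of_le_of_le' tendsto_const_nhds hb0
        (Eventually.of_forall fun _ => zero_le) ?_
      filter_upwards [hmem, eventually_gt_atTop 0] with N hN h0
      have hint : ∀ i, Integrable (w N i) P := fun i => by
        have := ((hN i).integrable one_le_two).add (integrable_const (c N))
        refine this.congr (Eventually.of_forall fun ω => ?_)
        simp [v]
      have hzero : ∀ i, ∫ ω, v N i ω ∂P = 0 := fun i => by
        rw [((hv N).identDistrib hs i).integral_eq]
        simp only [v]
        rw [integral_sub (hint 0) (integrable_const _)]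
        simp [c]
      have h1 := lintegral_norm_sum_sq_of_orthogonal (S N) (fun i _ => hN i)
        (fun i _ j _ hij => integral_inner_eq_zero_of_indepFun
          (((hv N).iIndepFun hs).indepFun hij) (hN i) (hN j) (hzero i))
      simp only [enorm_mul, enorm_pow, enorm_norm]
      rw [lintegral_const_mul' _ _ (by simp), h1]
      have h2 : ∑ i ∈ S N, ∫⁻ ω, ‖v N i ω‖ₑ ^ 2 ∂P ≤
          N * (2 * ∫⁻ ω, ‖w N 0 ω‖ₑ ^ 2 ∂P + 2 * ‖c N‖ₑ ^ 2) := by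
        refine (Finset.sum_le_sum fun i _ => hb N i).trans ?_
        rw [Finset.sum_const, nsmul_eq_mul]
        gcongr
        simpa using Finset.card_le_card (hS N)
      refine (mul_le_mul_right h2 _).trans ?_
      rw [← mul_assoc]
      refine mul_le_of_le_one_left zero_le ?_
      have h3 : (0 : ℝ) < N := by exact_mod_cast h0
      rw [Real.enorm_of_nonneg (by positivity), ← ENNReal.ofReal_natCast,
        ← ENNReal.ofReal_mul (by positivity), inv_mul_cancel₀ h3.ne']
      simp
  have h5 := (Real.continuous_sqrt.tendsto 0).comp hsum
  rw [Real.sqrt_zero] at h5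
  have h6 := h5.add (tendsto_wpa_of_atTop (P := P) hc)
  rw [add_zero] at h6
  refine squeeze_zero (fun z => by positivity) (fun z => ?_) h6
  have h7 : ∑ i ∈ S z.1, w z.1 i z.2 = ∑ i ∈ S z.1, v z.1 i z.2 + ((S z.1).card : ℝ) • c z.1 := by
    simp [v, Finset.sum_sub_distrib, ← Nat.cast_smul_eq_nsmul ℝ]
  have h8 : ((S z.1).card : ℝ) ≤ z.1 := by
    exact_mod_cast (by simpa using Finset.card_le_card (hS z.1) : (S z.1).card ≤ z.1)
  have h9 : (√(z.1 : ℝ))⁻¹ * z.1 = √(z.1 : ℝ) := by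
    rw [inv_mul_eq_div, Real.div_sqrt]
  simp only [Function.comp]
  rw [h7, Real.sqrt_mul (by positivity), Real.sqrt_inv, Real.sqrt_sq (norm_nonneg _)]
  calc (√(z.1 : ℝ))⁻¹ * ‖∑ i ∈ S z.1, v z.1 i z.2 + ((S z.1).card : ℝ) • c z.1‖
      ≤ (√(z.1 : ℝ))⁻¹ * (‖∑ i ∈ S z.1, v z.1 i z.2‖ + z.1 * ‖c z.1‖) := by
        gcongr
        refine (norm_add_le _ _).trans ?_
        rw [norm_smul, Real.norm_of_nonneg (by positivity)]
        gcongr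
    _ = _ := by rw [mul_add, ← mul_assoc, h9]

/-- The part with `ū_i` is a sum of i.i.d. variables covered by `tendsto_sqrt_inv_mul_norm_sum`. In
the part with `β̃ - β₀` the estimation error is common to the fold and factors out. -/
theorem tendsto_sum_αt_smul_e (hs : Sampling P D) (hA : A.IsValid D m P Θ)
    (hmodel : ModelAssumption P D m β₀ μ₀) (hrate : RateAssumption P D A m β₀ μ₀ g)
    (halpha : FixedEffectAssumption P D A m β₀ μ₀ g) (hmom : MomentAssumption P D A m β₀ μ₀)
    (l : Fin L) :
    Tendsto (fun z : ℕ × Ω => (√(z.1 : ℝ))⁻¹ * ‖∑ i ∈ A.fold z.1 l,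
      (A.αt D z.1 l i z.2 - D.α i z.2) • D.e P m μ₀ (A.T z.1) i z.2‖) (wpa P) (𝓝 0) := by
  have h1 := tendsto_sqrt_inv_mul_norm_sum hs (S := fun N => A.fold N l)
    (w := fun N i ω => D.ubar β₀ (A.T N) i ω • D.e P m μ₀ (A.T N) i ω)
    (fun N => fold_subset_range hA N l)
    (fun N => ((isDataFun_ubar _).prodMk (isDataFun_e hs hmodel hrate hmom _)).comp
      (c := fun x : ℝ × Vec q => x.1 • x.2) (by fun_prop)) (halpha.eu_sq 0) (halpha.eu_mean 0)
  have h2 := ((tight_foldAvg_Xbar hs hA hmom l).sqrt.mul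
    (tight_foldAvg_e_sq hs hA hmodel hrate hmom l).sqrt) _ (tendsto_sqrt_mul_βt hA hrate l)
  have h3 := h1.add h2
  rw [add_zero] at h3
  refine squeeze_zero (fun z => by positivity) (fun z => ?_) h3
  have h4 := norm_sum_le_foldAvg (A := A) (l := l) (z := z)
    (v := fun i z => (inner ℝ (D.Xbar (A.T z.1) i z.2) (A.βt z.1 l z.2 - β₀) : ℝ) •
      D.e P m μ₀ (A.T z.1) i z.2)
    (f := fun i z => ‖A.βt z.1 l z.2 - β₀‖ * (‖D.Xbar (A.T z.1) i z.2‖ *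
      ‖D.e P m μ₀ (A.T z.1) i z.2‖)) (fun i _ => by
        rw [norm_smul, ← mul_assoc]
        gcongr
        rw [mul_comm]
        exact norm_inner_le_norm _ _)
  rw [foldAvg_const_mul (fun z => ‖A.βt z.1 l z.2 - β₀‖), ← mul_assoc] at h4
  have h5 : ∑ i ∈ A.fold z.1 l, (A.αt D z.1 l i z.2 - D.α i z.2) • D.e P m μ₀ (A.T z.1) i z.2 =
      ∑ i ∈ A.fold z.1 l, D.ubar β₀ (A.T z.1) i z.2 • D.e P m μ₀ (A.T z.1) i z.2 -
      ∑ i ∈ A.fold z.1 l, (inner ℝ (D.Xbar (A.T z.1) i z.2) (A.βt z.1 l z.2 - β₀) : ℝ) •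
        D.e P m μ₀ (A.T z.1) i z.2 := by
    rw [← Finset.sum_sub_distrib]
    exact Finset.sum_congr rfl fun i _ => by rw [αt_sub_α hA β₀, sub_smul]
  rw [h5]
  refine (mul_le_mul_of_nonneg_left (norm_sub_le _ _) (by positivity)).trans ?_
  rw [mul_add]
  refine add_le_add le_rfl (h4.trans ?_)
  exact mul_le_mul_of_nonneg_left foldAvg_mul_le_sqrt (by positivity)

end FixedEffectErrors

end OrthMoment

namespace OrthMoment

/-! ### Shrinkage -/

section Shrinking

variable {Ω : Type*} [MeasurableSpace Ω] {P : Measure Ω} [IsProbabilityMeasure P]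
  {d p k q L : ℕ} {D : Panel Ω d p} {A : Procedure Ω p k q L}
  {m : Vec d → ℝ → Vec k → Vec q} {β₀ : Vec p} {μ₀ : Vec k} {g : ℝ} {Θ : Set (Vec k)}

theorem sum_sub_mean_sq (S : Finset ℕ) (x : ℕ → ℝ) :
    (S.card : ℝ)⁻¹ * ∑ i ∈ S, (x i - (S.card : ℝ)⁻¹ * ∑ j ∈ S, x j) ^ 2 =
      (S.card : ℝ)⁻¹ * ∑ i ∈ S, x i ^ 2 - ((S.card : ℝ)⁻¹ * ∑ j ∈ S, x j) ^ 2 := by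
  rcases S.eq_empty_or_nonempty with h | h
  · simp [h]
  have h0 : (S.card : ℝ) ≠ 0 := by exact_mod_cast h.card_pos.ne'
  simp only [sub_sq, Finset.sum_add_distrib, Finset.sum_sub_distrib, Finset.sum_const,
    nsmul_eq_mul, ← Finset.sum_mul, ← Finset.mul_sum]
  field_simp
  ring

/-- For nonempty `S` the two sides differ by the square of the mean minus `c`. -/
theorem sum_sub_mean_sq_le (S : Finset ℕ) (x : ℕ → ℝ) (c : ℝ) :
    (S.card : ℝ)⁻¹ * ∑ i ∈ S, x i ^ 2 - ((S.card : ℝ)⁻¹ * ∑ j ∈ S, x j) ^ 2 ≤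
      (S.card : ℝ)⁻¹ * ∑ i ∈ S, (x i - c) ^ 2 := by
  rcases S.eq_empty_or_nonempty with h | h
  · simp [h]
  have h0 : (S.card : ℝ) ≠ 0 := by exact_mod_cast h.card_pos.ne'
  have h1 : (S.card : ℝ)⁻¹ * ∑ i ∈ S, (x i - c) ^ 2 - ((S.card : ℝ)⁻¹ * ∑ i ∈ S, x i ^ 2 -
      ((S.card : ℝ)⁻¹ * ∑ j ∈ S, x j) ^ 2) = ((S.card : ℝ)⁻¹ * ∑ j ∈ S, x j - c) ^ 2 := by
    simp only [sub_sq, Finset.sum_add_distrib, Finset.sum_sub_distrib, Finset.sum_const,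
      nsmul_eq_mul, ← Finset.sum_mul, ← Finset.mul_sum]
    field_simp
    ring
  linarith [sq_nonneg ((S.card : ℝ)⁻¹ * ∑ j ∈ S, x j - c)]

theorem tendsto_fold_card (hA : A.IsValid D m P Θ) (l : Fin L) :
    Tendsto (fun N => (A.fold N l).card) atTop atTop :=
  tendsto_atTop_mono (fun N => hA.fold_card N l)
    (Nat.tendsto_div_const_atTop (by have := l.pos; omega))

theorem exists_tail_le {ξ : Ω → ℝ} (h : Integrable ξ P) (ε : ℝ) (hε : 0 < ε) :
    ∃ K : ℝ, 0 ≤ K ∧ ∫ ω in {ω | K < |ξ ω|}, |ξ ω| ∂P ≤ ε := by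
  have h1 : Tendsto (fun n : ℕ => ∫ ω in {ω | (n : ℝ) < |ξ ω|}, |ξ ω| ∂P) atTop (𝓝 0) := by
    have h2 : ∀ n : ℕ, NullMeasurableSet {ω | (n : ℝ) < |ξ ω|} P := fun n =>
      nullMeasurableSet_lt aemeasurable_const h.1.aemeasurable.abs
    have h3 : ∀ n : ℕ, ∫ ω in {ω | (n : ℝ) < |ξ ω|}, |ξ ω| ∂P =
        ∫ ω, {ω | (n : ℝ) < |ξ ω|}.indicator (fun ω => |ξ ω|) ω ∂P := fun n =>
      (integral_indicator₀ (h2 n)).symm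
    simp only [h3]
    rw [show (0 : ℝ) = ∫ _, (0 : ℝ) ∂P by simp]
    refine tendsto_integral_of_dominated_convergence (fun ω => |ξ ω|)
      (fun n => h.abs.1.indicator₀ (h2 n)) h.abs (fun n => Eventually.of_forall fun ω => ?_)
      (Eventually.of_forall fun ω => ?_)
    · exact (norm_indicator_le_norm_self _ _).trans (by simp)
    · refine tendsto_const_nhds.congr' ?_
      obtain ⟨n, hn⟩ := exists_nat_ge |ξ ω|
      filter_upwards [eventually_ge_atTop n] with j hj
      rw [Set.indicator_of_notMem]
      simp only [Set.mem_ofPred_eq, not_lt]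
      exact hn.trans (by exact_mod_cast hj)
  obtain ⟨n, hn⟩ := (h1.eventually (ge_mem_nhds hε)).exists
  exact ⟨n, by positivity, hn⟩

theorem tendsto_mean_of_isDataFun (hs : Sampling P D) {S : ℕ → Finset ℕ}
    (hS : Tendsto (fun N => (S N).card) atTop atTop) {f : ℕ → Ω → ℝ} (hf : IsDataFun P D f)
    (hint : Integrable (f 0) P) :
    Tendsto (fun z : ℕ × Ω => ((S z.1).card : ℝ)⁻¹ * ∑ i ∈ S z.1, f i z.2) (wpa P)
      (𝓝 (∫ ω, f 0 ω ∂P)) := by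
  have h := weak_law_array (ξ := fun _ => f) hS (fun _ => hint)
    (fun _ i j hij => (hf.iIndepFun hs).indepFun hij) (fun _ i => hf.identDistrib hs i)
    (fun ε hε => by
      obtain ⟨K, hK, h⟩ := exists_tail_le hint ε hε
      exact ⟨K, hK, fun _ => h⟩)
  simpa using h.add_const (∫ ω, f 0 ω ∂P)

/-- The largest variance estimate within a fold is of smaller order than `N^{-1/2}`. -/
theorem exists_uhatSq_bound (hs : Sampling P D) (hA : A.IsValid D m P Θ)
    (hrate : RateAssumption P D A m β₀ μ₀ g) (halpha : FixedEffectAssumption P D A m β₀ μ₀ g)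
    (hshr : A.shrink ≠ .none) (l : Fin L) :
    ∃ b : ℕ × Ω → ℝ, (∀ z, 0 ≤ b z) ∧ Tendsto (fun z : ℕ × Ω => √(z.1 : ℝ) * b z) (wpa P) (𝓝 0) ∧
      Tendsto b (wpa P) (𝓝 0) ∧
      ∀ᶠ z in wpa P, ∀ i ∈ A.fold z.1 l, |A.uhatSq D z.1 l i z.2| ≤ b z := by
  obtain ⟨δ, hδ, hg, hint, hbig⟩ := halpha.uhat_moment hshr
  set r : ℝ := 2 + δ
  have hr : 0 < r := by positivity
  set Q : ℕ × Ω → ℝ := foldAvg A l fun i z => |(A.T z.1 : ℝ) * A.uhatSq D z.1 l i z.2| ^ r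
  have hQ0 : ∀ z, 0 ≤ Q z := fun z => foldAvg_nonneg fun i => by positivity
  have hQ : Tight (wpa P) Q := tight_of_condExp hs hA l
    (f := fun N i ω => |(A.T N : ℝ) * A.uhatSq D N l i ω| ^ r) (fun N => hint N l)
    (fun N i _ ω => by positivity) (hbig l)
  -- As `r ≥ 1`, the root is bounded by `1 + Q`.
  have hQr : Tight (wpa P) fun z => Q z ^ r⁻¹ := by
    refine ((Tight.const 1).add hQ).mono (Eventually.of_forall fun z => ?_)
    rw [abs_of_nonneg (by have := hQ0 z; positivity),
      abs_of_nonneg (add_nonneg zero_le_one (hQ0 z))]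
    rcases le_total (Q z) 1 with h | h
    · exact (Real.rpow_le_one (hQ0 z) h (by positivity)).trans (by linarith [hQ0 z])
    · have : Q z ^ r⁻¹ ≤ Q z ^ (1 : ℝ) :=
        Real.rpow_le_rpow_of_exponent_le h (inv_le_one_of_one_le₀ (by simp only [r]; linarith))
      rw [Real.rpow_one] at this
      linarith
  have hT0 : ∀ N, (0 : ℝ) < A.T N := fun N => by
    have := hA.two_le_T N
    exact_mod_cast (by omega : 0 < A.T N)
  -- Each nonnegative term of a sum is at most the sum, so the largest `|T û²|` is at most `(N
  -- Q)^{1/r}`. Times `√N` the bound has order `N^{1/2 + 1/r - g}`, which vanishes by the condition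
  -- linking `g` and `δ`.
  set b : ℕ × Ω → ℝ := fun z => (A.T z.1 : ℝ)⁻¹ * ((z.1 : ℝ) ^ r⁻¹ * Q z ^ r⁻¹)
  have hb0 : ∀ z, 0 ≤ b z := fun z => by have := hQ0 z; positivity
  have hb : Tendsto (fun z : ℕ × Ω => √(z.1 : ℝ) * b z) (wpa P) (𝓝 0) := by
    obtain ⟨c, hc, hT⟩ := T_growth_bounds hrate
    have h1 : Tendsto (fun z : ℕ × Ω => c * (z.1 : ℝ) ^ (1 / 2 + 1 / r - g)) (wpa P) (𝓝 0) := by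
      simpa using (tendsto_rpow_wpa (P := P) (s := 1 / 2 + 1 / r - g) (by linarith)).const_mul c
    refine squeeze_zero' (Eventually.of_forall fun z => mul_nonneg (by positivity) (hb0 z)) ?_
      (hQr _ h1)
    filter_upwards [eventually_wpa_of_atTop hT,
      eventually_wpa_of_atTop (eventually_gt_atTop 0)] with z hz hz0
    have h0 : (0 : ℝ) < z.1 := by exact_mod_cast hz0
    have h2 : (A.T z.1 : ℝ)⁻¹ ≤ c * (z.1 : ℝ) ^ (-g) := by
      rw [Real.rpow_neg h0.le, ← div_eq_mul_inv, inv_le_comm₀ (hT0 _) (by positivity), inv_div,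
        div_le_iff₀ hc]
      linarith [hz.1]
    have h3 : (z.1 : ℝ) ^ (1 / 2 + 1 / r - g) =
        √(z.1 : ℝ) * ((z.1 : ℝ) ^ (-g) * (z.1 : ℝ) ^ r⁻¹) := by
      rw [Real.sqrt_eq_rpow, ← Real.rpow_add h0, ← Real.rpow_add h0, one_div r]
      congr 1; ring
    have h4 := hQ0 z
    rw [h3]
    simp only [b]
    calc √(z.1 : ℝ) * ((A.T z.1 : ℝ)⁻¹ * ((z.1 : ℝ) ^ r⁻¹ * Q z ^ r⁻¹))
        ≤ √(z.1 : ℝ) * ((c * (z.1 : ℝ) ^ (-g)) * ((z.1 : ℝ) ^ r⁻¹ * Q z ^ r⁻¹)) := by gcongr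
      _ = _ := by ring
  refine ⟨b, hb0, hb, ?_, ?_⟩
  · refine squeeze_zero' (Eventually.of_forall hb0) ?_ hb
    filter_upwards [eventually_wpa_of_atTop (eventually_ge_atTop 1)] with z hz
    exact le_mul_of_one_le_left (hb0 z) (Real.one_le_sqrt.2 (by exact_mod_cast hz))
  · filter_upwards [eventually_wpa_of_atTop (eventually_gt_atTop 0)] with z hz i hi
    have h1 := le_foldAvg (A := A) (l := l) (z := z)
      (f := fun i z => |(A.T z.1 : ℝ) * A.uhatSq D z.1 l i z.2| ^ r) (fun i => by positivity) hi hz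
    have h2 := Real.rpow_le_rpow (by positivity) h1 (inv_nonneg.2 hr.le)
    rw [← Real.rpow_mul (abs_nonneg _), mul_inv_cancel₀ hr.ne', Real.rpow_one,
      Real.mul_rpow (by positivity) (hQ0 z), abs_mul, abs_of_pos (hT0 _)] at h2
    simp only [b]
    rw [le_inv_mul_iff₀ (hT0 _)]
    exact h2

/-- The sample variance of the `α_i` tends to the positive number `v`. Replacing `α_i` by `α̃_i`
costs at most a factor two and a vanishing mean square error, and the subtracted variance estimates
vanish uniformly. The lower bound tends to `v/2`, so `v/4` is safe. -/
theorem exists_le_ebVar (hs : Sampling P D) (hA : A.IsValid D m P Θ)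
    (hrate : RateAssumption P D A m β₀ μ₀ g) (halpha : FixedEffectAssumption P D A m β₀ μ₀ g)
    (hshr : A.shrink ≠ .none) (l : Fin L) :
    ∃ c : ℝ, 0 < c ∧ ∀ᶠ z in wpa P, c ≤ A.ebVar D z.1 l z.2 := by
  obtain ⟨b, hb0, -, hb, hbV⟩ := exists_uhatSq_bound hs hA hrate halpha hshr l
  obtain ⟨hmem, hvar⟩ := halpha.α_var hshr 0
  rw [variance_eq_sub hmem] at hvar
  set v : ℝ := P[D.α 0 ^ 2] - P[D.α 0] ^ 2 with hv
  have hcard := tendsto_fold_card hA l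
  have h1 := tendsto_mean_of_isDataFun hs hcard isDataFun_α (hmem.integrable one_le_two)
  have h2 := tendsto_mean_of_isDataFun hs hcard
    (isDataFun_α.comp (P := P) (D := D) (c := fun x : ℝ => x ^ 2) (by fun_prop)) hmem.integrable_sq
  have h3 : Tendsto (fun z : ℕ × Ω =>
      ((A.fold z.1 l).card : ℝ)⁻¹ * ∑ i ∈ A.fold z.1 l, (A.αt D z.1 l i z.2 - D.α i z.2) ^ 2)
      (wpa P) (𝓝 0) := by
    have hT0 : ∀ N, (0 : ℝ) < A.T N := fun N => by
      have := hA.two_le_T N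
      exact_mod_cast (by omega : 0 < A.T N)
    have h4 := (halpha.αt_rate l).tight (Eventually.of_forall fun N => inv_pos.2 (hT0 N)) _
      (tendsto_wpa_of_atTop (tendsto_T_atTop hrate).inv_tendsto_atTop)
    refine h4.congr fun z => ?_
    simp only [Pi.inv_apply, inv_inv]
    rw [inv_mul_cancel_left₀ (hT0 _).ne', Real.norm_of_nonneg]
    · rfl
    · exact mul_nonneg (by positivity) (Finset.sum_nonneg fun i _ => sq_nonneg _)
  have h5 := (((h2.sub (h1.pow 2)).div_const 2).sub h3).sub (hb.const_mul 2)
  simp only [mul_zero, sub_zero] at h5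
  have h6 : (∫ ω, D.α 0 ω ^ 2 ∂P - (∫ ω, D.α 0 ω ∂P) ^ 2) / 2 = v / 2 := rfl
  rw [h6] at h5
  refine ⟨v / 4, by positivity, ?_⟩
  filter_upwards [h5.eventually (lt_mem_nhds (show v / 4 < v / 2 by linarith)), hbV,
    eventually_wpa_of_atTop (hcard.eventually_ge_atTop 2)] with z hz hV hn
  set n : ℝ := ((A.fold z.1 l).card : ℝ) with hn'
  have hn2 : 2 ≤ n := by rw [hn']; exact_mod_cast hn
  set a := A.αbar D z.1 l z.2
  have h7 := sum_sub_mean_sq_le (A.fold z.1 l) (fun i => D.α i z.2) a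
  have h8 : n⁻¹ * ∑ i ∈ A.fold z.1 l, (D.α i z.2 - a) ^ 2 ≤
      2 * (n⁻¹ * ∑ i ∈ A.fold z.1 l, (A.αt D z.1 l i z.2 - a) ^ 2) +
      2 * (n⁻¹ * ∑ i ∈ A.fold z.1 l, (A.αt D z.1 l i z.2 - D.α i z.2) ^ 2) := by
    have : ∑ i ∈ A.fold z.1 l, (D.α i z.2 - a) ^ 2 ≤
        ∑ i ∈ A.fold z.1 l, (2 * (A.αt D z.1 l i z.2 - a) ^ 2 +
          2 * (A.αt D z.1 l i z.2 - D.α i z.2) ^ 2) := by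
      refine Finset.sum_le_sum fun i _ => ?_
      nlinarith [sq_nonneg (A.αt D z.1 l i z.2 - a + (A.αt D z.1 l i z.2 - D.α i z.2))]
    rw [Finset.sum_add_distrib, ← Finset.mul_sum, ← Finset.mul_sum] at this
    have h9 := mul_le_mul_of_nonneg_left this (show 0 ≤ n⁻¹ by positivity)
    linarith
  have h9 : n⁻¹ * ∑ i ∈ A.fold z.1 l, (A.αt D z.1 l i z.2 - a) ^ 2 ≤
      (n - 1)⁻¹ * ∑ i ∈ A.fold z.1 l, (A.αt D z.1 l i z.2 - a) ^ 2 := by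
    refine mul_le_mul_of_nonneg_right (inv_anti₀ (by linarith) (by linarith))
      (Finset.sum_nonneg fun i _ => sq_nonneg _)
  -- `n/(n - 1) ≤ 2` because the fold eventually has at least two members.
  have h10 : (n - 1)⁻¹ * ∑ i ∈ A.fold z.1 l, A.uhatSq D z.1 l i z.2 ≤ 2 * b z := by
    have h11 : ∑ i ∈ A.fold z.1 l, A.uhatSq D z.1 l i z.2 ≤ n * b z := by
      have := Finset.sum_le_card_nsmul (A.fold z.1 l) (fun i => A.uhatSq D z.1 l i z.2) (b z)
        fun i hi => (le_abs_self _).trans (hV i hi)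
      simpa [nsmul_eq_mul] using this
    rw [inv_mul_le_iff₀ (by linarith)]
    nlinarith [hb0 z]
  have h12 : A.ebVar D z.1 l z.2 =
      (n - 1)⁻¹ * ∑ i ∈ A.fold z.1 l, (A.αt D z.1 l i z.2 - a) ^ 2 -
      (n - 1)⁻¹ * ∑ i ∈ A.fold z.1 l, A.uhatSq D z.1 l i z.2 := rfl
  rw [h12]
  linarith

/-- All that matters about EB and SURE is a prior variance bounded away from zero: derived for EB,
assumed for SURE. -/
theorem exists_shrunk (hs : Sampling P D) (hA : A.IsValid D m P Θ)
    (hrate : RateAssumption P D A m β₀ μ₀ g) (halpha : FixedEffectAssumption P D A m β₀ μ₀ g)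
    (hshr : A.shrink ≠ .none) (l : Fin L) :
    ∃ (c : ℝ) (τ : ℕ × Ω → ℝ), 0 < c ∧ (∀ᶠ z in wpa P, c ≤ τ z) ∧
      ∀ z i, A.αhat D z.1 l i z.2 = A.shrunk D z.1 l i z.2 (τ z) := by
  rcases hcase : A.shrink with _ | _ | _
  · exact absurd hcase hshr
  · obtain ⟨c, hc, h⟩ := exists_le_ebVar hs hA hrate halpha hshr l
    exact ⟨c, _, hc, h, fun z i => by simp only [Procedure.αhat, hcase]⟩
  · obtain ⟨c, hc, h⟩ := halpha.sure_pos hcase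
    exact ⟨c, fun z => A.sureVar z.1 l z.2, hc, eventually_wpa.2 (h l), fun z i => by
      simp only [Procedure.αhat, hcase]⟩

/-- Centring at the fold mean only lowers the sum of squares, and `α̃_i` is `α_i`, which has finite
variance, plus an error that vanishes in mean square. -/
theorem tight_foldAvg_αt_sub_αbar (hs : Sampling P D) (hA : A.IsValid D m P Θ)
    (hrate : RateAssumption P D A m β₀ μ₀ g) (halpha : FixedEffectAssumption P D A m β₀ μ₀ g)
    (hshr : A.shrink ≠ .none) (l : Fin L) :
    Tight (wpa P) (foldAvg A l fun i z => (A.αt D z.1 l i z.2 - A.αbar D z.1 l z.2) ^ 2) := by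
  have hα : Tight (wpa P) (foldAvg A l fun i z => ‖D.α i z.2‖ ^ 2) := by
    refine tight_foldAvg_norm_pow (f := fun _ i => D.α i) hA 2
      (fun _ i => (halpha.α_var hshr i).1.1)
      ⟨∫⁻ ω, ‖D.α 0 ω‖ₑ ^ 2 ∂P, ?_, fun _ i => le_of_eq ?_⟩ l
    · rw [lintegral_enorm_pow_eq _ two_ne_zero]
      exact ENNReal.pow_ne_top (halpha.α_var hshr 0).1.2.ne
    · exact (isDataFun_α.comp (c := fun x : ℝ => ‖x‖ₑ ^ 2) (by fun_prop)).lintegral_eq hs i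
  have h1 := ((Tight.of_tendsto (tendsto_foldAvg_αt hA hrate halpha l)).const_mul 2).add
    (hα.const_mul 2)
  refine h1.mono (Eventually.of_forall fun z => ?_)
  rw [abs_of_nonneg (foldAvg_nonneg fun i => by positivity)]
  refine le_trans ?_ (le_abs_self _)
  rcases (A.fold z.1 l).eq_empty_or_nonempty with h | h
  · simp [foldAvg, h]
  have h0 : (0 : ℝ) < (A.fold z.1 l).card := by exact_mod_cast h.card_pos
  have h2 : ∑ i ∈ A.fold z.1 l, (A.αt D z.1 l i z.2 - A.αbar D z.1 l z.2) ^ 2 ≤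
      ∑ i ∈ A.fold z.1 l, A.αt D z.1 l i z.2 ^ 2 := by
    have h3 := sum_sub_mean_sq (A.fold z.1 l) fun i => A.αt D z.1 l i z.2
    have h4 : ((A.fold z.1 l).card : ℝ)⁻¹ *
        ∑ i ∈ A.fold z.1 l, (A.αt D z.1 l i z.2 - A.αbar D z.1 l z.2) ^ 2 ≤
        ((A.fold z.1 l).card : ℝ)⁻¹ * ∑ i ∈ A.fold z.1 l, A.αt D z.1 l i z.2 ^ 2 :=
      h3.trans_le (sub_le_self _ (sq_nonneg _))
    exact le_of_mul_le_mul_left h4 (by positivity)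
  rw [← foldAvg_const_mul (c := fun _ => 2), ← foldAvg_const_mul (c := fun _ => 2), ← foldAvg_add]
  refine (mul_le_mul_of_nonneg_left h2 (by positivity)).trans ?_
  refine foldAvg_mono (f := fun i z => A.αt D z.1 l i z.2 ^ 2) fun i _ => ?_
  rw [Real.norm_eq_abs, sq_abs]
  nlinarith [sq_nonneg (A.αt D z.1 l i z.2 - D.α i z.2 - D.α i z.2)]

/-- Shrinkage moves `α̃_i` by `-s_i(α̃_i - ᾱ)` with `|s_i|` uniformly `o_p(N^{-1/2})`. After
Cauchy–Schwarz no correlation structure between the weights and `e_i` is needed. -/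
theorem tendsto_sum_shrinkage_smul_e (hs : Sampling P D) (hA : A.IsValid D m P Θ)
    (hmodel : ModelAssumption P D m β₀ μ₀) (hrate : RateAssumption P D A m β₀ μ₀ g)
    (halpha : FixedEffectAssumption P D A m β₀ μ₀ g) (hmom : MomentAssumption P D A m β₀ μ₀)
    (l : Fin L) :
    Tendsto (fun z : ℕ × Ω => (√(z.1 : ℝ))⁻¹ * ‖∑ i ∈ A.fold z.1 l,
      (A.αhat D z.1 l i z.2 - A.αt D z.1 l i z.2) • D.e P m μ₀ (A.T z.1) i z.2‖) (wpa P)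
      (𝓝 0) := by
  by_cases hshr : A.shrink = .none
  · simpa [Procedure.αhat, hshr] using tendsto_const_nhds
  obtain ⟨b, hb0, hb, hb1, hbV⟩ := exists_uhatSq_bound hs hA hrate halpha hshr l
  obtain ⟨c, τ, hc, hτ, hα⟩ := exists_shrunk hs hA hrate halpha hshr l
  have h1 := ((tight_foldAvg_αt_sub_αbar hs hA hrate halpha hshr l).sqrt.mul
    (tight_foldAvg_e_sq hs hA hmodel hrate hmom l).sqrt) _
    (by simpa using hb.const_mul (2 / c))
  refine squeeze_zero' (Eventually.of_forall fun z => by positivity) ?_ h1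
  filter_upwards [hbV, hτ, hb1.eventually (ge_mem_nhds (half_pos hc))] with z hV hτz hbz
  have h4 := norm_sum_le_foldAvg (A := A) (l := l) (z := z)
    (v := fun i z => (A.αhat D z.1 l i z.2 - A.αt D z.1 l i z.2) • D.e P m μ₀ (A.T z.1) i z.2)
    (f := fun i z => (2 / c * b z) * (|A.αt D z.1 l i z.2 - A.αbar D z.1 l z.2| *
      ‖D.e P m μ₀ (A.T z.1) i z.2‖)) (fun i hi => by
        rw [norm_smul, ← mul_assoc]
        refine mul_le_mul_of_nonneg_right ?_ (norm_nonneg _)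
        rw [hα, Procedure.shrunk]
        set V := A.uhatSq D z.1 l i z.2
        have h5 := hV i hi
        -- No positivity of the variance estimate is used: `|V| ≤ b ≤ c/2` keeps the denominator
        -- away from zero.
        have h6 : c / 2 ≤ V + τ z := by linarith [neg_abs_le V]
        have h7 : |V / (V + τ z)| ≤ 2 / c * b z := by
          rw [abs_div, abs_of_pos (show 0 < V + τ z by linarith)]
          rw [div_le_iff₀ (by linarith)]
          calc |V| ≤ b z := h5
            _ = 2 / c * b z * (c / 2) := by field_simp
            _ ≤ _ := mul_le_mul_of_nonneg_left h6 (by have := hb0 z; positivity)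
        rw [show (1 - V / (V + τ z)) * A.αt D z.1 l i z.2 + V / (V + τ z) * A.αbar D z.1 l z.2 -
          A.αt D z.1 l i z.2 = -(V / (V + τ z)) * (A.αt D z.1 l i z.2 - A.αbar D z.1 l z.2) by ring,
          norm_mul, norm_neg]
        exact mul_le_mul_of_nonneg_right h7 (norm_nonneg _))
  rw [foldAvg_const_mul (fun z => 2 / c * b z)] at h4
  refine h4.trans ?_
  have h5 := foldAvg_mul_le_sqrt (A := A) (l := l) (z := z)
    (f := fun i z => |A.αt D z.1 l i z.2 - A.αbar D z.1 l z.2|)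
    (f' := fun i z => ‖D.e P m μ₀ (A.T z.1) i z.2‖)
  simp only [sq_abs] at h5
  have h6 := mul_le_mul_of_nonneg_left h5
    (show 0 ≤ √(z.1 : ℝ) * (2 / c * b z) by have := hb0 z; positivity)
  refine le_trans (le_of_eq ?_) (h6.trans (le_of_eq ?_)) <;> ring

/-- The estimation errors of the fixed effects are asymptotically orthogonal to `e_i`. -/
theorem tendsto_sum_αhat_smul_e (hs : Sampling P D) (hA : A.IsValid D m P Θ)
    (hmodel : ModelAssumption P D m β₀ μ₀) (hrate : RateAssumption P D A m β₀ μ₀ g)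
    (halpha : FixedEffectAssumption P D A m β₀ μ₀ g) (hmom : MomentAssumption P D A m β₀ μ₀)
    (l : Fin L) :
    Tendsto (fun z : ℕ × Ω => (√(z.1 : ℝ))⁻¹ * ‖∑ i ∈ A.fold z.1 l,
      (A.αhat D z.1 l i z.2 - D.α i z.2) • D.e P m μ₀ (A.T z.1) i z.2‖) (wpa P) (𝓝 0) := by
  have h := (tendsto_sum_shrinkage_smul_e hs hA hmodel hrate halpha hmom l).add
    (tendsto_sum_αt_smul_e hs hA hmodel hrate halpha hmom l)
  rw [add_zero] at h
  refine squeeze_zero (fun z => by positivity) (fun z => ?_) h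
  rw [← mul_add]
  refine mul_le_mul_of_nonneg_left (le_trans (le_of_eq ?_) (norm_add_le _ _)) (by positivity)
  rw [← Finset.sum_add_distrib]
  congr 1
  exact Finset.sum_congr rfl fun i _ => by rw [← add_smul, sub_add_sub_cancel]

end Shrinking

end OrthMoment

namespace OrthMoment

/-! ### Estimated and infeasible orthogonal moments -/

section Gap

theorem norm_sub_le_of_deriv {F : Type*} [NormedAddCommGroup F] [NormedSpace ℝ F] {f : ℝ → F}
    {C : ℝ} (hf : ContDiff ℝ 1 f) (hC : ∀ s, ‖deriv f s‖ ≤ C) (s t : ℝ) :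
    ‖f t - f s‖ ≤ C * |t - s| :=
  convex_univ.norm_image_sub_le_of_norm_deriv_le
    (fun _ _ => (hf.differentiable one_ne_zero).differentiableAt) (fun x _ => hC x)
    (Set.mem_univ s) (Set.mem_univ t)

/-- The mean value inequality is used twice: for `deriv f`, and for `f y - y f'(s)`, whose
derivative is at most `C|t - s|` between `s` and `t`. The sharper constant `C/2` is not needed. -/
theorem norm_sub_sub_smul_deriv_le {F : Type*} [NormedAddCommGroup F] [NormedSpace ℝ F]
    {f : ℝ → F} {C : ℝ} (hf : ContDiff ℝ 2 f) (hC : ∀ s, ‖iteratedDeriv 2 f s‖ ≤ C) (s t : ℝ) :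
    ‖f t - f s - (t - s) • deriv f s‖ ≤ C * (t - s) ^ 2 := by
  have hC0 : 0 ≤ C := (norm_nonneg _).trans (hC 0)
  have hd : ∀ x, DifferentiableAt ℝ f x := fun x =>
    (hf.differentiable two_ne_zero).differentiableAt
  have h1 : ∀ x, ‖deriv f x - deriv f s‖ ≤ C * |x - s| := fun x =>
    norm_sub_le_of_deriv (ContDiff.deriv' (n := 1) hf) (fun y => by
      have := hC y
      rwa [iteratedDeriv_succ, iteratedDeriv_one] at this) s x
  have h2 : ∀ x, HasDerivAt (fun y => f y - y • deriv f s) (deriv f x - deriv f s) x := fun x => by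
    simpa [Pi.sub_def] using (hd x).hasDerivAt.sub ((hasDerivAt_id x).smul_const (deriv f s))
  have h3 := (convex_uIcc s t).norm_image_sub_le_of_norm_hasDerivWithin_le
    (f := fun y => f y - y • deriv f s) (f' := fun x => deriv f x - deriv f s) (C := C * |t - s|)
    (fun x _ => (h2 x).hasDerivWithinAt) (fun x hx => (h1 x).trans (by
      exact mul_le_mul_of_nonneg_left (Set.abs_sub_left_of_mem_uIcc hx) hC0)) Set.left_mem_uIcc Set.right_mem_uIcc
  rw [Real.norm_eq_abs, mul_assoc, abs_mul_abs_self, ← sq] at h3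
  refine le_trans (le_of_eq ?_) h3
  congr 1
  rw [sub_smul]
  abel

theorem sum_five_sq_le (x₁ x₂ x₃ x₄ x₅ : ℝ) :
    (x₁ + x₂ + x₃ + x₄ + x₅) ^ 2 ≤ 5 * (x₁ ^ 2 + x₂ ^ 2 + x₃ ^ 2 + x₄ ^ 2 + x₅ ^ 2) := by
  nlinarith [sq_nonneg (x₁ - x₂), sq_nonneg (x₁ - x₃), sq_nonneg (x₁ - x₄), sq_nonneg (x₁ - x₅),
    sq_nonneg (x₂ - x₃), sq_nonneg (x₂ - x₄), sq_nonneg (x₂ - x₅), sq_nonneg (x₃ - x₄),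
    sq_nonneg (x₃ - x₅), sq_nonneg (x₄ - x₅)]

variable {Ω : Type*} [MeasurableSpace Ω] {P : Measure Ω}
  {d p k q L : ℕ} {D : Panel Ω d p} {A : Procedure Ω p k q L}
  {m : Vec d → ℝ → Vec k → Vec q} {β₀ : Vec p} {μ₀ : Vec k} {g : ℝ} {Θ : Set (Vec k)}

/-- The estimated moment `m(W_i, α̂_il, μ₀) + ψ̂_il` minus the orthogonal moment `m*_i`. -/
noncomputable def momentGap (P : Measure Ω) (D : Panel Ω d p) (A : Procedure Ω p k q L)
    (m : Vec d → ℝ → Vec k → Vec q) (β₀ : Vec p) (μ₀ : Vec k) (l : Fin L) (i : ℕ) (z : ℕ × Ω) :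
    Vec q :=
  m (D.W i z.2) (A.αhat D z.1 l i z.2) μ₀ + A.ψ D z.1 l i z.2 - D.mstar P m β₀ μ₀ (A.T z.1) i z.2

/-- Second-order remainder of the moment function in the fixed effect. -/
noncomputable def remainder (D : Panel Ω d p) (A : Procedure Ω p k q L)
    (m : Vec d → ℝ → Vec k → Vec q) (μ₀ : Vec k) (l : Fin L) (i : ℕ) (z : ℕ × Ω) : Vec q :=
  m (D.W i z.2) (A.αhat D z.1 l i z.2) μ₀ - m (D.W i z.2) (D.α i z.2) μ₀ -
    (A.αhat D z.1 l i z.2 - D.α i z.2) • dα m (D.W i z.2) (D.α i z.2) μ₀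

/-- The orthogonality of the moment: `a_i(α̂_i - α_i)` from the expansion of `m` cancels against the
correction term, leaving the error of `α̂_i` only multiplied by `e_i` or by the error of `ã_i`, or
squared. -/
theorem momentGap_eq (l : Fin L) (i : ℕ) (z : ℕ × Ω) :
    momentGap P D A m β₀ μ₀ l i z = remainder D A m μ₀ l i z +
      D.u β₀ i (A.T z.1) z.2 • (A.at_ D z.1 l i z.2 - D.a P m μ₀ (A.T z.1) i z.2) +
      (-inner ℝ (D.X i (A.T z.1) z.2) (A.βt z.1 l z.2 - β₀)) • A.at_ D z.1 l i z.2 +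
      (A.αhat D z.1 l i z.2 - D.α i z.2) • D.e P m μ₀ (A.T z.1) i z.2 +
      (D.α i z.2 - A.αhat D z.1 l i z.2) •
        (A.at_ D z.1 l i z.2 - D.a P m μ₀ (A.T z.1) i z.2) := by
  simp only [momentGap, remainder, Procedure.ψ, Panel.mstar, Panel.e, Panel.u, inner_sub_right]
  module

theorem eventually_norm_remainder_le (hmom : MomentAssumption P D A m β₀ μ₀) (l : Fin L) :
    ∃ C : ℝ, 0 ≤ C ∧ ∀ᶠ z in wpa P, ∀ i, ‖remainder D A m μ₀ l i z‖ ≤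
      C * (A.αhat D z.1 l i z.2 - D.α i z.2) ^ 2 := by
  obtain ⟨C, hC⟩ := hmom.dαα_bound
  refine ⟨max C 0, le_max_right _ _, eventually_wpa_of_ae (Eventually.of_forall fun N => ?_)⟩
  filter_upwards [ae_all_iff.2 hC, ae_all_iff.2 hmom.smooth] with ω h1 h2 i
  exact norm_sub_sub_smul_deriv_le (h2 i) (fun s => (h1 i s).trans (le_max_left _ _)) _ _

variable [IsProbabilityMeasure P]

/-- `N^{-1/2}` times the sum of the moment gaps vanishes asymptotically. -/
theorem tendsto_sum_momentGap (hs : Sampling P D) (hA : A.IsValid D m P Θ)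
    (hmodel : ModelAssumption P D m β₀ μ₀) (hrate : RateAssumption P D A m β₀ μ₀ g)
    (halpha : FixedEffectAssumption P D A m β₀ μ₀ g) (hmom : MomentAssumption P D A m β₀ μ₀)
    (l : Fin L) :
    Tendsto (fun z : ℕ × Ω => (√(z.1 : ℝ))⁻¹ *
      ‖∑ i ∈ A.fold z.1 l, momentGap P D A m β₀ μ₀ l i z‖) (wpa P) (𝓝 0) := by
  obtain ⟨C, hC0, hC⟩ := eventually_norm_remainder_le hmom l
  -- The limits `h1` to `h5` bound the five terms of `momentGap_eq` in the order in which they occur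
  -- there.
  have h1 := (tendsto_sqrt_mul_αhat hA hrate halpha l).const_mul C
  have h2 := (Real.continuous_sqrt.tendsto 0).comp
    (tendsto_sum_weighted_errors hs hA hmodel hrate hmom l)
  have h3 := ((tight_foldAvg_X hs hA hmom l).sqrt.mul
    (tight_foldAvg_at hs hA hmodel hrate hmom l).sqrt) _ (tendsto_sqrt_mul_βt hA hrate l)
  have h4 := tendsto_sum_αhat_smul_e hs hA hmodel hrate halpha hmom l
  have h5 := (Real.continuous_sqrt.tendsto 0).comp
    (tendsto_mul_αhat_mul_at_sub_a hA hrate halpha l)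
  have h6 := (((h1.add h2).add h3).add h4).add h5
  simp only [mul_zero, Real.sqrt_zero, add_zero] at h6
  refine squeeze_zero' (Eventually.of_forall fun z => by positivity) ?_ h6
  filter_upwards [hC] with z hz
  simp only [momentGap_eq, Finset.sum_add_distrib]
  have k1 := norm_sum_le_foldAvg (A := A) (l := l) (z := z)
    (v := fun i z => remainder D A m μ₀ l i z)
    (f := fun i z => C * (A.αhat D z.1 l i z.2 - D.α i z.2) ^ 2) (fun i _ => hz i)
  rw [foldAvg_const_mul (fun _ => C)] at k1
  have k3 := norm_sum_le_foldAvg (A := A) (l := l) (z := z)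
    (v := fun i z => (-inner ℝ (D.X i (A.T z.1) z.2) (A.βt z.1 l z.2 - β₀)) • A.at_ D z.1 l i z.2)
    (f := fun i z => ‖A.βt z.1 l z.2 - β₀‖ * (‖D.X i (A.T z.1) z.2‖ * ‖A.at_ D z.1 l i z.2‖))
    (fun i _ => by
      rw [norm_smul, norm_neg, ← mul_assoc, mul_comm ‖A.βt z.1 l z.2 - β₀‖]
      gcongr
      exact norm_inner_le_norm _ _)
  rw [foldAvg_const_mul (fun z => ‖A.βt z.1 l z.2 - β₀‖), ← mul_assoc] at k3
  have k3' := k3.trans (mul_le_mul_of_nonneg_left foldAvg_mul_le_sqrt (by positivity))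
  have k5 := norm_sum_le_foldAvg (A := A) (l := l) (z := z)
    (v := fun i z => (D.α i z.2 - A.αhat D z.1 l i z.2) •
      (A.at_ D z.1 l i z.2 - D.a P m μ₀ (A.T z.1) i z.2))
    (f := fun i z => |A.αhat D z.1 l i z.2 - D.α i z.2| *
      ‖A.at_ D z.1 l i z.2 - D.a P m μ₀ (A.T z.1) i z.2‖)
    (fun i _ => by rw [norm_smul, Real.norm_eq_abs, abs_sub_comm])
  have k5' := k5.trans (mul_le_mul_of_nonneg_left foldAvg_mul_le_sqrt (by positivity))
  simp only [sq_abs] at k5'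
  have e1 : C * (√(z.1 : ℝ) * foldAvg A l (fun i z => (A.αhat D z.1 l i z.2 - D.α i z.2) ^ 2) z) =
      √(z.1 : ℝ) * (C * foldAvg A l (fun i z => (A.αhat D z.1 l i z.2 - D.α i z.2) ^ 2) z) := by
    ring
  simp only [Function.comp]
  rw [e1, Real.sqrt_mul (by positivity), Real.sqrt_inv, Real.sqrt_sq (norm_nonneg _),
    Real.sqrt_mul (by positivity), Real.sqrt_mul (foldAvg_nonneg fun i => sq_nonneg _)]
  have hn : 0 ≤ (√(z.1 : ℝ))⁻¹ := by positivity
  refine (mul_le_mul_of_nonneg_left ((norm_add_le _ _).trans (add_le_add_left ((norm_add_le _ _).trans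
    (add_le_add_left ((norm_add_le _ _).trans (add_le_add_left (norm_add_le _ _) _)) _)) _)) hn).trans ?_
  simp only [mul_add]
  exact add_le_add (add_le_add (add_le_add (add_le_add k1 le_rfl) k3') le_rfl) k5'

/-- The moment gaps vanish in mean square. -/
theorem tendsto_foldAvg_momentGap_sq (hs : Sampling P D) (hA : A.IsValid D m P Θ)
    (hmodel : ModelAssumption P D m β₀ μ₀) (hrate : RateAssumption P D A m β₀ μ₀ g)
    (halpha : FixedEffectAssumption P D A m β₀ μ₀ g) (hmom : MomentAssumption P D A m β₀ μ₀)
    (l : Fin L) :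
    Tendsto (foldAvg A l fun i z => ‖momentGap P D A m β₀ μ₀ l i z‖ ^ 2) (wpa P) (𝓝 0) := by
  obtain ⟨C, hC0, hC⟩ := eventually_norm_remainder_le hmom l
  -- Again one limit per term. The third and fifth terms go through `foldAvg_mul_le`, whose factor
  -- `N` is absorbed by the rates; the fourth pairs fourth moments by Cauchy–Schwarz.
  have h1 := (tendsto_foldAvg_αhat_fourth hA hrate halpha l).const_mul (C ^ 2)
  have h2 := tendsto_sum_sq_weighted_errors hs hA hmodel hrate hmom l
  have h3 := ((tight_foldAvg_X hs hA hmom l).mul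
    (tight_foldAvg_at hs hA hmodel hrate hmom l)) _
    (by simpa using (tendsto_sqrt_mul_βt (P := P) hA hrate l).pow 2)
  have h4' := (Real.continuous_sqrt.tendsto 0).comp (tendsto_foldAvg_αhat_fourth hA hrate halpha l)
  rw [Real.sqrt_zero] at h4'
  have h4 := (tight_foldAvg_e_fourth hs hA hmodel hrate hmom l).sqrt _ h4'
  have h5 := tendsto_mul_αhat_mul_at_sub_a hA hrate halpha l
  have h6 := ((((h1.add h2).add h3).add h4).add h5).const_mul 5
  simp only [mul_zero, add_zero] at h6
  refine squeeze_zero' (Eventually.of_forall fun z => foldAvg_nonneg fun i => by positivity) ?_ h6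
  filter_upwards [hC] with z hz
  set B : ℕ → ℕ × Ω → ℝ := fun i z => 5 *
      (C ^ 2 * (A.αhat D z.1 l i z.2 - D.α i z.2) ^ 4 +
      ‖D.u β₀ i (A.T z.1) z.2 • (A.at_ D z.1 l i z.2 - D.a P m μ₀ (A.T z.1) i z.2)‖ ^ 2 +
      ‖A.βt z.1 l z.2 - β₀‖ ^ 2 * (‖D.X i (A.T z.1) z.2‖ ^ 2 * ‖A.at_ D z.1 l i z.2‖ ^ 2) +
      (A.αhat D z.1 l i z.2 - D.α i z.2) ^ 2 * ‖D.e P m μ₀ (A.T z.1) i z.2‖ ^ 2 +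
      (A.αhat D z.1 l i z.2 - D.α i z.2) ^ 2 *
        ‖A.at_ D z.1 l i z.2 - D.a P m μ₀ (A.T z.1) i z.2‖ ^ 2) with hB
  have k1 : ∀ i ∈ A.fold z.1 l, ‖momentGap P D A m β₀ μ₀ l i z‖ ^ 2 ≤ B i z := by
    intro i _
    rw [momentGap_eq]
    have hn := (norm_add_le _ _).trans (add_le_add_left ((norm_add_le _ _).trans
      (add_le_add_left ((norm_add_le _ _).trans (add_le_add_left (norm_add_le
        (remainder D A m μ₀ l i z) (D.u β₀ i (A.T z.1) z.2 • (A.at_ D z.1 l i z.2 -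
          D.a P m μ₀ (A.T z.1) i z.2)))
      ‖(-inner ℝ (D.X i (A.T z.1) z.2) (A.βt z.1 l z.2 - β₀)) • A.at_ D z.1 l i z.2‖))
      ‖(A.αhat D z.1 l i z.2 - D.α i z.2) • D.e P m μ₀ (A.T z.1) i z.2‖))
      ‖(D.α i z.2 - A.αhat D z.1 l i z.2) •
        (A.at_ D z.1 l i z.2 - D.a P m μ₀ (A.T z.1) i z.2)‖)
    refine ((pow_le_pow_left₀ (norm_nonneg _) hn 2).trans (sum_five_sq_le _ _ _ _ _)).trans ?_
    refine mul_le_mul_of_nonneg_left ?_ (by norm_num)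
    refine add_le_add (add_le_add (add_le_add (add_le_add ?_ le_rfl) ?_) ?_) ?_
    · refine (pow_le_pow_left₀ (norm_nonneg _) (hz i) 2).trans (le_of_eq (by ring))
    · rw [norm_smul, norm_neg, mul_pow, ← mul_assoc, mul_comm (‖A.βt z.1 l z.2 - β₀‖ ^ 2),
        ← mul_pow ‖D.X i (A.T z.1) z.2‖]
      exact mul_le_mul_of_nonneg_right (pow_le_pow_left₀ (norm_nonneg _) (norm_inner_le_norm (𝕜 := ℝ)
        (D.X i (A.T z.1) z.2) (A.βt z.1 l z.2 - β₀)) 2)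
        (by positivity)
    · rw [norm_smul, mul_pow, Real.norm_eq_abs, sq_abs]
    · rw [norm_smul, mul_pow, Real.norm_eq_abs, sq_abs, sub_sq_comm]
  refine (foldAvg_mono (f' := B) k1).trans ?_
  rw [hB]
  rw [foldAvg_const_mul (fun _ => 5)]
  refine mul_le_mul_of_nonneg_left ?_ (by norm_num)
  simp only [foldAvg_add]
  rw [foldAvg_const_mul (fun _ => C ^ 2), foldAvg_const_mul (fun z => ‖A.βt z.1 l z.2 - β₀‖ ^ 2)]
  refine add_le_add (add_le_add (add_le_add le_rfl ?_) ?_) ?_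
  · refine (mul_le_mul_of_nonneg_left (foldAvg_mul_le (fun i => by positivity)
      (fun i => by positivity)) (by positivity)).trans (le_of_eq ?_)
    rw [mul_pow, Real.sq_sqrt (by positivity)]
    ring
  · refine foldAvg_mul_le_sqrt.trans (le_of_eq ?_)
    simp only [← pow_mul, Nat.reduceMul, Function.comp]
  · exact foldAvg_mul_le (fun i => by positivity) (fun i => by positivity)

end Gap

end OrthMoment

namespace OrthMoment

/-! ### The Jacobian of the sample moments -/

section Jacobian

variable {Ω : Type*} [MeasurableSpace Ω] {P : Measure Ω}
  {d p k q L : ℕ} {D : Panel Ω d p} {A : Procedure Ω p k q L}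
  {m : Vec d → ℝ → Vec k → Vec q} {β₀ : Vec p} {μ₀ : Vec k} {g ρ : ℝ} {Θ : Set (Vec k)}
  {G : Matrix (Fin q) (Fin k) ℝ} {Om : Matrix (Fin q) (Fin q) ℝ}

theorem sum_folds {M : Type*} [AddCommMonoid M] (hA : A.IsValid D m P Θ) (N : ℕ) (f : ℕ → M) :
    ∑ l, ∑ i ∈ A.fold N l, f i = ∑ i ∈ Finset.range N, f i := by
  rw [← hA.fold_cover N, Finset.sum_biUnion]
  exact fun l _ l' _ h => hA.fold_disjoint N h

/-- The operator `v ↦ G v`. -/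
noncomputable def clmOfMatrix (G : Matrix (Fin q) (Fin k) ℝ) : Vec k →L[ℝ] Vec q :=
  ∑ c, (EuclideanSpace.proj c : Vec k →L[ℝ] ℝ).smulRight
    (∑ r, G r c • EuclideanSpace.single r (1 : ℝ))

theorem clmOfMatrix_apply (G : Matrix (Fin q) (Fin k) ℝ) (v : Vec k) (r : Fin q) :
    clmOfMatrix G v r = ∑ c, G r c * v c := by
  simp [clmOfMatrix, Pi.single_apply, mul_comm]

theorem clmOfMatrix_entries (T : Vec k →L[ℝ] Vec q) :
    clmOfMatrix (Matrix.of fun r c => T (EuclideanSpace.single c 1) r) = T := by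
  conv_rhs => rw [clm_eq_sum T]
  refine Finset.sum_congr rfl fun c _ => ?_
  congr 1
  ext r
  simp [Pi.single_apply]

theorem clmOfMatrix_eq_sum (G : Matrix (Fin q) (Fin k) ℝ) :
    clmOfMatrix G = ∑ c, ∑ r, G r c • (EuclideanSpace.proj c : Vec k →L[ℝ] ℝ).smulRight
      (EuclideanSpace.single r (1 : ℝ) : Vec q) := by
  ext v r
  simp [clmOfMatrix, Pi.single_apply, mul_comm]

theorem continuous_clmOfMatrix :
    Continuous (clmOfMatrix : Matrix (Fin q) (Fin k) ℝ → Vec k →L[ℝ] Vec q) := by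
  simp only [funext clmOfMatrix_eq_sum]
  fun_prop

/-- The derivative of the sample moments. -/
noncomputable def sampleJac (D : Panel Ω d p) (A : Procedure Ω p k q L)
    (m : Vec d → ℝ → Vec k → Vec q) (z : ℕ × Ω) (μ : Vec k) : Vec k →L[ℝ] Vec q :=
  (z.1 : ℝ)⁻¹ • ∑ l, ∑ i ∈ A.fold z.1 l, dμ m (D.W i z.2) (A.αhat D z.1 l i z.2) μ

theorem hasFDerivAt_mhat {z : ℕ × Ω} {μ : Vec k}
    (h : ∀ i s, DifferentiableAt ℝ (fun ν => m (D.W i z.2) s ν) μ) :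
    HasFDerivAt (A.mhat D m z.1 z.2) (sampleJac D A m z μ) μ := by
  have h1 : HasFDerivAt (fun ν => ∑ l, ∑ i ∈ A.fold z.1 l,
      (m (D.W i z.2) (A.αhat D z.1 l i z.2) ν + A.ψ D z.1 l i z.2))
      (∑ l, ∑ i ∈ A.fold z.1 l, dμ m (D.W i z.2) (A.αhat D z.1 l i z.2) μ) μ :=
    HasFDerivAt.fun_sum fun l _ => HasFDerivAt.fun_sum fun i _ =>
      (h i _).hasFDerivAt.add_const _
  exact h1.const_smul (z.1 : ℝ)⁻¹

theorem Ghat_eq_sampleJac (N : ℕ) (ω : Ω) (r : Fin q) (c : Fin k) :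
    A.Ghat D m N ω r c = sampleJac D A m (N, ω) (A.μhat N ω) (EuclideanSpace.single c 1) r := by
  simp [Procedure.Ghat, sampleJac, jac, Matrix.sum_apply]

variable [IsProbabilityMeasure P]

/-- First move `s` to `α_i` at fixed `μ` by the mean value inequality with the envelope, then `μ` to
`μ₀` at `α_i` by the Hölder condition. Absolute values make the envelopes nonnegative everywhere and
not just almost surely. -/
theorem eventually_dμ_sub_le (hOm : OmegaAssumption P D A m β₀ μ₀ ρ Om)
    (hG : JacobianAssumption P D m μ₀ ρ G) :
    ∃ (c : ℝ) (F : ℕ → Ω → ℝ) (Fα : ℕ → Ω → ℝ), 0 < c ∧ IsDataFun P D F ∧ IsDataFun P D Fα ∧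
      (∀ i, Integrable (F i) P) ∧ (∀ i, Integrable (Fα i) P) ∧ (∀ i ω, 0 ≤ F i ω) ∧
      (∀ i ω, 0 ≤ Fα i ω) ∧ ∀ᵐ ω ∂P, ∀ i s, ∀ μ ∈ Metric.ball μ₀ ρ,
        ‖dμ m (D.W i ω) s μ - dμ m (D.W i ω) (D.α i ω) μ₀‖ ≤
          √(F i ω) * |s - D.α i ω| + Fα i ω * ‖μ - μ₀‖ ^ c := by
  obtain ⟨F, hFm, hFi, hF⟩ := hG.envelope
  obtain ⟨C, Fα, hC, hFαm, hFαi, hFα⟩ := hG.holder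
  refine ⟨1 / C, fun i ω => |F (D.W i ω)|, fun i ω => |Fα (D.W i ω) (D.α i ω)|, by positivity,
    ?_, ?_, fun i => (hFi i).abs, fun i => (hFαi i).abs, fun i ω => abs_nonneg _,
    fun i ω => abs_nonneg _, ?_⟩
  · exact IsDataFun.of_measurable (φ := fun x : UnitData d p => |F x.1|)
      (measurable_abs.comp (hFm.comp measurable_fst))
  · exact IsDataFun.of_measurable (φ := fun x : UnitData d p => |Fα x.1 x.2.1|)
      (measurable_abs.comp (hFαm.comp (measurable_fst.prodMk (measurable_fst.comp measurable_snd))))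
  filter_upwards [ae_all_iff.2 hF, ae_all_iff.2 hFα, ae_all_iff.2 hOm.dαμ_exists]
    with ω h1 h2 h3 i s μ hμ
  have h4 : ‖dμ m (D.W i ω) s μ - dμ m (D.W i ω) (D.α i ω) μ‖ ≤
      √|F (D.W i ω)| * |s - D.α i ω| :=
    norm_sub_le_of_deriv ((h3 i μ hμ).of_le one_le_two)
      (fun t => Real.le_sqrt_of_sq_le ((h1 i t μ hμ).trans (le_abs_self _))) _ _
  have h5 := (h2 i μ hμ).trans
    (mul_le_mul_of_nonneg_right (le_abs_self _) (Real.rpow_nonneg (norm_nonneg _) _))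
  refine le_trans ?_ (add_le_add h4 h5)
  exact norm_sub_le_norm_sub_add_norm_sub _ _ _

theorem tendsto_foldAvg_abs_αhat (hA : A.IsValid D m P Θ)
    (hrate : RateAssumption P D A m β₀ μ₀ g) (halpha : FixedEffectAssumption P D A m β₀ μ₀ g)
    (hs : Sampling P D) {F : ℕ → Ω → ℝ} (hF : IsDataFun P D F) (hFi : Integrable (F 0) P)
    (hF0 : ∀ i ω, 0 ≤ F i ω) (l : Fin L) :
    Tendsto (foldAvg A l fun i z => √(F i z.2) * |A.αhat D z.1 l i z.2 - D.α i z.2|) (wpa P)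
      (𝓝 0) := by
  have h1 : Tight (wpa P) (foldAvg A l fun i z => F i z.2) := by
    refine tight_foldAvg (f := fun _ i => F i) hA (C := ∫⁻ ω, ‖F 0 ω‖ₑ ∂P) hFi.2.ne
      (fun _ i => hF.aemeasurable hs i) (fun _ i => le_of_eq ?_) l
    exact (hF.comp (c := fun x : ℝ => ‖x‖ₑ) (by fun_prop)).lintegral_eq hs i
  have h2 := (Real.continuous_sqrt.tendsto 0).comp (tendsto_foldAvg_αhat hA hrate halpha l)
  rw [Real.sqrt_zero] at h2
  refine squeeze_zero (fun z => foldAvg_nonneg fun i => by positivity) (fun z => ?_) (h1.sqrt _ h2)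
  refine foldAvg_mul_le_sqrt.trans (le_of_eq ?_)
  simp only [sq_abs, Real.sq_sqrt (hF0 _ _)]
  rw [mul_comm]
  rfl

/-- The sample Jacobian is uniformly close to `G` near `μ₀`. -/
theorem exists_sampleJac_bound (hs : Sampling P D) (hA : A.IsValid D m P Θ)
    (hmodel : ModelAssumption P D m β₀ μ₀) (hrate : RateAssumption P D A m β₀ μ₀ g)
    (halpha : FixedEffectAssumption P D A m β₀ μ₀ g) (hρ : 0 < ρ)
    (hOm : OmegaAssumption P D A m β₀ μ₀ ρ Om) (hG : JacobianAssumption P D m μ₀ ρ G) :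
    ∃ (c K : ℝ) (R : ℕ × Ω → ℝ), 0 < c ∧ 0 ≤ K ∧ Tendsto R (wpa P) (𝓝 0) ∧
      ∀ᶠ z in wpa P, ∀ μ ∈ Metric.ball μ₀ ρ,
        ‖sampleJac D A m z μ - clmOfMatrix G‖ ≤ R z + K * ‖μ - μ₀‖ ^ c := by
  obtain ⟨c, F, Fα, hc, hF, hFα, hFi, hFαi, hF0, hFα0, hb⟩ := eventually_dμ_sub_le hOm hG
  have hrange : Tendsto (fun N => (Finset.range N).card) atTop atTop := by
    simp only [Finset.card_range]; exact tendsto_id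
  have h1 := tendsto_mean_of_isDataFun hs hrange hFα (hFαi 0)
  have hunit : IsUnitFun P D fun i ω => dμ m (D.W i ω) (D.α i ω) μ₀ := by
    simpa using isUnitFun_dμ hmodel.meas (μ := μ₀)
      (fun i => by
        filter_upwards [hOm.dμ_exists i] with ω h s
        exact h s μ₀ (Metric.mem_ball_self hρ)) 0
  have h2 : Tendsto (fun z : ℕ × Ω =>
      (z.1 : ℝ)⁻¹ • ∑ i ∈ Finset.range z.1, dμ m (D.W i z.2) (D.α i z.2) μ₀) (wpa P)
      (𝓝 (clmOfMatrix G)) := by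
    have h3 : Tendsto (fun z : ℕ × Ω => (Matrix.of fun r c => (z.1 : ℝ)⁻¹ *
        ∑ i ∈ Finset.range z.1, jac m (D.W i z.2) (D.α i z.2) μ₀ r c :
          Matrix (Fin q) (Fin k) ℝ)) (wpa P) (𝓝 G) := by
      refine tendsto_pi_nhds.2 fun r => tendsto_pi_nhds.2 fun c => ?_
      have h4 := tendsto_mean_of_isDataFun hs hrange
        (f := fun i ω => jac m (D.W i ω) (D.α i ω) μ₀ r c)
        ((hunit.comp_continuous (c := fun T : Vec k →L[ℝ] Vec q =>
          T (EuclideanSpace.single c 1) r) (by fun_prop)).isDataFun) (hG.G_exists 0 r c)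
      rw [← hG.G_eq 0 r c] at h4
      simpa using h4
    refine ((continuous_clmOfMatrix.tendsto _).comp h3).congr fun z => ?_
    simp only [Function.comp]
    conv_rhs => rw [← clmOfMatrix_entries ((z.1 : ℝ)⁻¹ •
      ∑ i ∈ Finset.range z.1, dμ m (D.W i z.2) (D.α i z.2) μ₀)]
    congr 1
    ext r c
    simp [jac]
  have h3 : Tendsto (fun z => ∑ l, foldAvg A l (fun i z => √(F i z.2) *
      |A.αhat D z.1 l i z.2 - D.α i z.2|) z) (wpa P) (𝓝 0) := by
    simpa using tendsto_finsetSum Finset.univ fun l _ =>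
      tendsto_foldAvg_abs_αhat hA hrate halpha hs hF (hFi 0) hF0 l
  have h4 := h3.add (tendsto_iff_norm_sub_tendsto_zero.1 h2)
  rw [add_zero] at h4
  refine ⟨c, ∫ ω, Fα 0 ω ∂P + 1, _, hc, by
    have : 0 ≤ ∫ ω, Fα 0 ω ∂P := integral_nonneg fun ω => hFα0 0 ω
    linarith, h4, ?_⟩
  filter_upwards [eventually_wpa_of_ae (p := fun z => ∀ i s, ∀ μ ∈ Metric.ball μ₀ ρ,
        ‖dμ m (D.W i z.2) s μ - dμ m (D.W i z.2) (D.α i z.2) μ₀‖ ≤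
          √(F i z.2) * |s - D.α i z.2| + Fα i z.2 * ‖μ - μ₀‖ ^ c) (Eventually.of_forall fun _ => hb),
    h1.eventually (ge_mem_nhds (lt_add_one (∫ ω, Fα 0 ω ∂P)))] with z hz hK μ hμ
  rw [Finset.card_range] at hK
  -- The Jacobian at `(α_i, μ₀)` is inserted. Its average obeys the law of large numbers and the
  -- rest is bounded term by term, uniformly in `μ`.
  have h5 : sampleJac D A m z μ - clmOfMatrix G = (z.1 : ℝ)⁻¹ • (∑ l, ∑ i ∈ A.fold z.1 l,
      (dμ m (D.W i z.2) (A.αhat D z.1 l i z.2) μ - dμ m (D.W i z.2) (D.α i z.2) μ₀)) +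
      ((z.1 : ℝ)⁻¹ • ∑ i ∈ Finset.range z.1, dμ m (D.W i z.2) (D.α i z.2) μ₀ - clmOfMatrix G) := by
    rw [← sum_folds hA z.1 fun i => dμ m (D.W i z.2) (D.α i z.2) μ₀]
    simp only [Finset.sum_sub_distrib, smul_sub, sampleJac]
    abel
  have h6 : ‖∑ l, ∑ i ∈ A.fold z.1 l, (dμ m (D.W i z.2) (A.αhat D z.1 l i z.2) μ -
      dμ m (D.W i z.2) (D.α i z.2) μ₀)‖ ≤ ∑ l, ∑ i ∈ A.fold z.1 l,
      √(F i z.2) * |A.αhat D z.1 l i z.2 - D.α i z.2| +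
      (∑ i ∈ Finset.range z.1, Fα i z.2) * ‖μ - μ₀‖ ^ c := by
    rw [← sum_folds hA z.1 fun i => Fα i z.2, Finset.sum_mul, ← Finset.sum_add_distrib]
    refine (norm_sum_le _ _).trans (Finset.sum_le_sum fun l _ => ?_)
    rw [Finset.sum_mul, ← Finset.sum_add_distrib]
    exact (norm_sum_le _ _).trans (Finset.sum_le_sum fun i _ => hz i _ μ hμ)
  rw [h5]
  refine (norm_add_le _ _).trans ?_
  rw [norm_smul, Real.norm_of_nonneg (by positivity)]
  have h7 := mul_le_mul_of_nonneg_left h6 (show (0 : ℝ) ≤ (z.1 : ℝ)⁻¹ by positivity)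
  rw [mul_add, ← mul_assoc, Finset.mul_sum] at h7
  have h8 := mul_le_mul_of_nonneg_right hK (show 0 ≤ ‖μ - μ₀‖ ^ c by positivity)
  simp only [foldAvg] at h7 ⊢
  linarith

/-- Second moments of integrable i.i.d. variables are of smaller order than the sample size. -/
theorem tendsto_sum_sq_div_sq (hs : Sampling P D) {f : ℕ → Ω → ℝ} (hf : IsDataFun P D f)
    (hfi : Integrable (f 0) P) :
    Tendsto (fun z : ℕ × Ω => ((z.1 : ℝ)⁻¹) ^ 2 * ∑ i ∈ Finset.range z.1, f i z.2 ^ 2) (wpa P)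
      (𝓝 0) := by
  rw [Metric.tendsto_nhds]
  intro ε hε
  -- Beyond `K`, squares are summed through `∑ t² ≤ (∑ t)²`, so a first moment suffices. With a tail
  -- of `√(ε/8)` the average of `t` is eventually at most twice that, and its square is at most
  -- `ε/2`.
  obtain ⟨K, hK, htail⟩ := exists_tail_le hfi (√(ε / 8)) (by positivity)
  have hrange : Tendsto (fun N => (Finset.range N).card) atTop atTop := by
    simp only [Finset.card_range]; exact tendsto_id
  set t : ℝ → ℝ := {x | K < |x|}.indicator fun x => |x|
  have htm : Measurable t := measurable_abs.indicator (measurableSet_lt measurable_const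
    measurable_abs)
  have ht : ∫ ω, t (f 0 ω) ∂P ≤ √(ε / 8) := by
    refine le_trans (le_of_eq ?_) htail
    rw [← integral_indicator₀ (nullMeasurableSet_lt aemeasurable_const hfi.1.aemeasurable.abs)]
    rfl
  have hti : Integrable (fun ω => t (f 0 ω)) P :=
    hfi.mono ((htm.comp_aemeasurable hfi.1.aemeasurable).aestronglyMeasurable)
      (Eventually.of_forall fun ω => (norm_indicator_le_norm_self _ _).trans (by simp))
  have h1 := tendsto_mean_of_isDataFun hs hrange (hf.comp htm) hti
  have h2 : Tendsto (fun z : ℕ × Ω => (z.1 : ℝ)⁻¹ * K ^ 2) (wpa P) (𝓝 0) := by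
    have := (tendsto_inv_atTop_nhds_zero_nat (𝕜 := ℝ)).mul_const (K ^ 2)
    rw [zero_mul] at this
    exact tendsto_wpa_of_atTop (P := P) (f := fun N : ℕ => (N : ℝ)⁻¹ * K ^ 2) this
  have hs8 : 0 < √(ε / 8) := by positivity
  filter_upwards [h1.eventually (ge_mem_nhds (lt_of_le_of_lt ht (show √(ε / 8) < 2 * √(ε / 8) by
    linarith))), h2.eventually (gt_mem_nhds (show 0 < ε / 4 by positivity)),
    eventually_wpa_of_atTop (eventually_gt_atTop 0)] with z hz1 hz2 hz0
  have h0 : (0 : ℝ) < z.1 := by exact_mod_cast hz0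
  rw [Finset.card_range] at hz1
  rw [Real.dist_eq, sub_zero, abs_of_nonneg (mul_nonneg (by positivity)
    (Finset.sum_nonneg fun i _ => sq_nonneg _))]
  have ht0 : ∀ x, 0 ≤ t x := fun x => Set.indicator_nonneg (fun _ _ => abs_nonneg _) _
  have h3 : ∀ x, x ^ 2 ≤ K ^ 2 + t x ^ 2 := fun x => by
    by_cases hx : K < |x|
    · have : t x = |x| := Set.indicator_of_mem (s := {x | K < |x|}) hx _
      rw [this, sq_abs]
      linarith [sq_nonneg K]
    · have : x ^ 2 ≤ K ^ 2 := by rw [← sq_abs x]; exact pow_le_pow_left₀ (abs_nonneg _) (not_lt.1 hx) 2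
      linarith [sq_nonneg (t x)]
  have h4 : ∑ i ∈ Finset.range z.1, f i z.2 ^ 2 ≤
      z.1 * K ^ 2 + (∑ i ∈ Finset.range z.1, t (f i z.2)) ^ 2 := by
    refine (Finset.sum_le_sum fun i _ => h3 (f i z.2)).trans ?_
    rw [Finset.sum_add_distrib]
    refine add_le_add (by simp) (Finset.sum_sq_le_sq_sum_of_nonneg fun i _ => ht0 _)
  have h5 : ((z.1 : ℝ)⁻¹) ^ 2 * (z.1 * K ^ 2 + (∑ i ∈ Finset.range z.1, t (f i z.2)) ^ 2) =
      (z.1 : ℝ)⁻¹ * K ^ 2 + ((z.1 : ℝ)⁻¹ * ∑ i ∈ Finset.range z.1, t (f i z.2)) ^ 2 := by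
    field_simp
  have h6 : ((z.1 : ℝ)⁻¹ * ∑ i ∈ Finset.range z.1, t (f i z.2)) ^ 2 ≤ ε / 2 := by
    calc _ ≤ (2 * √(ε / 8)) ^ 2 := pow_le_pow_left₀ (mul_nonneg (by positivity)
            (Finset.sum_nonneg fun i _ => ht0 _)) hz1 2
      _ = ε / 2 := by rw [mul_pow, Real.sq_sqrt (by positivity)]; ring
  have h7 := mul_le_mul_of_nonneg_left h4 (show (0 : ℝ) ≤ ((z.1 : ℝ)⁻¹) ^ 2 by positivity)
  linarith

end Jacobian

end OrthMoment

namespace OrthMoment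

/-! ### The orthogonal moments -/

section OrthogonalMoments

open scoped Matrix

variable {Ω : Type*} [MeasurableSpace Ω] {P : Measure Ω} [IsProbabilityMeasure P]
  {d p k q L : ℕ} {D : Panel Ω d p} {A : Procedure Ω p k q L}
  {m : Vec d → ℝ → Vec k → Vec q} {β₀ : Vec p} {μ₀ : Vec k} {g ρ : ℝ} {Θ : Set (Vec k)}
  {Om : Matrix (Fin q) (Fin q) ℝ}

theorem memLp_mstar (hOm : OmegaAssumption P D A m β₀ μ₀ ρ Om) (N i : ℕ) :
    MemLp (D.mstar P m β₀ μ₀ (A.T N) i) 2 P :=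
  (hOm.mstar_sq i).memLp N

theorem exists_mstar_tail_le (hOm : OmegaAssumption P D A m β₀ μ₀ ρ Om) (ε : ℝ) (hε : 0 < ε) :
    ∃ K : ℝ, 0 ≤ K ∧ ∀ N, ∫ ω in {ω | K < ‖D.mstar P m β₀ μ₀ (A.T N) 0 ω‖},
      ‖D.mstar P m β₀ μ₀ (A.T N) 0 ω‖ ^ 2 ∂P ≤ ε := by
  -- Uniform integrability bounds the `L²` norm of the tail, while the claim concerns its square;
  -- hence the root.
  obtain ⟨C, hC⟩ := (hOm.mstar_sq 0).spec (by simp) (by simp) (Real.sqrt_pos.2 hε)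
  refine ⟨C, C.2, fun N => ?_⟩
  set f := D.mstar P m β₀ μ₀ (A.T N) 0
  have hf : AEStronglyMeasurable f P := (memLp_mstar hOm N 0).1
  have h1 : NullMeasurableSet {ω | (C : ℝ) < ‖f ω‖} P :=
    nullMeasurableSet_lt aemeasurable_const hf.norm.aemeasurable
  have h3 : AEStronglyMeasurable (fun ω => ‖f ω‖ ^ 2) P := hf.norm.pow 2
  rw [integral_eq_lintegral_of_nonneg_ae (Eventually.of_forall fun ω => by positivity) h3.restrict]
  refine ENNReal.toReal_le_of_le_ofReal hε.le ?_
  have h2 := pow_le_pow_left₀ zero_le (hC N) 2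
  rw [← ENNReal.ofReal_pow (by positivity), Real.sq_sqrt hε.le] at h2
  refine le_trans ?_ ((lintegral_enorm_pow_eq _ two_ne_zero).trans_le h2)
  rw [← lintegral_indicator₀ h1]
  refine lintegral_mono fun ω => ?_
  by_cases h : (C : ℝ) < ‖f ω‖
  · rw [Set.indicator_of_mem (show ω ∈ {ω | (C : ℝ) < ‖f ω‖} from h),
      Set.indicator_of_mem (show ω ∈ {ω | C ≤ ‖f ω‖₊} from NNReal.coe_le_coe.1 h.le)]
    rw [ENNReal.ofReal_pow (norm_nonneg _), ofReal_norm]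
  · rw [Set.indicator_of_notMem (show ω ∉ {ω | (C : ℝ) < ‖f ω‖} from h)]
    exact zero_le

/-- `a_i` depends on `α_i` and `X_i1, …, X_iT` only, all of which belong to the conditioning set of
sequential exogeneity at `T`. -/
theorem integral_mstar (hs : Sampling P D) (hA : A.IsValid D m P Θ)
    (hmodel : ModelAssumption P D m β₀ μ₀) (hrate : RateAssumption P D A m β₀ μ₀ g) (N i : ℕ) :
    ∫ ω, D.mstar P m β₀ μ₀ (A.T N) i ω ∂P = 0 := by
  have hT : 1 ≤ A.T N := one_le_two.trans (hA.two_le_T N)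
  have hu := hmodel.sq_integrable i _ hT
  have ha := hrate.a_sq N i
  have hau : Integrable (fun ω => D.u β₀ i (A.T N) ω • D.a P m μ₀ (A.T N) i ω) P :=
    memLp_one_iff_integrable.1 (ha.smul hu)
  have hle : D.sigXα (A.T N) i ≤ D.sigPast i (A.T N) := by
    refine sup_le (le_sup_right.trans le_sup_left) (iSup₂_le fun t ht => ?_)
    rw [Finset.mem_Icc] at ht
    rcases ht.2.eq_or_lt with h | h
    · rw [h]; exact le_sup_left.trans le_sup_left
    · exact le_trans (le_sup_right.trans (le_iSup₂_of_le (f := fun s _ =>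
        (MeasurableSpace.comap (D.Y i s) inferInstance ⊔
          MeasurableSpace.comap (D.X i s) inferInstance)) t (Finset.mem_Ico.2 ⟨ht.1, h⟩) le_rfl))
        le_sup_right
  have h1 : ∫ ω, D.u β₀ i (A.T N) ω • D.a P m μ₀ (A.T N) i ω ∂P = 0 := by
    ext r
    have h2 : ∫ ω, D.u β₀ i (A.T N) ω * D.a P m μ₀ (A.T N) i ω r ∂P =
        (∫ ω, D.u β₀ i (A.T N) ω • D.a P m μ₀ (A.T N) i ω ∂P) r := by
      simpa using (EuclideanSpace.proj r : Vec q →L[ℝ] ℝ).integral_comp_comm hau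
    have h3 : AEStronglyMeasurable[D.sigPast i (A.T N)] (fun ω => D.a P m μ₀ (A.T N) i ω r) P :=
      ((EuclideanSpace.proj r : Vec q →L[ℝ] ℝ).continuous.comp_stronglyMeasurable
        (stronglyMeasurable_condExp.mono hle)).aestronglyMeasurable
    have h4 := integral_mul_eq_zero_of_condExp
      ((sigPast_le_sigUnit i _).trans (hs.sigUnit_le i)) h3 (hu.integrable one_le_two)
      (by
        have := (EuclideanSpace.proj r : Vec q →L[ℝ] ℝ).integrable_comp hau
        refine this.congr (Eventually.of_forall fun ω => ?_)
        simp [mul_comm])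
      (hmodel.exogenous i _ hT)
    rw [← h2]
    simp_rw [mul_comm (D.u β₀ i (A.T N) _)]
    simpa using h4
  simp only [Panel.mstar]
  rw [integral_add (hmodel.integrable i) hau, hmodel.moment i, h1, add_zero]

/-- A limit of second-moment matrices, whose quadratic forms are expectations of squares. -/
theorem posSemidef_Om (hOm : OmegaAssumption P D A m β₀ μ₀ ρ Om) : Om.PosSemidef := by
  rw [Matrix.posSemidef_iff_dotProduct_mulVec]
  constructor
  · ext r s
    have h1 := hOm.Om_lim 0 s r
    have h2 := hOm.Om_lim 0 r s
    simp only [outer, Matrix.of_apply, mul_comm] at h1 h2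
    rw [Matrix.conjTranspose_apply, star_trivial]
    refine tendsto_nhds_unique h1 ?_
    simpa only [mul_comm] using h2
  · intro x
    have h1 : Tendsto (fun N => ∑ r, ∑ s, x r * x s *
        ∫ ω, outer (D.mstar P m β₀ μ₀ (A.T N) 0 ω) r s ∂P) atTop
        (𝓝 (∑ r, ∑ s, x r * x s * Om r s)) :=
      tendsto_finsetSum _ fun r _ => tendsto_finsetSum _ fun s _ => (hOm.Om_lim 0 r s).const_mul _
    have h2 : star x ⬝ᵥ (Om *ᵥ x) = ∑ r, ∑ s, x r * x s * Om r s := by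
      simp only [dotProduct, Matrix.mulVec, Finset.mul_sum, Pi.star_apply, star_trivial]
      exact Finset.sum_congr rfl fun r _ => Finset.sum_congr rfl fun s _ => by ring
    rw [h2]
    refine ge_of_tendsto' h1 fun N => ?_
    have h3 := integral_inner_sq (memLp_mstar hOm N 0) (WithLp.toLp 2 x)
    rw [← h3]
    exact integral_nonneg fun ω => sq_nonneg _

/-- The normalized sum of the orthogonal moments. -/
noncomputable def mstarSum (P : Measure Ω) (D : Panel Ω d p) (A : Procedure Ω p k q L)
    (m : Vec d → ℝ → Vec k → Vec q) (β₀ : Vec p) (μ₀ : Vec k) (N : ℕ) (ω : Ω) : Vec q :=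
  (√(N : ℝ))⁻¹ • ∑ i ∈ Finset.range N, D.mstar P m β₀ μ₀ (A.T N) i ω

theorem tendstoInDistribution_mstarSum (hs : Sampling P D) (hA : A.IsValid D m P Θ)
    (hmodel : ModelAssumption P D m β₀ μ₀) (hrate : RateAssumption P D A m β₀ μ₀ g)
    (hmom : MomentAssumption P D A m β₀ μ₀) (hOm : OmegaAssumption P D A m β₀ μ₀ ρ Om) :
    TendstoInDistribution (mstarSum P D A m β₀ μ₀) atTop id (fun _ => P)
      (multivariateGaussian 0 Om) :=
  clt_array (ξ := fun N i => D.mstar P m β₀ μ₀ (A.T N) i)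
    (fun _ => (isDataFun_mstar hs hmodel hrate hmom _).iIndepFun hs)
    (fun _ i => (isDataFun_mstar hs hmodel hrate hmom _).identDistrib hs i)
    (fun N => memLp_mstar hOm N 0) (fun N => integral_mstar hs hA hmodel hrate N 0)
    (exists_mstar_tail_le hOm) (hOm.Om_lim 0) (posSemidef_Om hOm)

theorem exists_lintegral_mstar_le (hs : Sampling P D) (hmodel : ModelAssumption P D m β₀ μ₀)
    (hrate : RateAssumption P D A m β₀ μ₀ g) (hmom : MomentAssumption P D A m β₀ μ₀)
    (hOm : OmegaAssumption P D A m β₀ μ₀ ρ Om) :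
    ∃ C : ℝ≥0∞, C ≠ ∞ ∧ ∀ N i, ∫⁻ ω, ‖D.mstar P m β₀ μ₀ (A.T N) i ω‖ₑ ^ 2 ∂P ≤ C := by
  obtain ⟨-, -, C, hC⟩ := hOm.mstar_sq 0
  refine ⟨(C : ℝ≥0∞) ^ 2, by simp, fun N i => ?_⟩
  rw [((isDataFun_mstar hs hmodel hrate hmom (A.T N)).comp (c := fun x : Vec q => ‖x‖ₑ ^ 2)
    (by fun_prop)).lintegral_eq hs i, lintegral_enorm_pow_eq _ two_ne_zero]
  exact pow_le_pow_left₀ zero_le (by simpa using hC N) 2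

theorem tight_foldAvg_mstar (hs : Sampling P D) (hA : A.IsValid D m P Θ)
    (hmodel : ModelAssumption P D m β₀ μ₀) (hrate : RateAssumption P D A m β₀ μ₀ g)
    (hmom : MomentAssumption P D A m β₀ μ₀) (hOm : OmegaAssumption P D A m β₀ μ₀ ρ Om)
    (l : Fin L) :
    Tight (wpa P) (foldAvg A l fun i z => ‖D.mstar P m β₀ μ₀ (A.T z.1) i z.2‖ ^ 2) :=
  tight_foldAvg_norm_pow (f := fun N i => D.mstar P m β₀ μ₀ (A.T N) i) hA 2
    (fun N i => (memLp_mstar hOm N i).1) (exists_lintegral_mstar_le hs hmodel hrate hmom hOm) l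

/-- By independence and mean zero, the second moment of the normalized sum is the average of bounded
second moments. -/
theorem tight_mstarSum (hs : Sampling P D) (hA : A.IsValid D m P Θ)
    (hmodel : ModelAssumption P D m β₀ μ₀) (hrate : RateAssumption P D A m β₀ μ₀ g)
    (hmom : MomentAssumption P D A m β₀ μ₀) (hOm : OmegaAssumption P D A m β₀ μ₀ ρ Om) :
    Tight (wpa P) fun z => ‖mstarSum P D A m β₀ μ₀ z.1 z.2‖ := by
  obtain ⟨C, hC, h⟩ := exists_lintegral_mstar_le hs hmodel hrate hmom hOm
  have hdat := fun N => isDataFun_mstar (A := A) hs hmodel hrate hmom (A.T N)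
  have h1 : Tight (wpa P) fun z => ‖mstarSum P D A m β₀ μ₀ z.1 z.2‖ ^ 2 := by
    refine tight_of_lintegral_le (f := fun N ω => ‖mstarSum P D A m β₀ μ₀ N ω‖ ^ 2) hC
      (fun N => ?_) ?_
    · have hm : AEStronglyMeasurable (mstarSum P D A m β₀ μ₀ N) P :=
        AEStronglyMeasurable.fun_const_smul (Finset.aestronglyMeasurable_fun_sum _ fun i _ =>
          (memLp_mstar hOm N i).1) _
      exact hm.norm.aemeasurable.pow_const 2
    · filter_upwards [eventually_gt_atTop 0] with N hN
      have h0 : (0 : ℝ) < N := by exact_mod_cast hN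
      have h2 := lintegral_norm_sum_sq_of_orthogonal (P := P) (Finset.range N)
        (fun i _ => memLp_mstar hOm N i)
        (fun i _ j _ hij => integral_inner_eq_zero_of_indepFun
          (((hdat N).iIndepFun hs).indepFun hij) (memLp_mstar hOm N i) (memLp_mstar hOm N j)
          (integral_mstar hs hA hmodel hrate N i))
      simp only [mstarSum, enorm_pow, enorm_norm, enorm_smul, mul_pow]
      rw [lintegral_const_mul' _ _ (by simp), h2]
      refine (mul_le_mul_right (Finset.sum_le_sum fun i _ => h N i) _).trans ?_
      rw [Finset.sum_const, Finset.card_range, nsmul_eq_mul, ← mul_assoc]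
      refine mul_le_of_le_one_left zero_le ?_
      rw [Real.enorm_of_nonneg (by positivity), ← ENNReal.ofReal_pow (by positivity),
        ← ENNReal.ofReal_natCast, ← ENNReal.ofReal_mul (by positivity), inv_pow,
        Real.sq_sqrt h0.le, inv_mul_cancel₀ h0.ne']
      simp
  refine h1.sqrt.congr (Eventually.of_forall fun z => ?_)
  exact Real.sqrt_sq (norm_nonneg _)

theorem tendsto_mean_outer_mstar (hs : Sampling P D)
    (hmodel : ModelAssumption P D m β₀ μ₀) (hrate : RateAssumption P D A m β₀ μ₀ g)
    (hmom : MomentAssumption P D A m β₀ μ₀) (hOm : OmegaAssumption P D A m β₀ μ₀ ρ Om)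
    (r s : Fin q) :
    Tendsto (fun z : ℕ × Ω => (z.1 : ℝ)⁻¹ *
      ∑ i ∈ Finset.range z.1, outer (D.mstar P m β₀ μ₀ (A.T z.1) i z.2) r s) (wpa P)
      (𝓝 (Om r s)) := by
  have hdat := fun N => (isDataFun_mstar (A := A) hs hmodel hrate hmom (A.T N)).comp
    (c := fun v : Vec q => outer v r s) (by simp only [outer, Matrix.of_apply]; fun_prop)
  have h1 := weak_law_array (S := fun N => Finset.range N)
    (ξ := fun N i ω => outer (D.mstar P m β₀ μ₀ (A.T N) i ω) r s)
    (by simp only [Finset.card_range]; exact tendsto_id)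
    (fun N => integrable_outer (memLp_mstar hOm N 0) r s)
    (fun N i j hij => ((hdat N).iIndepFun hs).indepFun hij)
    (fun N i => (hdat N).identDistrib hs i) (fun ε hε => by
      obtain ⟨K, hK, h⟩ := exists_mstar_tail_le (A := A) hOm ε hε
      -- Entries of the outer product are at most `‖v‖²`, so exceeding `K²` forces `‖v‖ > K`.
      refine ⟨K ^ 2, by positivity, fun N => le_trans ?_ (h N)⟩
      set v := D.mstar P m β₀ μ₀ (A.T N) 0
      have hv : MemLp v 2 P := memLp_mstar hOm N 0
      have hi : Integrable (fun ω => ‖v ω‖ ^ 2) P := hv.integrable_norm_pow two_ne_zero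
      calc ∫ ω in {ω | K ^ 2 < |outer (v ω) r s|}, |outer (v ω) r s| ∂P
          ≤ ∫ ω in {ω | K ^ 2 < |outer (v ω) r s|}, ‖v ω‖ ^ 2 ∂P :=
            integral_mono_ae (integrable_outer hv r s).abs.integrableOn hi.integrableOn
              (Eventually.of_forall fun ω => abs_outer_le _ r s)
        _ ≤ _ := by
            refine setIntegral_mono_set hi.integrableOn
              (Eventually.of_forall fun ω => by positivity) (Eventually.of_forall fun ω hω => ?_)
            exact lt_of_pow_lt_pow_left₀ 2 (norm_nonneg _) (lt_of_lt_of_le hω (abs_outer_le _ r s)))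
  have h2 := h1.add (tendsto_wpa_of_atTop (P := P) (hOm.Om_lim 0 r s))
  simpa using h2

theorem abs_outer_sub_le (v w : Vec q) (r s : Fin q) :
    |outer w r s - outer v r s| ≤ ‖w - v‖ ^ 2 + 2 * (‖v‖ * ‖w - v‖) := by
  have h : ∀ (x : Vec q) (r : Fin q), |x r| ≤ ‖x‖ := fun x r => PiLp.norm_apply_le x r
  have h1 : outer w r s - outer v r s =
      (w - v) r * (w - v) s + v r * (w - v) s + (w - v) r * v s := by
    simp [outer]; ring
  rw [h1]
  refine (abs_add_le _ _).trans ((add_le_add_left (abs_add_le _ _) _).trans ?_)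
  simp only [abs_mul]
  have h2 := mul_le_mul (h (w - v) r) (h (w - v) s) (abs_nonneg _) (norm_nonneg _)
  have h3 := mul_le_mul (h v r) (h (w - v) s) (abs_nonneg _) (norm_nonneg _)
  have h4 := mul_le_mul (h (w - v) r) (h v s) (abs_nonneg _) (norm_nonneg _)
  nlinarith

/-- Consistency of the estimated second-moment matrix, given that the error of the preliminary
estimates is negligible in mean square. -/
theorem tendsto_secondMoment (hs : Sampling P D) (hA : A.IsValid D m P Θ)
    (hmodel : ModelAssumption P D m β₀ μ₀) (hrate : RateAssumption P D A m β₀ μ₀ g)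
    (halpha : FixedEffectAssumption P D A m β₀ μ₀ g) (hmom : MomentAssumption P D A m β₀ μ₀)
    (hOm : OmegaAssumption P D A m β₀ μ₀ ρ Om) {ν : Fin L → ℕ × Ω → Vec k}
    (hν : ∀ l, Tendsto (foldAvg A l fun i z => ‖m (D.W i z.2) (A.αhat D z.1 l i z.2) (ν l z) -
      m (D.W i z.2) (A.αhat D z.1 l i z.2) μ₀‖ ^ 2) (wpa P) (𝓝 0)) :
    Tendsto (fun z : ℕ × Ω => A.secondMoment D m z.1 z.2 fun l => ν l z) (wpa P) (𝓝 Om) := by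
  refine tendsto_pi_nhds.2 fun r => tendsto_pi_nhds.2 fun s => ?_
  have h0 := tendsto_mean_outer_mstar hs hmodel hrate hmom hOm r s
  set w : Fin L → ℕ → ℕ × Ω → Vec q := fun l i z =>
    m (D.W i z.2) (A.αhat D z.1 l i z.2) (ν l z) + A.ψ D z.1 l i z.2
  set v : ℕ → ℕ × Ω → Vec q := fun i z => D.mstar P m β₀ μ₀ (A.T z.1) i z.2
  -- The difference is the plug-in error of `ν` plus the moment gap at `μ₀`, both small in mean
  -- square.
  have h1 : ∀ l, Tendsto (foldAvg A l fun i z => ‖w l i z - v i z‖ ^ 2) (wpa P) (𝓝 0) := by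
    intro l
    have h2 := ((hν l).add (tendsto_foldAvg_momentGap_sq hs hA hmodel hrate halpha hmom l)).const_mul 2
    simp only [add_zero, mul_zero] at h2
    refine squeeze_zero (fun z => foldAvg_nonneg fun i => by positivity) (fun z => ?_) h2
    rw [← foldAvg_add, ← foldAvg_const_mul (fun _ => 2)]
    refine foldAvg_mono fun i _ => ?_
    refine le_trans (pow_le_pow_left₀ (norm_nonneg _) (le_trans (le_of_eq ?_) (norm_add_le _ _)) 2)
      (add_sq_le (a := ‖_‖) (b := ‖_‖))
    congr 1
    simp only [w, v, momentGap]
    abel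
  have h2 : ∀ l, Tendsto (foldAvg A l fun i z => ‖v i z‖ * ‖w l i z - v i z‖) (wpa P) (𝓝 0) := by
    intro l
    have h3 := (Real.continuous_sqrt.tendsto 0).comp (h1 l)
    rw [Real.sqrt_zero] at h3
    refine squeeze_zero (fun z => foldAvg_nonneg fun i => by positivity)
      (fun z => foldAvg_mul_le_sqrt.trans (le_of_eq (mul_comm _ _)))
      ((tight_foldAvg_mstar hs hA hmodel hrate hmom hOm l).sqrt _ h3)
  have h3 : Tendsto (fun z => ∑ l, (foldAvg A l (fun i z => ‖w l i z - v i z‖ ^ 2) z +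
      2 * foldAvg A l (fun i z => ‖v i z‖ * ‖w l i z - v i z‖) z)) (wpa P) (𝓝 0) := by
    simpa using tendsto_finsetSum Finset.univ fun l _ => (h1 l).add ((h2 l).const_mul 2)
  refine h0.congr_dist (squeeze_zero (fun _ => dist_nonneg) (fun z => ?_) h3)
  rw [dist_comm, Real.dist_eq, ← sum_folds hA z.1 fun i => outer (v i z) r s]
  have h4 : A.secondMoment D m z.1 z.2 (fun l => ν l z) r s =
      (z.1 : ℝ)⁻¹ * ∑ l, ∑ i ∈ A.fold z.1 l, outer (w l i z) r s := by
    simp [Procedure.secondMoment, Matrix.sum_apply, w]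
  rw [h4, ← mul_sub, ← Finset.sum_sub_distrib, abs_mul, abs_of_nonneg (by positivity)]
  have h5 : |∑ l, (∑ i ∈ A.fold z.1 l, outer (w l i z) r s - ∑ i ∈ A.fold z.1 l, outer (v i z) r s)| ≤
      ∑ l, ∑ i ∈ A.fold z.1 l, (‖w l i z - v i z‖ ^ 2 + 2 * (‖v i z‖ * ‖w l i z - v i z‖)) := by
    refine (Finset.abs_sum_le_sum_abs _ _).trans (Finset.sum_le_sum fun l _ => ?_)
    rw [← Finset.sum_sub_distrib]
    exact (Finset.abs_sum_le_sum_abs _ _).trans (Finset.sum_le_sum fun i _ => abs_outer_sub_le _ _ _ _)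
  refine (mul_le_mul_of_nonneg_left h5 (by positivity)).trans (le_of_eq ?_)
  rw [Finset.mul_sum]
  refine Finset.sum_congr rfl fun l _ => ?_
  simp only [foldAvg, Finset.sum_add_distrib, ← Finset.mul_sum]
  ring

end OrthogonalMoments

end OrthMoment

namespace OrthMoment

/-! ### Plugging in estimates of the parameter -/

section PlugIn

variable {Ω : Type*} [MeasurableSpace Ω] {P : Measure Ω} [IsProbabilityMeasure P]
  {d p k q L : ℕ} {D : Panel Ω d p} {A : Procedure Ω p k q L}
  {m : Vec d → ℝ → Vec k → Vec q} {β₀ : Vec p} {μ₀ : Vec k} {g ρ : ℝ} {Θ : Set (Vec k)}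
  {G : Matrix (Fin q) (Fin k) ℝ} {Om : Matrix (Fin q) (Fin q) ℝ}

theorem integrable_sum_smul {F : Type*} [NormedAddCommGroup F] [NormedSpace ℝ F]
    {f : Ω → Matrix (Fin q) (Fin k) ℝ} (hf : ∀ r c, Integrable (fun ω => f ω r c) P)
    (E : Fin k → Fin q → F) : Integrable (fun ω => ∑ c, ∑ r, f ω r c • E c r) P :=
  integrable_finsetSum _ fun c _ => integrable_finsetSum _ fun r _ => (hf r c).smul_const (E c r)

theorem integrable_dμ (hG : JacobianAssumption P D m μ₀ ρ G) (i : ℕ) :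
    Integrable (fun ω => dμ m (D.W i ω) (D.α i ω) μ₀) P := by
  have h1 := integrable_sum_smul (f := fun ω => jac m (D.W i ω) (D.α i ω) μ₀) (hG.G_exists i)
    fun c r => (EuclideanSpace.proj c : Vec k →L[ℝ] ℝ).smulRight
      (EuclideanSpace.single r (1 : ℝ) : Vec q)
  refine h1.congr (Eventually.of_forall fun ω => ?_)
  exact (clmOfMatrix_eq_sum _).symm.trans (clmOfMatrix_entries _)

theorem norm_moment_sub_le {w : Vec d} {s B : ℝ} {ν : Vec k} (hν : ν ∈ Metric.ball μ₀ ρ)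
    (hdiff : ∀ μ ∈ Metric.ball μ₀ ρ, DifferentiableAt ℝ (fun ν => m w s ν) μ)
    (hB : ∀ μ ∈ Metric.ball μ₀ ρ, ‖dμ m w s μ‖ ≤ B) :
    ‖m w s ν - m w s μ₀‖ ≤ B * ‖ν - μ₀‖ :=
  (convex_ball μ₀ ρ).norm_image_sub_le_of_norm_fderiv_le hdiff hB
    (Metric.mem_ball_self (dist_nonneg.trans_lt (Metric.mem_ball.1 hν))) hν

theorem tight_foldAvg_of_isDataFun (hs : Sampling P D) (hA : A.IsValid D m P Θ) {F : ℕ → Ω → ℝ}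
    (hF : IsDataFun P D F) (hFi : Integrable (F 0) P) (l : Fin L) :
    Tight (wpa P) (foldAvg A l fun i z => F i z.2) :=
  tight_foldAvg (f := fun _ i => F i) hA hFi.2.ne (fun _ i => hF.aemeasurable hs i)
    (fun _ i => (((hF.comp (c := fun x : ℝ => ‖x‖ₑ) (by fun_prop)).lintegral_eq hs i)).le) l

/-- Estimates at rate `N^{-1/2}` may be plugged into the moment function. -/
theorem tendsto_foldAvg_moment_sub_of_tight (hs : Sampling P D) (hA : A.IsValid D m P Θ)
    (hmodel : ModelAssumption P D m β₀ μ₀) (hrate : RateAssumption P D A m β₀ μ₀ g)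
    (halpha : FixedEffectAssumption P D A m β₀ μ₀ g) (hρ : 0 < ρ)
    (hOm : OmegaAssumption P D A m β₀ μ₀ ρ Om) (hG : JacobianAssumption P D m μ₀ ρ G)
    {ν : ℕ × Ω → Vec k} (hν : Tendsto ν (wpa P) (𝓝 μ₀))
    (hνt : Tight (wpa P) fun z => √(z.1 : ℝ) * ‖ν z - μ₀‖) (l : Fin L) :
    Tendsto (foldAvg A l fun i z => ‖m (D.W i z.2) (A.αhat D z.1 l i z.2) (ν z) -
      m (D.W i z.2) (A.αhat D z.1 l i z.2) μ₀‖ ^ 2) (wpa P) (𝓝 0) := by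
  obtain ⟨c, F, Fα, hc, hF, hFα, hFi, hFαi, hF0, hFα0, hb⟩ := eventually_dμ_sub_le hOm hG
  -- An envelope of the Jacobian at `α_i` over the ball; it is integrable but perhaps not square
  -- integrable.
  set ξ : ℕ → Ω → ℝ := fun i ω => ‖dμ m (D.W i ω) (D.α i ω) μ₀‖ + Fα i ω * ρ ^ c
  have hunit : IsUnitFun P D fun i ω => dμ m (D.W i ω) (D.α i ω) μ₀ := by
    simpa using isUnitFun_dμ hmodel.meas (μ := μ₀)
      (fun i => by
        filter_upwards [hOm.dμ_exists i] with ω h s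
        exact h s μ₀ (Metric.mem_ball_self hρ)) 0
  have hξ : IsDataFun P D ξ :=
    ((hunit.comp_continuous continuous_norm).isDataFun.prodMk hFα).comp
      (c := fun x : ℝ × ℝ => x.1 + x.2 * ρ ^ c) (by fun_prop)
  have hξi : Integrable (ξ 0) P := (integrable_dμ hG 0).norm.add ((hFαi 0).mul_const _)
  have hξ0 : ∀ i ω, 0 ≤ ξ i ω := fun i ω =>
    add_nonneg (norm_nonneg _) (mul_nonneg (hFα0 i ω) (by positivity))
  have hν2 := hνt.mul hνt
  -- The rate of `ν` provides a factor `1/N`, and `N⁻² ∑ ξ_i²` vanishes under a first moment alone.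
  have h1 := (hν2 _ (tendsto_sum_sq_div_sq hs hξ hξi)).const_mul 2
  have h2 := ((tight_foldAvg_of_isDataFun hs hA hF (hFi 0) l).mul hν2 _
    (tendsto_foldAvg_αhat hA hrate halpha l)).const_mul 2
  have h3 := h1.add h2
  simp only [mul_zero, add_zero] at h3
  refine squeeze_zero' (Eventually.of_forall fun z => foldAvg_nonneg fun i => by positivity) ?_ h3
  filter_upwards [eventually_wpa_of_ae (p := fun z => ∀ i s, ∀ μ ∈ Metric.ball μ₀ ρ,
        ‖dμ m (D.W i z.2) s μ - dμ m (D.W i z.2) (D.α i z.2) μ₀‖ ≤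
          √(F i z.2) * |s - D.α i z.2| + Fα i z.2 * ‖μ - μ₀‖ ^ c) (Eventually.of_forall fun _ => hb),
    eventually_wpa_of_forall_ae (p := fun _ ω => ∀ i, ∀ s, ∀ μ ∈ Metric.ball μ₀ ρ,
      DifferentiableAt ℝ (fun ν => m (D.W i ω) s ν) μ) (fun _ => ae_all_iff.2 hOm.dμ_exists),
    hν.eventually (Metric.ball_mem_nhds _ hρ),
    eventually_wpa_of_atTop (eventually_gt_atTop 0)] with z hz hdiff hball hz0
  have h0 : (0 : ℝ) < z.1 := by exact_mod_cast hz0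
  set Δ : ℕ → ℕ × Ω → ℝ := fun i z => A.αhat D z.1 l i z.2 - D.α i z.2 with hΔ
  have h4 : ∀ i ∈ A.fold z.1 l, ‖m (D.W i z.2) (A.αhat D z.1 l i z.2) (ν z) -
      m (D.W i z.2) (A.αhat D z.1 l i z.2) μ₀‖ ^ 2 ≤
      (2 * ‖ν z - μ₀‖ ^ 2) * (ξ i z.2 ^ 2 + F i z.2 * Δ i z ^ 2) := by
    intro i _
    have h5 := norm_moment_sub_le (m := m) (w := D.W i z.2) (s := A.αhat D z.1 l i z.2)
      (B := ξ i z.2 + √(F i z.2) * |Δ i z|) hball (hdiff i _) (fun μ hμ => by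
        have h6 := hz i (A.αhat D z.1 l i z.2) μ hμ
        have h7 : Fα i z.2 * ‖μ - μ₀‖ ^ c ≤ Fα i z.2 * ρ ^ c := by
          refine mul_le_mul_of_nonneg_left (Real.rpow_le_rpow (norm_nonneg _) ?_ hc.le) (hFα0 i _)
          exact (mem_ball_iff_norm.1 hμ).le
        have h8 := norm_le_norm_add_norm_sub' (dμ m (D.W i z.2) (A.αhat D z.1 l i z.2) μ)
          (dμ m (D.W i z.2) (D.α i z.2) μ₀)
        simp only [ξ, hΔ]
        linarith)
    refine (pow_le_pow_left₀ (norm_nonneg _) h5 2).trans ?_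
    have h9 := add_sq_le (a := ξ i z.2) (b := √(F i z.2) * |Δ i z|)
    rw [mul_pow (√(F i z.2)), Real.sq_sqrt (hF0 _ _), sq_abs] at h9
    rw [mul_pow]
    nlinarith [mul_le_mul_of_nonneg_right h9 (sq_nonneg ‖ν z - μ₀‖)]
  refine (foldAvg_mono (f' := fun i z => (2 * ‖ν z - μ₀‖ ^ 2) * (ξ i z.2 ^ 2 +
    F i z.2 * Δ i z ^ 2)) h4).trans ?_
  rw [foldAvg_const_mul (fun z => 2 * ‖ν z - μ₀‖ ^ 2), foldAvg_add, mul_add]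
  have hsq : √(z.1 : ℝ) * √(z.1 : ℝ) = z.1 := Real.mul_self_sqrt h0.le
  refine add_le_add ?_ ?_
  · have h5 : ∑ i ∈ A.fold z.1 l, ξ i z.2 ^ 2 ≤ ∑ i ∈ Finset.range z.1, ξ i z.2 ^ 2 :=
      Finset.sum_le_sum_of_subset_of_nonneg (fold_subset_range hA _ _) fun i _ _ => sq_nonneg _
    calc 2 * ‖ν z - μ₀‖ ^ 2 * foldAvg A l (fun i z => ξ i z.2 ^ 2) z
        ≤ 2 * ‖ν z - μ₀‖ ^ 2 * ((z.1 : ℝ)⁻¹ * ∑ i ∈ Finset.range z.1, ξ i z.2 ^ 2) := by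
          simp only [foldAvg]
          gcongr
      _ = 2 * ((((z.1 : ℝ)⁻¹) ^ 2 * ∑ i ∈ Finset.range z.1, ξ i z.2 ^ 2) *
          ((√(z.1 : ℝ) * √(z.1 : ℝ)) * ‖ν z - μ₀‖ ^ 2)) := by
          rw [hsq]; field_simp
      _ = _ := by ring
  · have h5 := foldAvg_mul_le (A := A) (l := l) (z := z) (f := fun i z => F i z.2)
      (f' := fun i z => Δ i z ^ 2) (fun i => hF0 i _) (fun i => sq_nonneg _)
    refine (mul_le_mul_of_nonneg_left h5 (by positivity)).trans (le_of_eq ?_)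
    conv_lhs => rw [← hsq]
    simp only [hΔ]
    ring

/-- The supremum has a measurable version with finite integral; it is finite almost surely, so
passing to real values loses nothing. -/
theorem exists_isDataFun_iSup_le {F : Type*} [NormedAddCommGroup F] (hs : Sampling P D)
    {f : ℕ → Ω → Vec k → F} (hf : ∀ μ ∈ Metric.ball μ₀ ρ, IsUnitFun P D fun i ω => f i ω μ)
    (hcont : ∀ i, ∀ᵐ ω ∂P, ContinuousOn (f i ω) (Metric.ball μ₀ ρ)) (n : ℕ)
    (hfin : ∫⁻ ω, ⨆ μ ∈ Metric.ball μ₀ ρ, ‖f 0 ω μ‖ₑ ^ n ∂P < ∞) :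
    ∃ S : ℕ → Ω → ℝ, IsDataFun P D S ∧ Integrable (S 0) P ∧ (∀ i ω, 0 ≤ S i ω) ∧
      ∀ᵐ ω ∂P, ∀ i, ∀ μ ∈ Metric.ball μ₀ ρ, ‖f i ω μ‖ ^ n ≤ S i ω := by
  obtain ⟨φ, hφ, h⟩ := exists_measurable_iSup_ball hf hcont n
  have hdat : IsDataFun P D fun i ω => φ (D.W i ω, D.α i ω) :=
    IsDataFun.of_measurable (φ := fun x : UnitData d p => φ (x.1, x.2.1))
      (hφ.comp (measurable_fst.prodMk (measurable_fst.comp measurable_snd)))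
  have hint : ∀ i, ∫⁻ ω, φ (D.W i ω, D.α i ω) ∂P < ∞ := fun i => by
    rw [hdat.lintegral_eq hs i, ← lintegral_congr_ae (h 0)]
    exact hfin
  refine ⟨fun i ω => (φ (D.W i ω, D.α i ω)).toReal, hdat.comp ENNReal.measurable_toReal,
    integrable_toReal_of_lintegral_ne_top (hdat.aemeasurable hs 0) (hint 0).ne,
    fun i ω => ENNReal.toReal_nonneg, ?_⟩
  filter_upwards [ae_all_iff.2 h, ae_all_iff.2 fun i =>
    ae_lt_top' (hdat.aemeasurable hs i) (hint i).ne] with ω h1 h2 i μ hμ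
  have h3 : ‖f i ω μ‖ₑ ^ n ≤ φ (D.W i ω, D.α i ω) := by
    rw [← h1 i]
    exact le_iSup₂ (f := fun μ (_ : μ ∈ Metric.ball μ₀ ρ) => ‖f i ω μ‖ₑ ^ n) μ hμ
  have h4 := ENNReal.toReal_mono (h2 i).ne h3
  simpa using h4

/-- Consistent estimates may be plugged into the moment function if its derivative has a square
integrable envelope. -/
theorem tendsto_foldAvg_moment_sub_of_sup (hs : Sampling P D) (hA : A.IsValid D m P Θ)
    (hmodel : ModelAssumption P D m β₀ μ₀) (hrate : RateAssumption P D A m β₀ μ₀ g)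
    (halpha : FixedEffectAssumption P D A m β₀ μ₀ g) (hρ : 0 < ρ)
    (hOm : OmegaAssumption P D A m β₀ μ₀ ρ Om)
    (hsup : ∀ i, ∫⁻ ω, ⨆ μ ∈ Metric.ball μ₀ ρ, ‖dμ m (D.W i ω) (D.α i ω) μ‖ₑ ^ 2 ∂P < ∞)
    {ν : ℕ × Ω → Vec k} (hν : Tendsto ν (wpa P) (𝓝 μ₀)) (l : Fin L) :
    Tendsto (foldAvg A l fun i z => ‖m (D.W i z.2) (A.αhat D z.1 l i z.2) (ν z) -
      m (D.W i z.2) (A.αhat D z.1 l i z.2) μ₀‖ ^ 2) (wpa P) (𝓝 0) := by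
  have hdiff : ∀ μ ∈ Metric.ball μ₀ ρ, ∀ i, ∀ᵐ ω ∂P, ∀ s,
      DifferentiableAt ℝ (fun ν => m (D.W i ω) s ν) μ := fun μ hμ i => by
    filter_upwards [hOm.dμ_exists i] with ω h s using h s μ hμ
  obtain ⟨S, hS, hSi, hS0, hSb⟩ := exists_isDataFun_iSup_le (μ₀ := μ₀) (ρ := ρ) hs
    (f := fun i ω μ => dμ m (D.W i ω) (D.α i ω) μ)
    (fun μ hμ => by simpa using isUnitFun_dμ hmodel.meas (hdiff μ hμ) 0)
    (fun i => by
      filter_upwards [hOm.dμ_cont i] with ω h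
      exact h.comp (f := fun μ : Vec k => (D.α i ω, μ)) (by fun_prop)
        fun μ hμ => ⟨Set.mem_univ _, hμ⟩) 2 (hsup 0)
  obtain ⟨S', hS', hSi', hS0', hSb'⟩ := exists_isDataFun_iSup_le (μ₀ := μ₀) (ρ := ρ) hs
    (f := fun i ω μ => dαμ m (D.W i ω) (D.α i ω) μ)
    (fun μ hμ => isUnitFun_dαμ hmodel.meas (hdiff μ hμ) fun i => by
      filter_upwards [hOm.dαμ_exists i] with ω h using h μ hμ)
    (fun i => by
      filter_upwards [hOm.dαμ_cont i] with ω h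
      exact h.comp (f := fun μ : Vec k => (D.α i ω, μ)) (by fun_prop)
        fun μ hμ => ⟨Set.mem_univ _, hμ⟩) 4 (hOm.dαμ_fourth 0)
  obtain ⟨C, hC⟩ := hOm.dααμ_bound
  have hνn : Tendsto (fun z => 3 * ‖ν z - μ₀‖ ^ 2) (wpa P) (𝓝 0) := by
    simpa using ((tendsto_iff_norm_sub_tendsto_zero.1 hν).pow 2).const_mul 3
  have h4 := tendsto_foldAvg_αhat_fourth hA hrate halpha l
  have h4' := (Real.continuous_sqrt.tendsto 0).comp h4
  have ht := ((tight_foldAvg_of_isDataFun hs hA hS hSi l).add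
    ((tight_foldAvg_of_isDataFun hs hA hS' hSi' l).sqrt.mul (Tight.of_tendsto h4'))).add
    ((Tight.of_tendsto h4).const_mul (C ^ 2))
  refine squeeze_zero' (Eventually.of_forall fun z => foldAvg_nonneg fun i => by positivity) ?_
    (ht _ hνn)
  filter_upwards [eventually_wpa_of_forall_ae (p := fun _ ω => ∀ i, ∀ μ ∈ Metric.ball μ₀ ρ,
      ‖dμ m (D.W i ω) (D.α i ω) μ‖ ^ 2 ≤ S i ω) (fun _ => hSb),
    eventually_wpa_of_forall_ae (p := fun _ ω => ∀ i, ∀ μ ∈ Metric.ball μ₀ ρ,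
      ‖dαμ m (D.W i ω) (D.α i ω) μ‖ ^ 4 ≤ S' i ω) (fun _ => hSb'),
    eventually_wpa_of_forall_ae (p := fun _ ω => ∀ i, ∀ s, ∀ μ ∈ Metric.ball μ₀ ρ,
      ‖dααμ m (D.W i ω) s μ‖ ≤ C) (fun _ => ae_all_iff.2 hC),
    eventually_wpa_of_forall_ae (p := fun _ ω => ∀ i, ∀ μ ∈ Metric.ball μ₀ ρ,
      ContDiff ℝ 2 fun s => dμ m (D.W i ω) s μ) (fun _ => ae_all_iff.2 hOm.dαμ_exists),
    eventually_wpa_of_forall_ae (p := fun _ ω => ∀ i, ∀ s, ∀ μ ∈ Metric.ball μ₀ ρ,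
      DifferentiableAt ℝ (fun ν => m (D.W i ω) s ν) μ) (fun _ => ae_all_iff.2 hOm.dμ_exists),
    hν.eventually (Metric.ball_mem_nhds _ hρ)] with z hz hz' hzC hsm hdiff hball
  set Δ : ℕ → ℕ × Ω → ℝ := fun i z => A.αhat D z.1 l i z.2 - D.α i z.2 with hΔ
  set B : ℕ → ℕ × Ω → ℝ := fun i z => (3 * ‖ν z - μ₀‖ ^ 2) *
    (S i z.2 + √(S' i z.2) * Δ i z ^ 2 + C ^ 2 * Δ i z ^ 4) with hB
  have h5 : ∀ i ∈ A.fold z.1 l, ‖m (D.W i z.2) (A.αhat D z.1 l i z.2) (ν z) -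
      m (D.W i z.2) (A.αhat D z.1 l i z.2) μ₀‖ ^ 2 ≤ B i z := by
    intro i _
    -- Second-order expansion of `∂m/∂μ'` in `α` around `α_i`. The nested root appears because `S'`
    -- bounds a fourth power.
    set b := √(S i z.2) + √(√(S' i z.2)) * |Δ i z| + C * Δ i z ^ 2
    have h6 := norm_moment_sub_le (m := m) (w := D.W i z.2) (s := A.αhat D z.1 l i z.2)
      (B := b) hball (hdiff i _) (fun μ hμ => by
        have h7 := norm_sub_sub_smul_deriv_le (hsm i μ hμ) (fun s => hzC i s μ hμ) (D.α i z.2)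
          (A.αhat D z.1 l i z.2)
        have h8 : ‖dμ m (D.W i z.2) (D.α i z.2) μ‖ ≤ √(S i z.2) :=
          Real.le_sqrt_of_sq_le (hz i μ hμ)
        have h9 : ‖dαμ m (D.W i z.2) (D.α i z.2) μ‖ ≤ √(√(S' i z.2)) :=
          Real.le_sqrt_of_sq_le (Real.le_sqrt_of_sq_le (by
            rw [← pow_mul]; exact hz' i μ hμ))
        have h10 : dμ m (D.W i z.2) (A.αhat D z.1 l i z.2) μ = dμ m (D.W i z.2) (D.α i z.2) μ +
            Δ i z • dαμ m (D.W i z.2) (D.α i z.2) μ +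
            (dμ m (D.W i z.2) (A.αhat D z.1 l i z.2) μ - dμ m (D.W i z.2) (D.α i z.2) μ -
              (A.αhat D z.1 l i z.2 - D.α i z.2) •
                deriv (fun s => dμ m (D.W i z.2) s μ) (D.α i z.2)) := by
          simp only [dαμ, hΔ]
          abel
        rw [h10]
        refine (norm_add_le _ _).trans (add_le_add ((norm_add_le _ _).trans (add_le_add h8 ?_)) h7)
        rw [norm_smul, mul_comm, Real.norm_eq_abs]
        exact mul_le_mul_of_nonneg_right h9 (abs_nonneg _))
    refine (pow_le_pow_left₀ (norm_nonneg _) h6 2).trans ?_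
    have h7 : b ^ 2 ≤ 3 * (S i z.2 + √(S' i z.2) * Δ i z ^ 2 + C ^ 2 * Δ i z ^ 4) := by
      have e1 := Real.sq_sqrt (hS0 i z.2)
      have e2 := Real.sq_sqrt (Real.sqrt_nonneg (S' i z.2))
      calc b ^ 2 ≤ 3 * (√(S i z.2) ^ 2 + (√(√(S' i z.2)) * |Δ i z|) ^ 2 + (C * Δ i z ^ 2) ^ 2) := by
            nlinarith [sq_nonneg (√(S i z.2) - √(√(S' i z.2)) * |Δ i z|),
              sq_nonneg (√(S i z.2) - C * Δ i z ^ 2),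
              sq_nonneg (√(√(S' i z.2)) * |Δ i z| - C * Δ i z ^ 2)]
        _ = _ := by rw [mul_pow, e1, e2, sq_abs]; ring
    rw [mul_pow, hB]
    nlinarith [mul_le_mul_of_nonneg_right h7 (sq_nonneg ‖ν z - μ₀‖)]
  refine (foldAvg_mono (f' := B) h5).trans ?_
  rw [hB, foldAvg_const_mul (fun z => 3 * ‖ν z - μ₀‖ ^ 2), foldAvg_add, foldAvg_add,
    foldAvg_const_mul (fun _ => C ^ 2)]
  refine mul_le_mul_of_nonneg_left (add_le_add (add_le_add le_rfl ?_) le_rfl) (by positivity)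
  refine foldAvg_mul_le_sqrt.trans (le_of_eq ?_)
  simp only [Real.sq_sqrt (hS0' _ _), ← pow_mul, Nat.reduceMul, Function.comp, hΔ]

end PlugIn

end OrthMoment

namespace OrthMoment

/-! ### Generalized method of moments -/

section MatrixFacts

open scoped Matrix

variable {k q : ℕ} {G : Matrix (Fin q) (Fin k) ℝ} {Om Υ : Matrix (Fin q) (Fin q) ℝ}

theorem isUnit_det_of_posDef {n : ℕ} {M : Matrix (Fin n) (Fin n) ℝ} (h : M.PosDef) :
    IsUnit M.det :=
  h.det_pos.ne'.isUnit

theorem tendsto_matrix_iff {ι : Type*} {F : Filter ι} {a b : ℕ} {M : ι → Matrix (Fin a) (Fin b) ℝ}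
    {M₀ : Matrix (Fin a) (Fin b) ℝ} :
    Tendsto M F (𝓝 M₀) ↔ ∀ r s, Tendsto (fun z => M z r s) F (𝓝 (M₀ r s)) :=
  tendsto_pi_nhds.trans (forall_congr' fun _ => tendsto_pi_nhds)

theorem tendsto_matrix_mul {ι : Type*} {F : Filter ι} {a b c : ℕ} {M : ι → Matrix (Fin a) (Fin b) ℝ}
    {M₀ : Matrix (Fin a) (Fin b) ℝ} {K : ι → Matrix (Fin b) (Fin c) ℝ}
    {K₀ : Matrix (Fin b) (Fin c) ℝ} (hM : Tendsto M F (𝓝 M₀)) (hK : Tendsto K F (𝓝 K₀)) :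
    Tendsto (fun z => M z * K z) F (𝓝 (M₀ * K₀)) := by
  refine tendsto_matrix_iff.2 fun r s => ?_
  simp only [Matrix.mul_apply]
  exact tendsto_finsetSum _ fun j _ =>
    (tendsto_matrix_iff.1 hM r j).mul (tendsto_matrix_iff.1 hK j s)

theorem tendsto_matrix_transpose {ι : Type*} {F : Filter ι} {a b : ℕ}
    {M : ι → Matrix (Fin a) (Fin b) ℝ} {M₀ : Matrix (Fin a) (Fin b) ℝ} (hM : Tendsto M F (𝓝 M₀)) :
    Tendsto (fun z => (M z)ᵀ) F (𝓝 M₀ᵀ) :=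
  tendsto_matrix_iff.2 fun r s => tendsto_matrix_iff.1 hM s r

theorem tendsto_matrix_inv {ι : Type*} {F : Filter ι} {n : ℕ} {M : ι → Matrix (Fin n) (Fin n) ℝ}
    {M₀ : Matrix (Fin n) (Fin n) ℝ} (h : Tendsto M F (𝓝 M₀)) (h0 : IsUnit M₀.det) :
    Tendsto (fun z => (M z)⁻¹) F (𝓝 M₀⁻¹) := by
  refine (continuousAt_matrix_inv M₀ ?_).tendsto.comp h
  rw [Ring.inverse_eq_inv']
  exact continuousAt_inv₀ h0.ne_zero

theorem mulVec_injective_of_rank (hG : G.rank = k) : Function.Injective G.mulVec := by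
  have h1 := LinearMap.finrank_range_add_finrank_ker G.mulVecLin
  rw [Module.finrank_fin_fun] at h1
  have h2 : Module.finrank ℝ (LinearMap.range G.mulVecLin) = k := hG
  have h3 : Module.finrank ℝ (LinearMap.ker G.mulVecLin) = 0 := by omega
  exact LinearMap.ker_eq_bot.1 (Submodule.finrank_eq_zero.1 h3)

/-- Full column rank makes `v ↦ G v` injective, so positivity survives the congruence. -/
theorem posDef_transpose_mul_mul (hG : G.rank = k) (hΥ : Υ.PosDef) : (Gᵀ * Υ * G).PosDef := by
  simpa [Matrix.conjTranspose_eq_transpose_of_trivial] using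
    hΥ.conjTranspose_mul_mul_same (mulVec_injective_of_rank hG)

theorem transpose_eq_of_posDef {n : ℕ} {M : Matrix (Fin n) (Fin n) ℝ} (h : M.PosDef) : Mᵀ = M := by
  have := h.isHermitian.eq
  rwa [Matrix.conjTranspose_eq_transpose_of_trivial] at this

/-- The matrix `-(G'ΥG)⁻¹G'Υ` that maps the limit of the moments to that of the estimator. -/
noncomputable def influence (G : Matrix (Fin q) (Fin k) ℝ) (Υ : Matrix (Fin q) (Fin q) ℝ) :
    Matrix (Fin k) (Fin q) ℝ :=
  -((Gᵀ * Υ * G)⁻¹ * (Gᵀ * Υ))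

theorem influence_mul_mul_transpose (hG : G.rank = k) (hΥ : Υ.PosDef) :
    influence G Υ * Om * (influence G Υ)ᵀ = sandwich G Υ Om := by
  have h1 := transpose_eq_of_posDef (posDef_transpose_mul_mul hG hΥ)
  simp only [influence, sandwich, Matrix.transpose_neg, Matrix.transpose_mul,
    Matrix.transpose_nonsing_inv, Matrix.transpose_transpose, transpose_eq_of_posDef hΥ, h1]
  simp only [Matrix.neg_mul, Matrix.mul_neg, neg_neg, Matrix.mul_assoc]

theorem tendsto_sandwich {ι : Type*} {F : Filter ι} {Gh : ι → Matrix (Fin q) (Fin k) ℝ}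
    {Υh Omh : ι → Matrix (Fin q) (Fin q) ℝ} (hΥ : Υ.PosDef) (hG : G.rank = k)
    (h1 : Tendsto Gh F (𝓝 G)) (h2 : Tendsto Υh F (𝓝 Υ)) (h3 : Tendsto Omh F (𝓝 Om)) :
    Tendsto (fun z => sandwich (Gh z) (Υh z) (Omh z)) F (𝓝 (sandwich G Υ Om)) := by
  have h4 := tendsto_matrix_mul (tendsto_matrix_transpose h1) h2
  have h5 := tendsto_matrix_inv (tendsto_matrix_mul h4 h1)
    (isUnit_det_of_posDef (posDef_transpose_mul_mul hG hΥ))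
  exact tendsto_matrix_mul (tendsto_matrix_mul h5 (tendsto_matrix_mul (tendsto_matrix_mul
    (tendsto_matrix_mul h4 h3) h2) h1)) h5

theorem tendsto_clmOfMatrix_transpose_mul_add {ι : Type*} {F : Filter ι}
    {Gh : ι → Matrix (Fin q) (Fin k) ℝ} {Υh : ι → Matrix (Fin q) (Fin q) ℝ}
    (h1 : Tendsto Gh F (𝓝 G)) (h2 : Tendsto Υh F (𝓝 Υ)) :
    Tendsto (fun z => clmOfMatrix ((Gh z)ᵀ * (Υh z + (Υh z)ᵀ))) F
      (𝓝 (clmOfMatrix (Gᵀ * (Υ + Υᵀ)))) :=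
  (continuous_clmOfMatrix.tendsto (Gᵀ * (Υ + Υᵀ))).comp
    (tendsto_matrix_mul (tendsto_matrix_transpose h1) (h2.add (tendsto_matrix_transpose h2)))

/-- Compare characteristic functions: the image evaluated at `t` is the original at `M't`. No
density is involved, so singular covariances are covered. -/
theorem map_clmOfMatrix_multivariateGaussian (hOm : Om.PosSemidef) (M : Matrix (Fin k) (Fin q) ℝ) :
    (multivariateGaussian 0 Om).map (clmOfMatrix M) =
      multivariateGaussian 0 (M * Om * Mᵀ) := by
  have hM : (M * Om * Mᵀ).PosSemidef := by
    simpa [Matrix.conjTranspose_eq_transpose_of_trivial] using hOm.mul_mul_conjTranspose_same M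
  have : IsProbabilityMeasure ((multivariateGaussian 0 Om).map (clmOfMatrix M)) :=
    Measure.isProbabilityMeasure_map (by fun_prop)
  refine Measure.ext_of_charFun ?_
  ext t
  have h1 : ∀ v : Vec q, (inner ℝ (clmOfMatrix M v) t : ℝ) =
      inner ℝ v (WithLp.toLp 2 (Mᵀ *ᵥ t.ofLp)) := by
    intro v
    simp only [PiLp.inner_apply, RCLike.inner_apply, conj_trivial, clmOfMatrix_apply,
      Matrix.mulVec, dotProduct, Matrix.transpose_apply, Finset.mul_sum, Finset.sum_mul]
    rw [Finset.sum_comm]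
    exact Finset.sum_congr rfl fun c _ => Finset.sum_congr rfl fun r _ => by ring
  have h2 : charFun ((multivariateGaussian 0 Om).map (clmOfMatrix M)) t =
      charFun (multivariateGaussian 0 Om) (WithLp.toLp 2 (Mᵀ *ᵥ t.ofLp)) := by
    rw [charFun_apply, charFun_apply, integral_map (by fun_prop) (by fun_prop)]
    simp only [h1]
  rw [h2, charFun_multivariateGaussian hOm, charFun_multivariateGaussian hM]
  congr 3
  · simp
  · congr 1
    simp only [← Matrix.mulVec_mulVec]
    rw [Matrix.dotProduct_mulVec t.ofLp M, ← Matrix.mulVec_transpose]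

theorem clmOfMatrix_mul {j : ℕ} (M : Matrix (Fin j) (Fin q) ℝ) (v : Vec k) :
    clmOfMatrix (M * G) v = clmOfMatrix M (clmOfMatrix G v) := by
  ext r
  simp only [clmOfMatrix_apply, Matrix.mul_apply, Finset.sum_mul, Finset.mul_sum]
  rw [Finset.sum_comm]
  exact Finset.sum_congr rfl fun c _ => Finset.sum_congr rfl fun r _ => by ring

theorem clmOfMatrix_one (v : Vec k) : clmOfMatrix (1 : Matrix (Fin k) (Fin k) ℝ) v = v := by
  ext r
  simp [clmOfMatrix_apply, Matrix.one_apply]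

end MatrixFacts

/-! ### First-order condition and its linearization -/

section FirstOrderCondition

open scoped Matrix

variable {k q : ℕ}

theorem hasFDerivAt_quadForm_comp {f : Vec k → Vec q} {f' : Vec k →L[ℝ] Vec q} {μ : Vec k}
    (Υ : Matrix (Fin q) (Fin q) ℝ) (hf : HasFDerivAt f f' μ) :
    HasFDerivAt (fun ν => quadForm Υ (f ν))
      (∑ r, ∑ s, ((f μ r * Υ r s) • (EuclideanSpace.proj s : Vec q →L[ℝ] ℝ).comp f' +
        f μ s • (Υ r s • (EuclideanSpace.proj r : Vec q →L[ℝ] ℝ).comp f'))) μ := by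
  have hc : ∀ r, HasFDerivAt (fun ν => f ν r)
      ((EuclideanSpace.proj r : Vec q →L[ℝ] ℝ).comp f') μ := fun r =>
    (EuclideanSpace.proj r : Vec q →L[ℝ] ℝ).hasFDerivAt.comp μ hf
  exact HasFDerivAt.fun_sum fun r _ => HasFDerivAt.fun_sum fun s _ =>
    ((hc r).mul_const (Υ r s)).mul (hc s)

/-- First-order condition of GMM: the weighted moments are orthogonal to the Jacobian. -/
theorem clmOfMatrix_eq_zero_of_isMinOn {f : Vec k → Vec q} {f' : Vec k →L[ℝ] Vec q} {μ : Vec k}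
    {Υ : Matrix (Fin q) (Fin q) ℝ} {Θ : Set (Vec k)} (hf : HasFDerivAt f f' μ)
    (hmin : IsMinOn (fun ν => quadForm Υ (f ν)) Θ μ) (hΘ : Θ ∈ 𝓝 μ)
    {J : Matrix (Fin q) (Fin k) ℝ} (hJ : ∀ r c, J r c = f' (EuclideanSpace.single c 1) r) :
    clmOfMatrix (Jᵀ * (Υ + Υᵀ)) (f μ) = 0 := by
  have h1 := (hmin.isLocalMin hΘ).hasFDerivAt_eq_zero (hasFDerivAt_quadForm_comp Υ hf)
  ext c
  have h2 := congrArg (fun T : Vec k →L[ℝ] ℝ => T (EuclideanSpace.single c 1)) h1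
  simp only [sum_apply, add_apply, smul_apply,
    ContinuousLinearMap.comp_apply, zero_apply, smul_eq_mul] at h2
  simp only [clmOfMatrix_apply, Matrix.mul_apply, Matrix.transpose_apply, Matrix.add_apply, hJ,
    PiLp.zero_apply, Finset.sum_mul]
  rw [← h2]
  -- The product rule differentiates each of the two factors `f`. Without symmetry of the weights
  -- this produces `Υ + Υ'` instead of `2Υ`.
  have e1 : ∀ r s, (f μ r * Υ r s) * (EuclideanSpace.proj s : Vec q →L[ℝ] ℝ)
      (f' (EuclideanSpace.single c 1)) = f' (EuclideanSpace.single c 1) s * Υ r s * f μ r :=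
    fun r s => by simp; ring
  have e2 : ∀ r s, f μ s * (Υ r s * (EuclideanSpace.proj r : Vec q →L[ℝ] ℝ)
      (f' (EuclideanSpace.single c 1))) = f' (EuclideanSpace.single c 1) r * Υ r s * f μ s :=
    fun r s => by simp; ring
  simp only [e1, e2, mul_add, add_mul, Finset.sum_add_distrib]
  rw [add_comm]
  congr 1
  exact Finset.sum_comm

/-- Solving the linearized first-order condition. -/
theorem tendsto_of_linearized {ι E F : Type*} [NormedAddCommGroup E] [NormedSpace ℝ E]
    [NormedAddCommGroup F] [NormedSpace ℝ F] {l : Filter ι} {x : ι → E} {V M S : ι → F}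
    {Bh : ι → F →L[ℝ] E} {B : F →L[ℝ] E} {G : E →L[ℝ] F} {H : E →L[ℝ] E} {κ : ι → ℝ}
    (hB : Tendsto Bh l (𝓝 B)) (hH : ∀ v, H (B (G v)) = v)
    (hV : ∀ᶠ z in l, Bh z (V z) = 0) (hκ : Tendsto κ l (𝓝 0))
    (hr : ∀ᶠ z in l, ‖V z - M z - G (x z)‖ ≤ κ z * ‖x z‖)
    (hM : Tendsto (fun z => ‖M z - S z‖) l (𝓝 0)) (hS : Tight l fun z => ‖S z‖) :
    Tight l (fun z => ‖x z‖) ∧ Tendsto (fun z => ‖x z + H (B (S z))‖) l (𝓝 0) := by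
  set b : ι → ℝ := fun z => ‖B - Bh z‖
  have hb : Tendsto b l (𝓝 0) := by
    have := (tendsto_const_nhds (x := B)).sub hB
    rw [sub_self] at this
    exact tendsto_zero_iff_norm_tendsto_zero.1 this
  set θ : ι → ℝ := fun z => ‖H‖ * (b z * ‖G‖ + ‖Bh z‖ * κ z)
  set δ : ι → ℝ := fun z => ‖H‖ * (b z * ‖S z‖ + ‖Bh z‖ * ‖M z - S z‖)
  have hθ : Tendsto θ l (𝓝 0) := by
    simpa using ((hb.mul_const ‖G‖).add (hB.norm.mul hκ)).const_mul ‖H‖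
  have hδ : Tendsto δ l (𝓝 0) := by
    simpa using ((hS _ hb).add (hB.norm.mul hM)).const_mul ‖H‖
  -- Insert `V = S + (M - S) + G x + r` into `Bh V = 0` and apply `H`, which undoes `B G`. Every
  -- leftover carries a vanishing factor.
  have hx : ∀ᶠ z in l, ‖x z + H (B (S z))‖ ≤ θ z * ‖x z‖ + δ z := by
    filter_upwards [hV, hr] with z h1 h2
    set r := V z - M z - G (x z) with hrdef
    have h3 : V z = S z + (M z - S z) + G (x z) + r := by rw [hrdef]; abel
    have h4 : x z + H (B (S z)) = H ((B - Bh z) (G (x z)) + (B - Bh z) (S z) -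
        Bh z (M z - S z) - Bh z r) := by
      have h5 : Bh z (S z) + Bh z (M z - S z) + Bh z (G (x z)) + Bh z r = 0 := by
        rw [← map_add, ← map_add, ← map_add, ← h3, h1]
      have h6 : (B - Bh z) (G (x z)) + (B - Bh z) (S z) - Bh z (M z - S z) - Bh z r =
          B (G (x z)) + B (S z) -
            (Bh z (S z) + Bh z (M z - S z) + Bh z (G (x z)) + Bh z r) := by
        simp only [sub_apply]
        abel
      rw [h6, h5, sub_zero, map_add, hH]
    rw [h4]
    refine (H.le_opNorm _).trans ?_
    have h7 : ‖(B - Bh z) (G (x z)) + (B - Bh z) (S z) - Bh z (M z - S z) - Bh z r‖ ≤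
        b z * (‖G‖ * ‖x z‖) + b z * ‖S z‖ + ‖Bh z‖ * ‖M z - S z‖ + ‖Bh z‖ * (κ z * ‖x z‖) := by
      refine (norm_sub_le _ _).trans (add_le_add ((norm_sub_le _ _).trans (add_le_add
        ((norm_add_le _ _).trans (add_le_add ?_ ?_)) ?_)) ?_)
      · exact ((B - Bh z).le_opNorm _).trans
          (mul_le_mul_of_nonneg_left (G.le_opNorm _) (norm_nonneg _))
      · exact (B - Bh z).le_opNorm _
      · exact (Bh z).le_opNorm _
      · exact ((Bh z).le_opNorm _).trans (mul_le_mul_of_nonneg_left h2 (norm_nonneg _))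
    refine (mul_le_mul_of_nonneg_left h7 (norm_nonneg _)).trans (le_of_eq ?_)
    simp only [θ, δ]
    ring
  -- Once `θ ≤ 1/2`, the term `θ‖x‖` is absorbed on the left. So the rate of the estimator is a
  -- conclusion and need not be assumed.
  have hxt : Tight l fun z => ‖x z‖ := by
    refine (((Tight.of_tendsto hδ).add ((hS.const_mul (‖H‖ * ‖B‖)))).const_mul 2).mono ?_
    filter_upwards [hx, hθ.eventually (ge_mem_nhds (show (0 : ℝ) < 1 / 2 by norm_num))]
      with z h1 h2
    rw [abs_of_nonneg (norm_nonneg _)]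
    refine le_trans ?_ (le_abs_self _)
    have h3 : ‖H (B (S z))‖ ≤ ‖H‖ * ‖B‖ * ‖S z‖ := by
      rw [mul_assoc]
      exact (H.le_opNorm _).trans (mul_le_mul_of_nonneg_left (B.le_opNorm _) (norm_nonneg _))
    have h4 : ‖x z‖ ≤ ‖x z + H (B (S z))‖ + ‖H (B (S z))‖ := norm_le_add_norm_add _ _
    have h5 := mul_le_mul_of_nonneg_right h2 (norm_nonneg (x z))
    linarith
  refine ⟨hxt, squeeze_zero' (Eventually.of_forall fun _ => norm_nonneg _) hx ?_⟩
  simpa using (hxt _ hθ).add hδ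

end FirstOrderCondition

end OrthMoment

namespace OrthMoment

/-! ### Asymptotic normality -/

section AsymptoticNormality

open scoped Matrix

variable {Ω : Type*} [MeasurableSpace Ω] {P : Measure Ω} [IsProbabilityMeasure P]
  {d p k q L : ℕ} {D : Panel Ω d p} {A : Procedure Ω p k q L}
  {m : Vec d → ℝ → Vec k → Vec q} {β₀ : Vec p} {μ₀ : Vec k} {g ρ : ℝ} {Θ : Set (Vec k)}
  {G : Matrix (Fin q) (Fin k) ℝ} {Om Υ : Matrix (Fin q) (Fin q) ℝ}

theorem tendsto_sqrt_smul_mhat_sub (hs : Sampling P D) (hA : A.IsValid D m P Θ)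
    (hmodel : ModelAssumption P D m β₀ μ₀) (hrate : RateAssumption P D A m β₀ μ₀ g)
    (halpha : FixedEffectAssumption P D A m β₀ μ₀ g) (hmom : MomentAssumption P D A m β₀ μ₀) :
    Tendsto (fun z : ℕ × Ω => ‖√(z.1 : ℝ) • A.mhat D m z.1 z.2 μ₀ -
      mstarSum P D A m β₀ μ₀ z.1 z.2‖) (wpa P) (𝓝 0) := by
  have h1 : Tendsto (fun z : ℕ × Ω => ∑ l, (√(z.1 : ℝ))⁻¹ *
      ‖∑ i ∈ A.fold z.1 l, momentGap P D A m β₀ μ₀ l i z‖) (wpa P) (𝓝 0) := by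
    simpa using tendsto_finsetSum Finset.univ fun l _ =>
      tendsto_sum_momentGap hs hA hmodel hrate halpha hmom l
  refine squeeze_zero (fun _ => norm_nonneg _) (fun z => ?_) h1
  have h2 : √(z.1 : ℝ) * (z.1 : ℝ)⁻¹ = (√(z.1 : ℝ))⁻¹ := by
    rw [← div_eq_mul_inv, Real.sqrt_div_self]
  have h3 : √(z.1 : ℝ) • A.mhat D m z.1 z.2 μ₀ - mstarSum P D A m β₀ μ₀ z.1 z.2 =
      (√(z.1 : ℝ))⁻¹ • ∑ l, ∑ i ∈ A.fold z.1 l, momentGap P D A m β₀ μ₀ l i z := by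
    simp only [Procedure.mhat, mstarSum, momentGap, smul_smul, h2, Finset.sum_sub_distrib, smul_sub,
      sum_folds hA z.1 fun i => D.mstar P m β₀ μ₀ (A.T z.1) i z.2]
  rw [h3, norm_smul, Real.norm_of_nonneg (by positivity), ← Finset.mul_sum]
  exact mul_le_mul_of_nonneg_left (norm_sum_le _ _) (by positivity)

/-- In the feasible optimal case the second-moment matrix at the preliminary estimates converges to
`Om`, and inversion is continuous there. -/
theorem tendsto_weights (hs : Sampling P D) (hA : A.IsValid D m P Θ)
    (hmodel : ModelAssumption P D m β₀ μ₀) (hrate : RateAssumption P D A m β₀ μ₀ g)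
    (halpha : FixedEffectAssumption P D A m β₀ μ₀ g) (hmom : MomentAssumption P D A m β₀ μ₀)
    (hρ : 0 < ρ) (hOm : OmegaAssumption P D A m β₀ μ₀ ρ Om)
    (hΥ : WeightingAssumption P D A m μ₀ ρ Om Υ) :
    Tendsto (fun z : ℕ × Ω => A.Υ z.1 z.2) (wpa P) (𝓝 Υ) := by
  obtain ⟨hpos, h | ⟨h1, h2, h3⟩⟩ := hΥ
  · exact tendsto_matrix_iff.2 fun r s =>
      (tendsto_wpa_iff (f := fun N ω => A.Υ N ω r s)).2 (h r s)
  -- `Om` is only known to be positive semidefinite. It is invertible because its matrix inverse is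
  -- the positive definite `Υ`.
  · have hdet : IsUnit Om.det := by
      rw [← Matrix.isUnit_nonsing_inv_det_iff, ← h2]
      exact isUnit_det_of_posDef hpos
    have h4 := tendsto_secondMoment hs hA hmodel hrate halpha hmom hOm
      (ν := fun l z => A.μt z.1 l z.2) fun l => tendsto_foldAvg_moment_sub_of_sup hs hA hmodel
        hrate halpha hρ hOm h3 (tendsto_wpa_iff.2 (hOm.μt_consistent l)) l
    rw [h2]
    refine (tendsto_matrix_inv h4 hdet).congr fun z => ?_
    rw [h1]
    rfl

theorem tendsto_sampleJac {c K : ℝ} {R : ℕ × Ω → ℝ} (hc : 0 < c) (hR : Tendsto R (wpa P) (𝓝 0))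
    (hρ : 0 < ρ) (hJ : ∀ᶠ z in wpa P, ∀ μ ∈ Metric.ball μ₀ ρ,
      ‖sampleJac D A m z μ - clmOfMatrix G‖ ≤ R z + K * ‖μ - μ₀‖ ^ c)
    (hμ : Tendsto (fun z : ℕ × Ω => A.μhat z.1 z.2) (wpa P) (𝓝 μ₀)) :
    Tendsto (fun z : ℕ × Ω => R z + K * ‖A.μhat z.1 z.2 - μ₀‖ ^ c) (wpa P) (𝓝 0) ∧
      Tendsto (fun z : ℕ × Ω => A.Ghat D m z.1 z.2) (wpa P) (𝓝 G) := by
  have h1 : Tendsto (fun z : ℕ × Ω => R z + K * ‖A.μhat z.1 z.2 - μ₀‖ ^ c) (wpa P) (𝓝 0) := by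
    have h2 := (tendsto_iff_norm_sub_tendsto_zero.1 hμ).rpow_const (p := c) (Or.inr hc.le)
    rw [Real.zero_rpow hc.ne'] at h2
    simpa using hR.add (h2.const_mul K)
  refine ⟨h1, ?_⟩
  have h3 : Tendsto (fun z : ℕ × Ω => sampleJac D A m z (A.μhat z.1 z.2)) (wpa P)
      (𝓝 (clmOfMatrix G)) := by
    refine tendsto_iff_norm_sub_tendsto_zero.2 (squeeze_zero' (Eventually.of_forall fun _ =>
      norm_nonneg _) ?_ h1)
    filter_upwards [hJ, hμ.eventually (Metric.ball_mem_nhds _ hρ)] with z h4 h5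
    exact h4 _ h5
  refine tendsto_matrix_iff.2 fun r s => ?_
  have h4 : Continuous fun T : Vec k →L[ℝ] Vec q => T (EuclideanSpace.single s 1) r := by fun_prop
  have h5 := (h4.tendsto _).comp h3
  have h6 : clmOfMatrix G (EuclideanSpace.single s 1) r = G r s := by
    simp [clmOfMatrix_apply]
  rw [h6] at h5
  exact h5.congr fun z => (Ghat_eq_sampleJac z.1 z.2 r s).symm

/-- Mean value inequality on the closed ball around `μ₀` that reaches exactly to `μ̂`; on it the
sample Jacobian differs from `G` by at most the stated factor. -/
theorem eventually_norm_mhat_sub_le {c K : ℝ} {R : ℕ × Ω → ℝ} (hc : 0 < c) (hK : 0 ≤ K)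
    (hρ : 0 < ρ) (hOm : OmegaAssumption P D A m β₀ μ₀ ρ Om)
    (hJ : ∀ᶠ z in wpa P, ∀ μ ∈ Metric.ball μ₀ ρ,
      ‖sampleJac D A m z μ - clmOfMatrix G‖ ≤ R z + K * ‖μ - μ₀‖ ^ c)
    (hμ : Tendsto (fun z : ℕ × Ω => A.μhat z.1 z.2) (wpa P) (𝓝 μ₀)) :
    ∀ᶠ z in wpa P, ‖A.mhat D m z.1 z.2 (A.μhat z.1 z.2) - A.mhat D m z.1 z.2 μ₀ -
      clmOfMatrix G (A.μhat z.1 z.2 - μ₀)‖ ≤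
        (R z + K * ‖A.μhat z.1 z.2 - μ₀‖ ^ c) * ‖A.μhat z.1 z.2 - μ₀‖ := by
  filter_upwards [hJ, hμ.eventually (Metric.ball_mem_nhds _ hρ),
    eventually_wpa_of_forall_ae (p := fun _ ω => ∀ i, ∀ s, ∀ μ ∈ Metric.ball μ₀ ρ,
      DifferentiableAt ℝ (fun ν => m (D.W i ω) s ν) μ) (fun _ => ae_all_iff.2 hOm.dμ_exists)]
    with z h1 h2 h3
  have h4 : ∀ μ ∈ Metric.closedBall μ₀ ‖A.μhat z.1 z.2 - μ₀‖, μ ∈ Metric.ball μ₀ ρ := fun μ hμ =>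
    lt_of_le_of_lt (Metric.mem_closedBall.1 hμ) (by rw [← dist_eq_norm]; exact h2)
  refine (convex_closedBall μ₀ ‖A.μhat z.1 z.2 - μ₀‖).norm_image_sub_le_of_norm_hasFDerivWithin_le'
    (f' := sampleJac D A m z) (fun μ hμ => (hasFDerivAt_mhat fun i s =>
      h3 i s μ (h4 μ hμ)).hasFDerivWithinAt) (fun μ hμ => (h1 μ (h4 μ hμ)).trans ?_)
    (Metric.mem_closedBall_self (norm_nonneg _)) (by rw [mem_closedBall_iff_norm])
  have h5 : ‖μ - μ₀‖ ≤ ‖A.μhat z.1 z.2 - μ₀‖ := mem_closedBall_iff_norm.1 hμ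
  gcongr

/-- Asymptotic linearity of the estimator. -/
theorem tendsto_sub_influence (hs : Sampling P D) (hA : A.IsValid D m P Θ)
    (hmodel : ModelAssumption P D m β₀ μ₀) (hrate : RateAssumption P D A m β₀ μ₀ g)
    (halpha : FixedEffectAssumption P D A m β₀ μ₀ g) (hmom : MomentAssumption P D A m β₀ μ₀)
    (hρ : 0 < ρ) (hΘ : Θ ∈ 𝓝 μ₀) (hOm : OmegaAssumption P D A m β₀ μ₀ ρ Om)
    (hG : JacobianAssumption P D m μ₀ ρ G) (hΥ : WeightingAssumption P D A m μ₀ ρ Om Υ)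
    (hμ : Tendsto (fun z : ℕ × Ω => A.μhat z.1 z.2) (wpa P) (𝓝 μ₀)) :
    Tight (wpa P) (fun z => ‖√(z.1 : ℝ) • (A.μhat z.1 z.2 - μ₀)‖) ∧
    Tendsto (fun z : ℕ × Ω => √(z.1 : ℝ) • (A.μhat z.1 z.2 - μ₀) -
      clmOfMatrix (influence G Υ) (mstarSum P D A m β₀ μ₀ z.1 z.2)) (wpa P) (𝓝 0) ∧
    Tendsto (fun z : ℕ × Ω => A.Ghat D m z.1 z.2) (wpa P) (𝓝 G) := by
  obtain ⟨c, K, R, hc, hK, hR, hJ⟩ := exists_sampleJac_bound hs hA hmodel hrate halpha hρ hOm hG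
  obtain ⟨hκ, hGhat⟩ := tendsto_sampleJac hc hR hρ hJ hμ
  have hW := tendsto_weights hs hA hmodel hrate halpha hmom hρ hOm hΥ
  have hΥt := transpose_eq_of_posDef hΥ.1
  have hdet := isUnit_det_of_posDef (posDef_transpose_mul_mul hG.full_rank hΥ.1)
  have hB : Tendsto (fun z : ℕ × Ω => clmOfMatrix
      ((A.Ghat D m z.1 z.2)ᵀ * (A.Υ z.1 z.2 + (A.Υ z.1 z.2)ᵀ))) (wpa P)
      (𝓝 (clmOfMatrix (Gᵀ * (Υ + Υᵀ)))) :=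
    tendsto_clmOfMatrix_transpose_mul_add hGhat hW
  -- The factor `1/2` compensates `Υ + Υ' = 2Υ`, which holds in the limit.
  have hmat : ((1 / 2 : ℝ) • (Gᵀ * Υ * G)⁻¹) * (Gᵀ * (Υ + Υᵀ)) = -influence G Υ := by
    rw [hΥt, ← two_smul ℝ Υ, influence, neg_neg, Matrix.mul_smul, Matrix.mul_smul,
      Matrix.smul_mul, smul_smul]
    norm_num
  have hH : ∀ v, clmOfMatrix ((1 / 2 : ℝ) • (Gᵀ * Υ * G)⁻¹)
      (clmOfMatrix (Gᵀ * (Υ + Υᵀ)) (clmOfMatrix G v)) = v := fun v => by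
    rw [← clmOfMatrix_mul, ← clmOfMatrix_mul, hmat, influence, neg_neg,
      Matrix.mul_assoc, Matrix.nonsing_inv_mul _ hdet, clmOfMatrix_one]
  -- By consistency `μ̂` eventually lies in the interior of `Θ` and in the ball where the moments
  -- are differentiable, so the minimum is a critical point.
  have hFOC : ∀ᶠ z in wpa P, clmOfMatrix ((A.Ghat D m z.1 z.2)ᵀ *
      (A.Υ z.1 z.2 + (A.Υ z.1 z.2)ᵀ)) (√(z.1 : ℝ) • A.mhat D m z.1 z.2 (A.μhat z.1 z.2)) = 0 := by
    filter_upwards [hμ.eventually (Metric.ball_mem_nhds _ hρ),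
      hμ.eventually (eventually_mem_nhds_iff.2 hΘ),
      eventually_wpa_of_ae (p := fun z => A.μhat z.1 z.2 ∈ Θ ∧
        IsMinOn (A.objective D m z.1 z.2) Θ (A.μhat z.1 z.2)) hA.μhat_min,
      eventually_wpa_of_forall_ae (p := fun _ ω => ∀ i, ∀ s, ∀ μ ∈ Metric.ball μ₀ ρ,
        DifferentiableAt ℝ (fun ν => m (D.W i ω) s ν) μ) (fun _ => ae_all_iff.2 hOm.dμ_exists)]
      with z h1 h2 h3 h4
    rw [map_smul, clmOfMatrix_eq_zero_of_isMinOn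
      (hasFDerivAt_mhat (D := D) (A := A) (m := m) (z := z) fun i s => h4 i s _ h1) h3.2 h2
      fun r c => Ghat_eq_sampleJac z.1 z.2 r c, smul_zero]
  have hr : ∀ᶠ z in wpa P, ‖√(z.1 : ℝ) • A.mhat D m z.1 z.2 (A.μhat z.1 z.2) -
      √(z.1 : ℝ) • A.mhat D m z.1 z.2 μ₀ -
      clmOfMatrix G (√(z.1 : ℝ) • (A.μhat z.1 z.2 - μ₀))‖ ≤
        (R z + K * ‖A.μhat z.1 z.2 - μ₀‖ ^ c) * ‖√(z.1 : ℝ) • (A.μhat z.1 z.2 - μ₀)‖ := by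
    filter_upwards [eventually_norm_mhat_sub_le hc hK hρ hOm hJ hμ] with z h1
    rw [map_smul, ← smul_sub, ← smul_sub, norm_smul, norm_smul, mul_left_comm]
    exact mul_le_mul_of_nonneg_left h1 (norm_nonneg _)
  obtain ⟨h1, h2⟩ := tendsto_of_linearized
    (x := fun z : ℕ × Ω => √(z.1 : ℝ) • (A.μhat z.1 z.2 - μ₀))
    (V := fun z => √(z.1 : ℝ) • A.mhat D m z.1 z.2 (A.μhat z.1 z.2))
    (M := fun z => √(z.1 : ℝ) • A.mhat D m z.1 z.2 μ₀)
    (S := fun z => mstarSum P D A m β₀ μ₀ z.1 z.2)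
    hB hH hFOC hκ hr (tendsto_sqrt_smul_mhat_sub hs hA hmodel hrate halpha hmom)
    (tight_mstarSum hs hA hmodel hrate hmom hOm)
  refine ⟨h1, tendsto_zero_iff_norm_tendsto_zero.2 (h2.congr fun z => ?_), hGhat⟩
  have h3 : ∀ (M : Matrix (Fin k) (Fin q) ℝ) (v : Vec q), clmOfMatrix (-M) v = -clmOfMatrix M v :=
    fun M v => by ext i; simp [clmOfMatrix_apply]
  rw [← clmOfMatrix_mul, hmat, h3, ← sub_eq_add_neg]

end AsymptoticNormality

end OrthMoment

/-! ### Limit law and consistency of the variance estimator -/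

namespace OrthMoment

open scoped Matrix

variable {Ω : Type*} [MeasurableSpace Ω] {P : Measure Ω} [IsProbabilityMeasure P]
  {d p k q L : ℕ} {D : Panel Ω d p} {A : Procedure Ω p k q L}
  {m : Vec d → ℝ → Vec k → Vec q} {β₀ : Vec p} {μ₀ : Vec k} {g ρ : ℝ} {Θ : Set (Vec k)}
  {G : Matrix (Fin q) (Fin k) ℝ} {Om Υ : Matrix (Fin q) (Fin q) ℝ}

theorem tendstoInDistribution_influence (hs : Sampling P D) (hA : A.IsValid D m P Θ)
    (hmodel : ModelAssumption P D m β₀ μ₀) (hrate : RateAssumption P D A m β₀ μ₀ g)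
    (hmom : MomentAssumption P D A m β₀ μ₀) (hOm : OmegaAssumption P D A m β₀ μ₀ ρ Om)
    (hG : G.rank = k) (hΥ : Υ.PosDef) :
    TendstoInDistribution
      (fun N ω => clmOfMatrix (influence G Υ) (mstarSum P D A m β₀ μ₀ N ω)) atTop id (fun _ => P)
      (multivariateGaussian 0 (sandwich G Υ Om)) := by
  have h := (tendstoInDistribution_mstarSum hs hA hmodel hrate hmom hOm).continuous_comp
    (g := clmOfMatrix (influence G Υ)) (by fun_prop)
  refine ⟨h.forall_aemeasurable, by fun_prop, ?_⟩
  have hlim : (multivariateGaussian 0 Om).map (clmOfMatrix (influence G Υ) ∘ id) =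
      (multivariateGaussian 0 (sandwich G Υ Om)).map id := by
    rw [Measure.map_id, Function.comp_id,
      map_clmOfMatrix_multivariateGaussian (posSemidef_Om hOm), influence_mul_mul_transpose hG hΥ]
  exact (congrArg (fun μ : ProbabilityMeasure (Vec k) => Tendsto _ atTop (𝓝 μ))
    (Subtype.ext hlim)).mp h.tendsto

/-- The rate `N^{-1/2}` of `μ̂`, obtained along with its asymptotic linearity, is what permits
plugging it into `Ω̂`. -/
theorem tendsto_Vhat (hs : Sampling P D) (hA : A.IsValid D m P Θ)
    (hmodel : ModelAssumption P D m β₀ μ₀) (hrate : RateAssumption P D A m β₀ μ₀ g)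
    (halpha : FixedEffectAssumption P D A m β₀ μ₀ g) (hmom : MomentAssumption P D A m β₀ μ₀)
    (hρ : 0 < ρ) (hΘ : Θ ∈ 𝓝 μ₀) (hOm : OmegaAssumption P D A m β₀ μ₀ ρ Om)
    (hG : JacobianAssumption P D m μ₀ ρ G) (hΥ : WeightingAssumption P D A m μ₀ ρ Om Υ)
    (hμ : Tendsto (fun z : ℕ × Ω => A.μhat z.1 z.2) (wpa P) (𝓝 μ₀)) :
    Tendsto (fun z : ℕ × Ω => A.Vhat D m z.1 z.2) (wpa P) (𝓝 (sandwich G Υ Om)) := by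
  obtain ⟨h1, -, h3⟩ := tendsto_sub_influence hs hA hmodel hrate halpha hmom hρ hΘ hOm hG hΥ hμ
  have h4 : Tight (wpa P) fun z : ℕ × Ω => √(z.1 : ℝ) * ‖A.μhat z.1 z.2 - μ₀‖ := by
    simpa only [norm_smul, Real.norm_of_nonneg (Real.sqrt_nonneg _)] using h1
  have h5 := tendsto_secondMoment hs hA hmodel hrate halpha hmom hOm
    (ν := fun _ z => A.μhat z.1 z.2) fun l =>
      tendsto_foldAvg_moment_sub_of_tight hs hA hmodel hrate halpha hρ hOm hG hμ h4 l
  exact tendsto_sandwich hΥ.1 hG.full_rank h3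
    (tendsto_weights hs hA hmodel hrate halpha hmom hρ hOm hΥ) h5

end OrthMoment


theorem theorem1 {Ω : Type*} [MeasurableSpace Ω] (P : Measure Ω) [IsProbabilityMeasure P]
    {d p k q L : ℕ} (D : Panel Ω d p) (A : Procedure Ω p k q L)
    (m : Vec d → ℝ → Vec k → Vec q) (Θ : Set (Vec k)) (β₀ : Vec p) (μ₀ : Vec k) (g ρ : ℝ)
    (G : Matrix (Fin q) (Fin k) ℝ) (Om Υ : Matrix (Fin q) (Fin q) ℝ)
    (hρ : 0 < ρ) (hΘ : Θ ∈ 𝓝 μ₀)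
    (hA : A.IsValid D m P Θ)
    (hsampling : Sampling P D)
    (hmodel : ModelAssumption P D m β₀ μ₀)
    (hrate : RateAssumption P D A m β₀ μ₀ g)
    (halpha : FixedEffectAssumption P D A m β₀ μ₀ g)
    (hmom : MomentAssumption P D A m β₀ μ₀)
    (hOm : OmegaAssumption P D A m β₀ μ₀ ρ Om)
    (hG : JacobianAssumption P D m μ₀ ρ G)
    (hΥ : WeightingAssumption P D A m μ₀ ρ Om Υ)
    (hconsistent : TendstoInMeasure P A.μhat atTop fun _ => μ₀) :
    TendstoInDistribution (fun (N : ℕ) ω => Real.sqrt N • (A.μhat N ω - μ₀)) atTop id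
        (fun _ => P) (multivariateGaussian 0 (sandwich G Υ Om)) ∧
      ∀ r c, TendstoInMeasure P (fun N ω => A.Vhat D m N ω r c) atTop
        fun _ => sandwich G Υ Om r c := by
  have hμ := (tendsto_wpa_iff (P := P)).2 hconsistent
  refine ⟨?_, fun r c => tendsto_wpa_iff.1 (tendsto_matrix_iff.1 (tendsto_Vhat hsampling hA hmodel
    hrate halpha hmom hρ hΘ hOm hG hΥ hμ) r c)⟩
  -- Slutsky: the normalized estimator differs from its influence representation by a term that
  -- vanishes in probability.
  refine tendstoInDistribution_of_tendstoInMeasure_sub _ _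
    (tendstoInDistribution_influence hsampling hA hmodel hrate hmom hOm hG.full_rank hΥ.1) ?_ ?_
  · exact tendsto_wpa_iff.1
      (tendsto_sub_influence hsampling hA hmodel hrate halpha hmom hρ hΘ hOm hG hΥ hμ).2.1
  · exact fun N => (((hA.μhat_meas N).sub_const μ₀).const_smul (√(N : ℝ))).aemeasurable
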